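/- Let $k$ be a field of characteristic $0$, let $H$ be a Hopf algebra over $k$ with bijective antipode, and let $V$ be a finite-dimensional (left) Yetter--Drinfeld module over $H$ with braiding $c(v\otimes w)=v_{(-1)}w\otimes v_{(0)}$. For $n\ge 0$ let $\Delta_{1^n}:V^{\otimes n}\to V^{\otimes n}$ be the quantum symmetrizer, that is, the component in $V\otimes\cdots\otimes V$ of the iterated braided comultiplication of the tensor algebra $T(V)$, in which $V$ is primitive. The Nichols algebra of $V$ is $\mathcal B(V)=T(V)/\bigoplus_{n\ge2}\ker\Delta_{1^n}$; the Nichols algebra of any braided vector space is defined in the same way. Let $R$ be a subring of $k$ and let $V_R$ be an $R$-order of $V$: a finitely generated projective $R$-submodule $V_R\subseteq V$ such that the canonical map $k\otimes_R V_R\to V$ is bijective, $c(V_R^{\otimes 2})\subseteq V_R^{\otimes 2}$ and $c^{-1}(V_R^{\otimes 2})\subseteq V_R^{\otimes 2}$. Put $$\mathcal B(V_R)=\bigoplus_{n\ge0}\mathcal B^n(V_R),\qquad \mathcal B^n(V_R)=V_R^{\otimes n}/\bigl(V_R^{\otimes n}\cap\ker\Delta_{1^n}\bigr).$$ Let $\mathfrak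 m$ be a maximal ideal of $R$ and let $V_{R,\mathfrak m}=R/\mathfrak m\otimes_R V_R$, which is the degree one part of $B=R/\mathfrak m\otimes_R\mathcal B(V_R)$. Give $B$ the braiding $c_B$ and the comultiplication $\Delta_B$ induced by those of the tensor algebra $T(V_R)$. Let $W\subseteq\bigoplus_{n\ge2}R/\mathfrak m\otimes_R\mathcal B^n(V_R)$ be an $R/\mathfrak m$-subspace that is categorical in $B$, i.e. $c_B(W\otimes B)=B\otimes W$ and $c_B(B\otimes W)=W\otimes B$, and consists of primitive elements, i.e. $\Delta_B(w)=w\otimes1+1\otimes w$ for all $w\in W$. Regard $V_{R,\mathfrak m}\oplus W$ as a braided vector space with the restriction of $c_B$. If the Nichols algebra of $V_{R,\mathfrak m}\oplus W$ is infinite-dimensional over $R/\mathfrak m$, then $\mathcal B(V)$ is infinite-dimensional over $k$. -/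

import Mathlib

open scoped TensorProduct

namespace Nichols

noncomputable section

/-! ### Yetter-Drinfeld modules -/

/-- A (left-left) Yetter-Drinfeld module over the bialgebra `H`: a left `H`-module `V` with a
left coaction `δ : V → H ⊗ V`, `δ v = v₍₋₁₎ ⊗ v₍₀₎`, which is coassociative, counital, and satisfies
`(h₍₁₎ v)₍₋₁₎ h₍₂₎ ⊗ (h₍₁₎ v)₍₀₎ = h₍₁₎ v₍₋₁₎ ⊗ h₍₂₎ v₍₀₎`. -/
class YetterDrinfeld (k H V : Type*) [Field k] [Ring H] [Bialgebra k H]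
    [AddCommGroup V] [Module k V] [Module H V] [IsScalarTower k H V] where
  /-- The coaction. -/
  coact : V →ₗ[k] H ⊗[k] V
  coassoc : (TensorProduct.assoc k H H V).toLinearMap ∘ₗ
      (Coalgebra.comul (R := k) (A := H)).rTensor V ∘ₗ coact = coact.lTensor H ∘ₗ coact
  counit : (TensorProduct.lid k V).toLinearMap ∘ₗ
      (Coalgebra.counit (R := k) (A := H)).rTensor V ∘ₗ coact = LinearMap.id
  compat : ∀ (h : H) (v : V),
      (LinearMap.mul' k H).rTensor V (TensorProduct.rightComm k H V H
        ((coact ∘ₗ (Algebra.lsmul k k V : H →ₐ[k] Module.End k V).toLinearMap.flip v).rTensor H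
          (Coalgebra.comul (R := k) h))) =
      TensorProduct.map (LinearMap.mul' k H)
        (TensorProduct.lift (Algebra.lsmul k k V : H →ₐ[k] Module.End k V).toLinearMap)
        (TensorProduct.tensorTensorTensorComm k H H H V (Coalgebra.comul (R := k) h ⊗ₜ coact v))

/-- The braiding of a Yetter-Drinfeld module, `c (v ⊗ w) = v₍₋₁₎ w ⊗ v₍₀₎`. -/
def ydBraiding (k H V : Type*) [Field k] [Ring H] [Bialgebra k H]
    [AddCommGroup V] [Module k V] [Module H V] [IsScalarTower k H V] [YetterDrinfeld k H V] :
    V ⊗[k] V →ₗ[k] V ⊗[k] V :=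
  (TensorProduct.lift (Algebra.lsmul k k V : H →ₐ[k] Module.End k V).toLinearMap).rTensor V ∘ₗ
    (TensorProduct.rightComm k H V V).toLinearMap ∘ₗ
    (YetterDrinfeld.coact (k := k) (H := H) (V := V)).rTensor V

/-! ### The tensor algebra of a braided module

Throughout, `c : M ⊗ M → M ⊗ M` is the braiding and `T = TensorAlgebra R M`. -/

section TensorAlgebra

variable {R M : Type*} [CommRing R] [AddCommGroup M] [Module R M]

/-- Right multiplication of `T` by a vector, `t ⊗ v ↦ t v`. -/
def mulVec (R M : Type*) [CommRing R] [AddCommGroup M] [Module R M] :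
    TensorAlgebra R M ⊗[R] M →ₗ[R] TensorAlgebra R M :=
  LinearMap.mul' R (TensorAlgebra R M) ∘ₗ (TensorAlgebra.ι R).lTensor (TensorAlgebra R M)

/-- Left multiplication of `T` by a vector, `v ⊗ t ↦ v t`. -/
def vecMul (R M : Type*) [CommRing R] [AddCommGroup M] [Module R M] :
    M ⊗[R] TensorAlgebra R M →ₗ[R] TensorAlgebra R M :=
  LinearMap.mul' R (TensorAlgebra R M) ∘ₗ (TensorAlgebra.ι R).rTensor (TensorAlgebra R M)

/-- One crossing: for `w : M`, the operator `t ⊗ v ↦ ∑ t w' ⊗ v'` on `T ⊗ M`, where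
`c (v ⊗ w) = ∑ w' ⊗ v'`. -/
def crossing (c : M ⊗[R] M →ₗ[R] M ⊗[R] M) :
    M →ₗ[R] Module.End R (TensorAlgebra R M ⊗[R] M) :=
  (TensorProduct.curry
    ((mulVec R M).rTensor M ∘ₗ
      (TensorProduct.assoc R (TensorAlgebra R M) M M).symm.toLinearMap ∘ₗ
      c.lTensor (TensorAlgebra R M) ∘ₗ
      (TensorProduct.assoc R (TensorAlgebra R M) M M).toLinearMap)).flip

/-- The braiding `c_{M,T} : M ⊗ T → T ⊗ M`: the vector is moved through the letters of `t` one
after the other, from left to right. -/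
def vecBraiding (c : M ⊗[R] M →ₗ[R] M ⊗[R] M) :
    M ⊗[R] TensorAlgebra R M →ₗ[R] TensorAlgebra R M ⊗[R] M :=
  TensorProduct.lift
    (((MulOpposite.opLinearEquiv R).symm.toLinearMap ∘ₗ
      (TensorAlgebra.lift R
        ((MulOpposite.opLinearEquiv R).toLinearMap ∘ₗ crossing c)).toLinearMap).flip ∘ₗ
      TensorProduct.mk R (TensorAlgebra R M) M 1)

/-- Left multiplication by `1 ⊗ v` in the braided tensor product algebra `T ⊗ T`, that is
`s ⊗ t ↦ ∑ s' ⊗ v' t`, where `c_{M,T} (v ⊗ s) = ∑ s' ⊗ v'`. -/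
def rightVecMul (c : M ⊗[R] M →ₗ[R] M ⊗[R] M) :
    M →ₗ[R] Module.End R (TensorAlgebra R M ⊗[R] TensorAlgebra R M) :=
  TensorProduct.curry
    ((vecMul R M).lTensor (TensorAlgebra R M) ∘ₗ
      (TensorProduct.assoc R (TensorAlgebra R M) M (TensorAlgebra R M)).toLinearMap ∘ₗ
      (vecBraiding c).rTensor (TensorAlgebra R M) ∘ₗ
      (TensorProduct.assoc R M (TensorAlgebra R M) (TensorAlgebra R M)).symm.toLinearMap)

/-- Left multiplication by `v ⊗ 1` in `T ⊗ T`, that is `s ⊗ t ↦ v s ⊗ t`. -/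
def leftVecMul (R M : Type*) [CommRing R] [AddCommGroup M] [Module R M] :
    M →ₗ[R] Module.End R (TensorAlgebra R M ⊗[R] TensorAlgebra R M) :=
  TensorProduct.curry
    ((vecMul R M).rTensor (TensorAlgebra R M) ∘ₗ
      (TensorProduct.assoc R M (TensorAlgebra R M) (TensorAlgebra R M)).symm.toLinearMap)

/-- The braiding `c_{T,T} : T ⊗ T → T ⊗ T` extending `c`:
`s ⊗ t ↦ (1 ⊗ s) (t ⊗ 1)` in the braided tensor product algebra. -/
def tensorBraiding (c : M ⊗[R] M →ₗ[R] M ⊗[R] M) :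
    TensorAlgebra R M ⊗[R] TensorAlgebra R M →ₗ[R] TensorAlgebra R M ⊗[R] TensorAlgebra R M :=
  TensorProduct.lift
    (LinearMap.lcomp R _ ((TensorProduct.mk R (TensorAlgebra R M) (TensorAlgebra R M)).flip 1) ∘ₗ
      (TensorAlgebra.lift R (rightVecMul c)).toLinearMap)

/-- The comultiplication `Δ : T → T ⊗ T`: the algebra map to the braided tensor product algebra
with `Δ v = v ⊗ 1 + 1 ⊗ v` for `v ∈ M`. Here `Δ (v₁ ⋯ vₙ)` is computed by applying the left
multiplications by `Δ vₙ, …, Δ v₁` to `1 ⊗ 1`. -/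
def comul (c : M ⊗[R] M →ₗ[R] M ⊗[R] M) :
    TensorAlgebra R M →ₗ[R] TensorAlgebra R M ⊗[R] TensorAlgebra R M :=
  LinearMap.applyₗ (1 ⊗ₜ[R] 1) ∘ₗ
    (TensorAlgebra.lift R (leftVecMul R M + rightVecMul c)).toLinearMap

/-- The degree `n` part `Tⁿ(M)` of the tensor algebra. -/
def tensorDegree (R M : Type*) [CommRing R] [AddCommGroup M] [Module R M] (n : ℕ) :
    Submodule R (TensorAlgebra R M) :=
  LinearMap.range (TensorAlgebra.ι R : M →ₗ[R] TensorAlgebra R M) ^ n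

/-- The quantum symmetrizer `Δ_{1ⁿ} : Tⁿ(M) → Tⁿ(M)`, the component of the iterated
comultiplication in `M ⊗ ⋯ ⊗ M` (`n` factors), extended by zero to the other degrees of `T`.
It is computed through `Δ_{1ⁿ⁺¹} = (id ⊗ Δ_{1ⁿ}) Δ_{1,n}`; note that `TensorAlgebra.ιInv` is the
projection of `T` to its degree one part and `TensorAlgebra.algebraMapInv` the one to degree
zero. -/
def symmetrizer (c : M ⊗[R] M →ₗ[R] M ⊗[R] M) :
    ℕ → (TensorAlgebra R M →ₗ[R] TensorAlgebra R M)
  | 0 => Algebra.linearMap R (TensorAlgebra R M) ∘ₗ TensorAlgebra.algebraMapInv.toLinearMap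
  | n + 1 => vecMul R M ∘ₗ TensorProduct.map TensorAlgebra.ιInv (symmetrizer c n) ∘ₗ comul c

/-- `I(M) = ⨁_{n ≥ 2} ker (Δ_{1ⁿ} : Tⁿ(M) → Tⁿ(M))`. -/
def nicholsIdeal (c : M ⊗[R] M →ₗ[R] M ⊗[R] M) : Submodule R (TensorAlgebra R M) :=
  ⨆ n ≥ 2, tensorDegree R M n ⊓ LinearMap.ker (symmetrizer c n)

/-- The Nichols algebra `B(M) = T(M) / I(M)` (only its module structure is needed here). -/
abbrev NicholsAlgebra (c : M ⊗[R] M →ₗ[R] M ⊗[R] M) : Type _ :=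
  TensorAlgebra R M ⧸ nicholsIdeal c

end TensorAlgebra

/-! ### Maps of braided modules -/

section Maps

variable {R K M N : Type*} [CommRing R] [CommRing K] [Algebra R K] [AddCommGroup M] [Module R M]
  [AddCommGroup N] [Module R N] [Module K N] [IsScalarTower R K N]

/-- The map `M ⊗_R M → N ⊗_K N`, `x ⊗ y ↦ f x ⊗ f y`, for an `R`-linear map `f : M → N` into a
module over the `R`-algebra `K`. -/
def tensorSq (K : Type*) [CommRing K] [Algebra R K] [Module K N] [IsScalarTower R K N]
    (f : M →ₗ[R] N) : M ⊗[R] M →ₗ[R] N ⊗[K] N :=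
  TensorProduct.lift ((((TensorProduct.mk K N N).restrictScalars₁₂ R R).compl₂ f) ∘ₗ f)

/-- The `R`-linear map `f : M → N` is compatible with `c` on `M ⊗_R M` and `d` on `N ⊗_K N`. -/
def IsBraidedMap (f : M →ₗ[R] N) (c : M ⊗[R] M →ₗ[R] M ⊗[R] M) (d : N ⊗[K] N →ₗ[K] N ⊗[K] N) :
    Prop :=
  ∀ z : M ⊗[R] M, d (tensorSq K f z) = tensorSq K f (c z)

open Classical in
/-- The restriction of the braiding `d` of `N` along `f : M → N`. It is only used when
`f ⊗ f` is injective and `d` maps the image of `f ⊗ f` to itself, so that the restriction exists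
and is unique. -/
def restrictBraiding (f : M →ₗ[R] N) (d : N ⊗[K] N →ₗ[K] N ⊗[K] N) :
    M ⊗[R] M →ₗ[R] M ⊗[R] M :=
  if h : ∃ c, IsBraidedMap f c d then h.choose else 0

open Classical in
/-- The braiding on `N` induced by the braiding `c` of `M` along `f : M → N`. It is only used when
the image of `f ⊗ f` spans `N ⊗_K N` and `c` is compatible with the relations, so that the induced
braiding exists and is unique. -/
def inducedBraiding (K : Type*) [CommRing K] [Algebra R K] [Module K N] [IsScalarTower R K N]
    (f : M →ₗ[R] N) (c : M ⊗[R] M →ₗ[R] M ⊗[R] M) :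
    N ⊗[K] N →ₗ[K] N ⊗[K] N :=
  if h : ∃ d, IsBraidedMap f c d then h.choose else 0

end Maps

/-- A subspace `U` of the braided vector space `(E, c)` is categorical if
`c (U ⊗ E) = E ⊗ U` and `c (E ⊗ U) = U ⊗ E`. -/
def IsCategorical {K E : Type*} [CommRing K] [AddCommGroup E] [Module K E]
    (c : E ⊗[K] E →ₗ[K] E ⊗[K] E) (U : Submodule K E) : Prop :=
  (LinearMap.range (U.subtype.rTensor E)).map c = LinearMap.range (U.subtype.lTensor E) ∧
  (LinearMap.range (U.subtype.lTensor E)).map c = LinearMap.range (U.subtype.rTensor E)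

/-! ### Orders and their Nichols algebras -/

section Order

variable {k V : Type*} [Field k] [AddCommGroup V] [Module k V]

/-- `VR` is an `R`-order of the braided vector space `(V, c)`. In the last two conditions,
`VR ⊗ VR` is regarded as an `R`-submodule of `V ⊗ V`. -/
structure IsOrder (c : V ⊗[k] V →ₗ[k] V ⊗[k] V) (R : Subring k) (VR : Submodule R V) : Prop where
  finite : Module.Finite R VR
  projective : Module.Projective R VR
  bijective : Function.Bijective (VR.subtype.liftBaseChange k)
  map_le : (LinearMap.range (tensorSq k VR.subtype)).map (c.restrictScalars R) ≤
    LinearMap.range (tensorSq k VR.subtype)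
  comap_le : (LinearMap.range (tensorSq k VR.subtype)).comap (c.restrictScalars R) ≤
    LinearMap.range (tensorSq k VR.subtype)

/-- The canonical map `T(V_R) → T(V)`. -/
def orderTensor (R : Subring k) (VR : Submodule R V) :
    TensorAlgebra R VR →ₐ[R] TensorAlgebra k V :=
  TensorAlgebra.lift R ((TensorAlgebra.ι k).restrictScalars R ∘ₗ VR.subtype)

/-- The elements of `T(V_R)` whose image in `T(V)` lies in `I(V)`, that is
`⨁ₙ (V_R^{⊗ n} ∩ ker Δ_{1ⁿ})`. -/
def orderIdeal (c : V ⊗[k] V →ₗ[k] V ⊗[k] V) (R : Subring k) (VR : Submodule R V) :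
    Submodule R (TensorAlgebra R VR) :=
  ((nicholsIdeal c).restrictScalars R).comap (orderTensor R VR).toLinearMap

/-- The Nichols algebra `B(V_R) = ⨁ₙ V_R^{⊗ n} / (V_R^{⊗ n} ∩ ker Δ_{1ⁿ})` of the order `V_R`. -/
abbrev OrderNichols (c : V ⊗[k] V →ₗ[k] V ⊗[k] V) (R : Subring k) (VR : Submodule R V) : Type _ :=
  TensorAlgebra R VR ⧸ orderIdeal c R VR

/-- The degree `n` part `Bⁿ(V_R)`. -/
def orderDegree (c : V ⊗[k] V →ₗ[k] V ⊗[k] V) (R : Subring k) (VR : Submodule R V) (n : ℕ) :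
    Submodule R (OrderNichols c R VR) :=
  (tensorDegree R VR n).map (orderIdeal c R VR).mkQ

/-- The specialization `K ⊗_R B(V_R)` of the Nichols algebra of `V_R` to an `R`-algebra `K`. -/
abbrev Specialized (c : V ⊗[k] V →ₗ[k] V ⊗[k] V) (R : Subring k) (VR : Submodule R V)
    (K : Type*) [CommRing K] [Algebra R K] : Type _ :=
  K ⊗[R] OrderNichols c R VR

variable (c : V ⊗[k] V →ₗ[k] V ⊗[k] V) (R : Subring k) (VR : Submodule R V)
  (K : Type*) [CommRing K] [Algebra R K]

/-- The canonical map `T(V_R) → K ⊗_R B(V_R)`, `t ↦ 1 ⊗ [t]`. -/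
def specMk : TensorAlgebra R VR →ₗ[R] Specialized c R VR K :=
  TensorProduct.mk R K (OrderNichols c R VR) 1 ∘ₗ (orderIdeal c R VR).mkQ

/-- The part `⨁_{n ≥ d} K ⊗_R Bⁿ(V_R)` of `K ⊗_R B(V_R)`. -/
def specDegreeGE (d : ℕ) : Submodule K (Specialized c R VR K) :=
  ⨆ n ≥ d, (orderDegree c R VR n).baseChange K

/-- The braiding of `V_R`, which is the restriction of `c`. -/
def orderBraiding : VR ⊗[R] VR →ₗ[R] VR ⊗[R] VR :=
  restrictBraiding VR.subtype c

/-- The braiding of `K ⊗_R B(V_R)`, which is induced by the braiding of `T(V_R)`. -/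
def specBraiding : Specialized c R VR K ⊗[K] Specialized c R VR K →ₗ[K]
    Specialized c R VR K ⊗[K] Specialized c R VR K :=
  inducedBraiding K (specMk c R VR K) (tensorBraiding (orderBraiding c R VR))

/-- `D` is compatible with the comultiplication of `T(V_R)`. As the image of `T(V_R)` spans
`K ⊗_R B(V_R)`, there is at most one such `D`. -/
def IsSpecComul (D : Specialized c R VR K →ₗ[K] Specialized c R VR K ⊗[K] Specialized c R VR K) :
    Prop :=
  ∀ t : TensorAlgebra R VR,
    D (specMk c R VR K t) = tensorSq K (specMk c R VR K) (comul (orderBraiding c R VR) t)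

open Classical in
/-- The comultiplication of `K ⊗_R B(V_R)`, which is induced by the comultiplication of `T(V_R)`.
If `R` is so bad that the latter does not pass to the quotient (this never happens for a
Dedekind domain), then it is set to zero, and `0` is the only primitive element of positive
degree. -/
def specComul : Specialized c R VR K →ₗ[K] Specialized c R VR K ⊗[K] Specialized c R VR K :=
  if h : ∃ D, IsSpecComul c R VR K D then h.choose else 0

/-- `x` is a primitive element of `K ⊗_R B(V_R)`: `Δ x = x ⊗ 1 + 1 ⊗ x`. -/
def IsPrimitive (x : Specialized c R VR K) : Prop :=
  specComul c R VR K x = x ⊗ₜ[K] specMk c R VR K 1 + specMk c R VR K 1 ⊗ₜ[K] x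

/-- The canonical map `K ⊗_R V_R → K ⊗_R B(V_R)` onto the degree one part. -/
def specVec : K ⊗[R] VR →ₗ[K] Specialized c R VR K :=
  ((orderIdeal c R VR).mkQ ∘ₗ TensorAlgebra.ι R).baseChange K

/-- The direct sum `V_{R,K} ⊕ W`, where `V_{R,K} = K ⊗_R V_R`, for a subspace `W` of
`K ⊗_R B(V_R)`. -/
abbrev SumSpace (W : Submodule K (Specialized c R VR K)) : Type _ :=
  (K ⊗[R] VR) × W

/-- The braiding of `V_{R,K} ⊕ W`: the restriction of the braiding of `K ⊗_R B(V_R)` along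
`(u, w) ↦ u + w`. -/
def sumBraiding (W : Submodule K (Specialized c R VR K)) :
    SumSpace c R VR K W ⊗[K] SumSpace c R VR K W →ₗ[K]
      SumSpace c R VR K W ⊗[K] SumSpace c R VR K W :=
  restrictBraiding (K := K) (M := SumSpace c R VR K W) (N := Specialized c R VR K)
    ((specVec c R VR K).coprod W.subtype) (specBraiding c R VR K)

/-- The Nichols algebra `B(V_{R,K} ⊕ W)`. -/
abbrev SumNichols (W : Submodule K (Specialized c R VR K)) : Type _ :=
  NicholsAlgebra (M := SumSpace c R VR K W) (sumBraiding c R VR K W)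

end Order

end

end Nichols

/-!
Let `B = K ⊗_R B(V_R)` and `U = V_{R,K} ⊕ W ⊆ B`. As `U` is categorical and consists of primitive
elements, the evaluation `T(U) → B`, which multiplies in `B`, commutes with the braidings and the
comultiplications. Hence, on tensors of degree at most `n`, the quantum symmetrizer `Δ_{1ⁿ}` of `U`
factors through `B`: take the iterated comultiplication of the evaluation and project each factor
to `U`.

If `B(V)` is finite-dimensional, then almost all quantum symmetrizers of `V` vanish, so `B(V_R)`
lives in finitely many degrees and `B` is a noetherian `K`-module. So there is an `N` such that
every tensor over `U` has the same evaluation as one of degree less than `N`, where `Δ_{1ⁿ}`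
vanishes for `n ≥ N`. Therefore almost all quantum symmetrizers of `U` vanish, and the Nichols
algebra of `U` is finite over `K`.
-/

namespace Nichols

/-! ### Skew derivations and quantum symmetrizers -/

section Assoc

variable {R N X Y Z : Type*} [CommRing R] [AddCommGroup N] [Module R N] [AddCommGroup X]
  [Module R X] [AddCommGroup Y] [Module R Y] [AddCommGroup Z] [Module R Z] (f : X ⊗[R] Y →ₗ[R] Z)

theorem lTensor_assoc_tmul (p : N ⊗[R] X) (y : Y) :
    f.lTensor N (TensorProduct.assoc R N X Y (p ⊗ₜ y)) =
      (f ∘ₗ (TensorProduct.mk R X Y).flip y).lTensor N p := by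
  induction p with
  | zero => simp only [TensorProduct.zero_tmul, map_zero]
  | tmul a b => simp
  | add a b ha hb => simp only [TensorProduct.add_tmul, map_add, ha, hb]

theorem rTensor_assoc_symm_tmul (x : X) (p : Y ⊗[R] N) :
    f.rTensor N ((TensorProduct.assoc R X Y N).symm (x ⊗ₜ p)) =
      (f ∘ₗ TensorProduct.mk R X Y x).rTensor N p := by
  induction p with
  | zero => simp only [TensorProduct.tmul_zero, map_zero]
  | tmul a b => simp
  | add a b ha hb => simp only [TensorProduct.tmul_add, map_add, ha, hb]

end Assoc

section TensorAlgebra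

open TensorAlgebra (ι ιInv algebraMapInv)

variable {R M : Type*} [CommRing R] [AddCommGroup M] [Module R M]

local notation "T" => TensorAlgebra R M
local notation "ε" => AlgHom.toLinearMap (algebraMapInv (R := R) (M := M))
local notation "π" => ιInv (R := R) (M := M)

theorem algebraMapInv_ι (v : M) : algebraMapInv (ι R v) = (0 : R) := by
  simp [algebraMapInv]

theorem ιInv_ι (v : M) : ιInv (ι R v) = v :=
  TensorAlgebra.ι_leftInverse v

theorem ιInv_mul (x y : T) :
    ιInv (x * y) = algebraMapInv x • ιInv y + algebraMapInv y • ιInv x := by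
  let : Module Rᵐᵒᵖ M := Module.compHom _ ((RingHom.id R).fromOpposite mul_comm)
  have : IsCentralScalar R M := ⟨fun _ _ => rfl⟩
  have fst_eq (z : T) : (TensorAlgebra.toTrivSqZeroExt z).fst = algebraMapInv z := by
    have : (TrivSqZeroExt.fstHom R R M).comp TensorAlgebra.toTrivSqZeroExt = algebraMapInv := by
      ext v
      simp [algebraMapInv, TensorAlgebra.toTrivSqZeroExt_ι]
    exact DFunLike.congr_fun this z
  change (TensorAlgebra.toTrivSqZeroExt (x * y)).snd = algebraMapInv x •
    (TensorAlgebra.toTrivSqZeroExt y).snd + algebraMapInv y • (TensorAlgebra.toTrivSqZeroExt x).snd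
  rw [map_mul, TrivSqZeroExt.snd_mul, fst_eq, fst_eq, op_smul_eq_smul]

theorem ιInv_one : ιInv (1 : T) = 0 := by
  simpa using ιInv_mul (1 : T) 1

theorem ιInv_algebraMap (r : R) : ιInv (algebraMap R T r) = 0 := by
  rw [Algebra.algebraMap_eq_smul_one, map_smul, ιInv_one, smul_zero]

theorem ιInv_ι_mul (v : M) (x : T) : ιInv (ι R v * x) = algebraMapInv x • v := by
  simp [ιInv_mul, algebraMapInv_ι, ιInv_ι]

theorem ιInv_mul_ι (x : T) (v : M) : ιInv (x * ι R v) = algebraMapInv x • v := by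
  simp [ιInv_mul, algebraMapInv_ι, ιInv_ι]

theorem tensorAlgebra_induction_left {P : T → Prop} (x : T)
    (one : P 1) (smul : ∀ (r : R) x, P x → P (r • x)) (add : ∀ x y, P x → P y → P (x + y))
    (ι_mul : ∀ v x, P x → P (ι R v * x)) : P x := by
  suffices ∀ y, P y → P (x * y) by simpa using this 1 one
  induction x using TensorAlgebra.induction with
  | algebraMap r => intro y hy; rw [← Algebra.smul_def]; exact smul r y hy
  | ι v => exact ι_mul v
  | mul a b ha hb => intro y hy; rw [mul_assoc]; exact ha _ (hb _ hy)
  | add a b ha hb => intro y hy; rw [add_mul]; exact add _ _ (ha _ hy) (hb _ hy)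

theorem tensorAlgebra_induction_right {P : T → Prop} (x : T)
    (one : P 1) (smul : ∀ (r : R) x, P x → P (r • x)) (add : ∀ x y, P x → P y → P (x + y))
    (mul_ι : ∀ x v, P x → P (x * ι R v)) : P x := by
  suffices ∀ y, P y → P (y * x) by simpa using this 1 one
  induction x using TensorAlgebra.induction with
  | algebraMap r =>
    intro y hy; rw [← Algebra.commutes, ← Algebra.smul_def]; exact smul r y hy
  | ι v => exact fun y => mul_ι y v
  | mul a b ha hb => intro y hy; rw [← mul_assoc]; exact hb _ (ha _ hy)
  | add a b ha hb => intro y hy; rw [mul_add]; exact add _ _ (ha _ hy) (hb _ hy)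

theorem linearMap_ext_left {X : Type*} [AddCommGroup X] [Module R X] {F G : T →ₗ[R] X}
    (one : F 1 = G 1) (ι_mul : ∀ v x, F x = G x → F (ι R v * x) = G (ι R v * x)) : F = G := by
  ext x
  induction x using tensorAlgebra_induction_left with
  | one => exact one
  | smul r x hx => rw [map_smul, map_smul, hx]
  | add x y hx hy => rw [map_add, map_add, hx, hy]
  | ι_mul v x hx => exact ι_mul v x hx

theorem linearMap_ext_right {X : Type*} [AddCommGroup X] [Module R X] {F G : T →ₗ[R] X}
    (one : F 1 = G 1) (mul_ι : ∀ x v, F x = G x → F (x * ι R v) = G (x * ι R v)) : F = G := by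
  ext x
  induction x using tensorAlgebra_induction_right with
  | one => exact one
  | smul r x hx => rw [map_smul, map_smul, hx]
  | add x y hx hy => rw [map_add, map_add, hx, hy]
  | mul_ι x v hx => exact mul_ι x v hx

@[simp] theorem vecMul_tmul (v : M) (t : T) : vecMul R M (v ⊗ₜ t) = ι R v * t := by
  simp [vecMul]

@[simp] theorem mulVec_tmul (t : T) (v : M) : mulVec R M (t ⊗ₜ v) = t * ι R v := by
  simp [mulVec]

@[simp] theorem leftVecMul_tmul (v : M) (s t : T) :
    leftVecMul R M v (s ⊗ₜ t) = (ι R v * s) ⊗ₜ t := by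
  simp [leftVecMul]

theorem vecMul_comp_mk_flip (t : T) :
    vecMul R M ∘ₗ (TensorProduct.mk R M T).flip t = LinearMap.mulRight R t ∘ₗ ι R := by
  ext v
  simp

theorem mulVec_comp_mk (t : T) :
    mulVec R M ∘ₗ TensorProduct.mk R T M t = LinearMap.mulLeft R t ∘ₗ ι R := by
  ext v
  simp

variable (c : M ⊗[R] M →ₗ[R] M ⊗[R] M)

/-- The braiding `c ⊗ id` of the first two factors of `M ⊗ M ⊗ X`. -/
noncomputable def braidFirst (X : Type*) [AddCommGroup X] [Module R X] :
    M ⊗[R] (M ⊗[R] X) →ₗ[R] M ⊗[R] (M ⊗[R] X) :=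
  (TensorProduct.assoc R M M X).toLinearMap ∘ₗ c.rTensor X ∘ₗ
    (TensorProduct.assoc R M M X).symm.toLinearMap

theorem braidFirst_tmul {X : Type*} [AddCommGroup X] [Module R X] (v u : M) (x : X) :
    braidFirst c X (v ⊗ₜ (u ⊗ₜ x)) = TensorProduct.assoc R M M X (c (v ⊗ₜ u) ⊗ₜ x) := by
  simp [braidFirst]

theorem assoc_tmul_apply {X Y : Type*} [AddCommGroup X] [Module R X] [AddCommGroup Y] [Module R Y]
    (f : X →ₗ[R] Y) (p : M ⊗[R] M) (x : X) :
    TensorProduct.assoc R M M Y (p ⊗ₜ f x) =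
      (f.lTensor M).lTensor M (TensorProduct.assoc R M M X (p ⊗ₜ x)) := by
  induction p with
  | zero => simp only [TensorProduct.zero_tmul, map_zero]
  | tmul a b => simp only [TensorProduct.assoc_tmul, LinearMap.lTensor_tmul]
  | add a b ha hb => simp only [TensorProduct.add_tmul, map_add, ha, hb]

theorem braidFirst_comp_lTensor {X Y : Type*} [AddCommGroup X] [Module R X] [AddCommGroup Y]
    [Module R Y] (f : X →ₗ[R] Y) :
    braidFirst c Y ∘ₗ (f.lTensor M).lTensor M = (f.lTensor M).lTensor M ∘ₗ braidFirst c X := by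
  refine TensorProduct.ext' fun v z => ?_
  induction z with
  | zero => simp only [TensorProduct.tmul_zero, map_zero]
  | add a b ha hb => simp only [TensorProduct.tmul_add, map_add, ha, hb]
  | tmul u x =>
    simp only [LinearMap.comp_apply, LinearMap.lTensor_tmul, braidFirst_tmul, assoc_tmul_apply]

/-- The operator `u ⊗ t ↦ ∑ u' ⊗ v' t` on `M ⊗ T`, where `c (v ⊗ u) = ∑ u' ⊗ v'`. -/
noncomputable def letterAct : M →ₗ[R] Module.End R (M ⊗[R] T) :=
  TensorProduct.curry ((vecMul R M).lTensor M ∘ₗ braidFirst c T)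

theorem letterAct_apply (v : M) (z : M ⊗[R] T) :
    letterAct c v z = (vecMul R M).lTensor M (braidFirst c T (v ⊗ₜ z)) := rfl

theorem letterAct_tmul (v u : M) (t : T) :
    letterAct c v (u ⊗ₜ t) = (LinearMap.mulRight R t ∘ₗ ι R).lTensor M (c (v ⊗ₜ u)) := by
  rw [letterAct_apply, braidFirst_tmul, lTensor_assoc_tmul, vecMul_comp_mk_flip]

theorem crossing_tmul (u : M) (t : T) (v : M) :
    crossing c u (t ⊗ₜ v) = (LinearMap.mulLeft R t ∘ₗ ι R).rTensor M (c (v ⊗ₜ u)) := by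
  rw [← mulVec_comp_mk, ← rTensor_assoc_symm_tmul]
  simp [crossing]

theorem vecBraiding_one (v : M) : vecBraiding c (v ⊗ₜ 1) = 1 ⊗ₜ v := by
  simp [vecBraiding]

theorem vecBraiding_mul_ι (v : M) (t : T) (u : M) :
    vecBraiding c (v ⊗ₜ (t * ι R u)) = crossing c u (vecBraiding c (v ⊗ₜ t)) := by
  simp [vecBraiding]

theorem rightVecMul_tmul (v : M) (s t : T) :
    rightVecMul c v (s ⊗ₜ t) =
      (LinearMap.mulRight R t ∘ₗ ι R).lTensor T (vecBraiding c (v ⊗ₜ s)) := by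
  rw [← vecMul_comp_mk_flip, ← lTensor_assoc_tmul]
  simp [rightVecMul]

theorem rTensor_rightVecMul_tmul {X : Type*} [AddCommGroup X] [Module R X] (f : T →ₗ[R] X) (v : M)
    (s t : T) : f.rTensor T (rightVecMul c v (s ⊗ₜ t)) =
      (LinearMap.mulRight R t ∘ₗ ι R).lTensor X (f.rTensor M (vecBraiding c (v ⊗ₜ s))) := by
  rw [rightVecMul_tmul, ← LinearMap.comp_apply, LinearMap.rTensor_comp_lTensor,
    ← LinearMap.lTensor_comp_rTensor, LinearMap.comp_apply]

theorem counit_rTensor_comp_crossing (u : M) : (ε).rTensor M ∘ₗ crossing c u = 0 := by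
  refine TensorProduct.ext' fun t w => ?_
  have : ε ∘ₗ LinearMap.mulLeft R t ∘ₗ ι R = 0 := by ext; simp [algebraMapInv_ι]
  rw [LinearMap.comp_apply, crossing_tmul, ← LinearMap.rTensor_comp_apply, this,
    LinearMap.rTensor_zero, LinearMap.zero_apply, LinearMap.zero_apply]

theorem counit_vecBraiding (v : M) (s : T) :
    (ε).rTensor M (vecBraiding c (v ⊗ₜ s)) = algebraMapInv s ⊗ₜ v := by
  suffices (ε).rTensor M ∘ₗ vecBraiding c ∘ₗ TensorProduct.mk R M T v =
      (TensorProduct.mk R R M).flip v ∘ₗ ε from LinearMap.congr_fun this s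
  refine linearMap_ext_right ?_ fun x u _ => ?_
  · simp [vecBraiding_one]
  · have := LinearMap.congr_fun (counit_rTensor_comp_crossing c u) (vecBraiding c (v ⊗ₜ x))
    simpa [vecBraiding_mul_ι, algebraMapInv_ι] using this

theorem ιInv_crossing (u : M) (z : T ⊗[R] M) :
    (π).rTensor M (crossing c u z) = c (TensorProduct.lid R M ((ε).rTensor M z) ⊗ₜ u) := by
  induction z with
  | zero => simp only [map_zero, TensorProduct.zero_tmul]
  | add a b ha hb => simp only [map_add, ha, hb, TensorProduct.add_tmul]
  | tmul t w =>
    have : π ∘ₗ LinearMap.mulLeft R t ∘ₗ ι R = algebraMapInv t • LinearMap.id := by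
      ext; simp [ιInv_mul_ι]
    rw [crossing_tmul, ← LinearMap.rTensor_comp_apply, this]
    simp [LinearMap.rTensor_smul, ← TensorProduct.smul_tmul']

theorem ιInv_vecBraiding (v : M) (s : T) :
    (π).rTensor M (vecBraiding c (v ⊗ₜ s)) = c (v ⊗ₜ ιInv s) := by
  suffices (π).rTensor M ∘ₗ vecBraiding c ∘ₗ TensorProduct.mk R M T v =
      c ∘ₗ TensorProduct.mk R M M v ∘ₗ π from LinearMap.congr_fun this s
  refine linearMap_ext_right ?_ fun x u _ => ?_
  · simp [vecBraiding_one, ιInv_one]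
  · simp [vecBraiding_mul_ι, ιInv_crossing, counit_vecBraiding, ιInv_mul_ι,
      ← TensorProduct.smul_tmul']

theorem comul_one : comul c 1 = 1 ⊗ₜ 1 := by simp [comul]

theorem comul_ι_mul (v : M) (x : T) :
    comul c (ι R v * x) = leftVecMul R M v (comul c x) + rightVecMul c v (comul c x) := by
  simp [comul]

theorem counit_rTensor_comp_leftVecMul (v : M) : (ε).rTensor T ∘ₗ leftVecMul R M v = 0 := by
  ext s t
  simp [algebraMapInv_ι]

theorem counit_rTensor_comp_rightVecMul (v : M) :
    (ε).rTensor T ∘ₗ rightVecMul c v =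
      (LinearMap.mulLeft R (ι R v)).lTensor R ∘ₗ (ε).rTensor T := by
  refine TensorProduct.ext' fun s t => ?_
  rw [LinearMap.comp_apply, rTensor_rightVecMul_tmul, counit_vecBraiding]
  simp

theorem counit_comul (x : T) : (ε).rTensor T (comul c x) = 1 ⊗ₜ x := by
  suffices (ε).rTensor T ∘ₗ comul c = TensorProduct.mk R R T 1 from LinearMap.congr_fun this x
  refine linearMap_ext_left (by simp [comul_one]) fun v x hx => ?_
  have hl := LinearMap.congr_fun (counit_rTensor_comp_leftVecMul v) (comul c x)
  have hr := LinearMap.congr_fun (counit_rTensor_comp_rightVecMul c v) (comul c x)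
  simp only [LinearMap.comp_apply] at hl hr hx ⊢
  rw [comul_ι_mul, map_add, hl, hr, hx]
  simp

/-- The skew derivation `Δ_{1,*} : T → M ⊗ T`, the component of the comultiplication whose left
factor has degree one. -/
noncomputable def skewDer : T →ₗ[R] M ⊗[R] T :=
  (π).rTensor T ∘ₗ comul c

theorem ιInv_rTensor_comp_leftVecMul (v : M) :
    (π).rTensor T ∘ₗ leftVecMul R M v =
      TensorProduct.mk R M T v ∘ₗ TensorProduct.lid R T ∘ₗ (ε).rTensor T := by
  ext s t
  simp [ιInv_ι_mul, TensorProduct.smul_tmul]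

theorem ιInv_rTensor_comp_rightVecMul (v : M) :
    (π).rTensor T ∘ₗ rightVecMul c v = letterAct c v ∘ₗ (π).rTensor T := by
  refine TensorProduct.ext' fun s t => ?_
  rw [LinearMap.comp_apply, rTensor_rightVecMul_tmul, ιInv_vecBraiding, LinearMap.comp_apply,
    LinearMap.rTensor_tmul, letterAct_tmul]

theorem skewDer_one : skewDer c 1 = 0 := by
  simp [skewDer, comul_one, ιInv_one]

theorem skewDer_algebraMap (r : R) : skewDer c (algebraMap R T r) = 0 := by
  simp [Algebra.algebraMap_eq_smul_one, skewDer_one]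

theorem skewDer_ι_mul (v : M) (x : T) :
    skewDer c (ι R v * x) = v ⊗ₜ x + letterAct c v (skewDer c x) := by
  have hl := LinearMap.congr_fun (ιInv_rTensor_comp_leftVecMul v) (comul c x)
  have hr := LinearMap.congr_fun (ιInv_rTensor_comp_rightVecMul c v) (comul c x)
  simp only [LinearMap.comp_apply] at hl hr
  rw [skewDer, LinearMap.comp_apply, comul_ι_mul, map_add, hl, hr, counit_comul]
  simp

theorem vecMul_injective : Function.Injective (vecMul R M) := by
  -- For the zero braiding, `Δ_{1,*}` splits off the first letter.
  suffices skewDer 0 ∘ₗ vecMul R M = LinearMap.id from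
    Function.LeftInverse.injective (g := skewDer 0) (LinearMap.congr_fun this)
  refine TensorProduct.ext' fun v x => ?_
  have : letterAct (0 : M ⊗[R] M →ₗ[R] M ⊗[R] M) v = 0 := by
    ext
    simp [letterAct_tmul]
  simp [skewDer_ι_mul, this]

theorem symmetrizer_zero_apply (x : T) :
    symmetrizer c 0 x = algebraMap R T (algebraMapInv x) := rfl

theorem symmetrizer_succ_apply (n : ℕ) (x : T) :
    symmetrizer c (n + 1) x = vecMul R M ((symmetrizer c n).lTensor M (skewDer c x)) := by
  rw [skewDer, LinearMap.comp_apply, ← LinearMap.comp_apply (LinearMap.lTensor _ _),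
    LinearMap.lTensor_comp_rTensor]
  rfl

end TensorAlgebra

/-! ### Relations of the Nichols algebra -/

section TensorRange

variable {R M X : Type*} [CommRing R] [AddCommGroup M] [Module R M] [AddCommGroup X] [Module R X]
  {P : Submodule R X}

variable (M) in
/-- The image of `M ⊗ P` in `M ⊗ X` for a submodule `P` of `X`. -/
def lTensorRange (P : Submodule R X) : Submodule R (M ⊗[R] X) :=
  LinearMap.range (P.subtype.lTensor M)

variable (M) in
/-- The image of `P ⊗ M` in `X ⊗ M` for a submodule `P` of `X`. -/
def rTensorRange (P : Submodule R X) : Submodule R (X ⊗[R] M) :=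
  LinearMap.range (P.subtype.rTensor M)

theorem tmul_mem_lTensorRange (v : M) {x : X} (hx : x ∈ P) : v ⊗ₜ[R] x ∈ lTensorRange M P :=
  ⟨v ⊗ₜ ⟨x, hx⟩, by simp⟩

theorem tmul_mem_rTensorRange (v : M) {x : X} (hx : x ∈ P) : x ⊗ₜ[R] v ∈ rTensorRange M P :=
  ⟨⟨x, hx⟩ ⊗ₜ v, by simp⟩

theorem lTensorRange_le {Q : Submodule R (M ⊗[R] X)} (h : ∀ v, ∀ x ∈ P, v ⊗ₜ x ∈ Q) :
    lTensorRange M P ≤ Q := by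
  rintro _ ⟨z, rfl⟩
  induction z with
  | zero => simp
  | add a b ha hb => rw [map_add]; exact Q.add_mem ha hb
  | tmul v x => simpa using h v x x.2

theorem rTensorRange_le {Q : Submodule R (X ⊗[R] M)} (h : ∀ v, ∀ x ∈ P, x ⊗ₜ v ∈ Q) :
    rTensorRange M P ≤ Q := by
  rintro _ ⟨z, rfl⟩
  induction z with
  | zero => simp
  | add a b ha hb => rw [map_add]; exact Q.add_mem ha hb
  | tmul x v => simpa using h v x x.2

theorem lTensorRange_mono {Q : Submodule R X} (h : P ≤ Q) :
    lTensorRange M P ≤ lTensorRange M Q :=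
  lTensorRange_le fun v _ hx => tmul_mem_lTensorRange v (h hx)

theorem lTensor_eq_zero {Y : Type*} [AddCommGroup Y] [Module R Y] {f : X →ₗ[R] Y}
    (hf : ∀ x ∈ P, f x = 0) {z : M ⊗[R] X} (hz : z ∈ lTensorRange M P) : f.lTensor M z = 0 := by
  suffices lTensorRange M P ≤ LinearMap.ker (f.lTensor M) from this hz
  refine lTensorRange_le fun v x hx => ?_
  rw [LinearMap.mem_ker, LinearMap.lTensor_tmul, hf x hx, TensorProduct.tmul_zero]

theorem lTensor_mem_lTensorRange {Y : Type*} [AddCommGroup Y] [Module R Y] {f : Y →ₗ[R] X}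
    (hf : ∀ y, f y ∈ P) (z : M ⊗[R] Y) : f.lTensor M z ∈ lTensorRange M P := by
  rw [lTensorRange, ← LinearMap.subtype_comp_codRestrict f P hf, LinearMap.lTensor_comp]
  exact ⟨_, rfl⟩

theorem rTensor_mem_rTensorRange {Y : Type*} [AddCommGroup Y] [Module R Y] {f : Y →ₗ[R] X}
    (hf : ∀ y, f y ∈ P) (z : Y ⊗[R] M) : f.rTensor M z ∈ rTensorRange M P := by
  rw [rTensorRange, ← LinearMap.subtype_comp_codRestrict f P hf, LinearMap.rTensor_comp]
  exact ⟨_, rfl⟩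

end TensorRange

section Grading

open TensorAlgebra (ι ιInv algebraMapInv)

variable {R M : Type*} [CommRing R] [AddCommGroup M] [Module R M]

local notation "T" => TensorAlgebra R M

instance : GradedAlgebra (tensorDegree R M) :=
  TensorAlgebra.gradedAlgebra

theorem ι_mul_mem_tensorDegree (v : M) {n : ℕ} {x : T} (hx : x ∈ tensorDegree R M n) :
    ι R v * x ∈ tensorDegree R M (n + 1) := by
  rw [tensorDegree, pow_succ']
  exact Submodule.mul_mem_mul ⟨v, rfl⟩ hx

theorem mul_ι_mem_tensorDegree (v : M) {n : ℕ} {x : T} (hx : x ∈ tensorDegree R M n) :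
    x * ι R v ∈ tensorDegree R M (n + 1) := by
  rw [tensorDegree, pow_succ]
  exact Submodule.mul_mem_mul hx ⟨v, rfl⟩

theorem one_mem_tensorDegree_zero : (1 : T) ∈ tensorDegree R M 0 :=
  SetLike.GradedOne.one_mem

theorem mem_tensorDegree_zero {x : T} : x ∈ tensorDegree R M 0 ↔ ∃ r, algebraMap R T r = x := by
  simp [tensorDegree, Submodule.mem_one]

theorem mem_tensorDegree_one {x : T} : x ∈ tensorDegree R M 1 ↔ ∃ v, ι R v = x := by
  simp [tensorDegree]

theorem tensorDegree_succ_le {n : ℕ} {P : Submodule R T}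
    (h : ∀ v, ∀ x ∈ tensorDegree R M n, ι R v * x ∈ P) : tensorDegree R M (n + 1) ≤ P := by
  rw [tensorDegree, pow_succ', Submodule.mul_le]
  rintro _ ⟨v, rfl⟩ x hx
  exact h v x hx

theorem tensorDegree_succ_le_right {n : ℕ} {P : Submodule R T}
    (h : ∀ v, ∀ x ∈ tensorDegree R M n, x * ι R v ∈ P) : tensorDegree R M (n + 1) ≤ P := by
  rw [tensorDegree, pow_succ, Submodule.mul_le]
  rintro x hx _ ⟨v, rfl⟩
  exact h v x hx

theorem algebraMapInv_eq_zero_of_mem_tensorDegree {n : ℕ} {x : T}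
    (hx : x ∈ tensorDegree R M (n + 1)) : algebraMapInv x = 0 := by
  suffices tensorDegree R M (n + 1) ≤ LinearMap.ker (algebraMapInv (R := R) (M := M)).toLinearMap
    from this hx
  refine tensorDegree_succ_le fun v x _ => ?_
  simp [algebraMapInv_ι]

theorem ιInv_eq_zero_of_mem_tensorDegree {n : ℕ} (hn : n ≠ 1) {x : T}
    (hx : x ∈ tensorDegree R M n) : ιInv x = 0 := by
  match n, hn with
  | 0, _ =>
    obtain ⟨r, rfl⟩ := mem_tensorDegree_zero.mp hx
    exact ιInv_algebraMap r
  | n + 2, _ =>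
    suffices tensorDegree R M (n + 2) ≤ LinearMap.ker (ιInv (R := R) (M := M)) from this hx
    refine tensorDegree_succ_le fun v x hx => ?_
    rw [LinearMap.mem_ker, ιInv_ι_mul, algebraMapInv_eq_zero_of_mem_tensorDegree hx, zero_smul]

variable (c : M ⊗[R] M →ₗ[R] M ⊗[R] M)

theorem letterAct_mem_lTensorRange (v : M) {P Q : Submodule R T}
    (h : ∀ u, ∀ x ∈ P, ι R u * x ∈ Q) {z : M ⊗[R] T} (hz : z ∈ lTensorRange M P) :
    letterAct c v z ∈ lTensorRange M Q := by
  suffices lTensorRange M P ≤ (lTensorRange M Q).comap (letterAct c v) from this hz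
  refine lTensorRange_le fun u x hx => ?_
  rw [Submodule.mem_comap, letterAct_tmul]
  exact lTensor_mem_lTensorRange (fun w => h w x hx) _

theorem skewDer_mem_lTensorRange {n : ℕ} {x : T} (hx : x ∈ tensorDegree R M (n + 1)) :
    skewDer c x ∈ lTensorRange M (tensorDegree R M n) := by
  suffices tensorDegree R M (n + 1) ≤ (lTensorRange M (tensorDegree R M n)).comap (skewDer c)
    from this hx
  clear x hx
  induction n with
  | zero =>
    refine tensorDegree_succ_le fun v x hx => ?_
    obtain ⟨r, rfl⟩ := mem_tensorDegree_zero.mp hx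
    rw [Submodule.mem_comap, skewDer_ι_mul, skewDer_algebraMap, map_zero, add_zero]
    exact tmul_mem_lTensorRange v hx
  | succ n ih =>
    refine tensorDegree_succ_le fun v x hx => ?_
    rw [Submodule.mem_comap, skewDer_ι_mul]
    exact Submodule.add_mem _ (tmul_mem_lTensorRange v hx)
      (letterAct_mem_lTensorRange c v (fun u _ hy => ι_mul_mem_tensorDegree u hy) (ih hx))

theorem symmetrizer_eq_zero_of_mem_tensorDegree {n m : ℕ} (hmn : m ≠ n) {x : T}
    (hx : x ∈ tensorDegree R M m) : symmetrizer c n x = 0 := by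
  induction n generalizing m x with
  | zero =>
    obtain ⟨k, rfl⟩ := Nat.exists_eq_succ_of_ne_zero hmn
    rw [symmetrizer_zero_apply, algebraMapInv_eq_zero_of_mem_tensorDegree hx, map_zero]
  | succ n ih =>
    rw [symmetrizer_succ_apply]
    match m with
    | 0 =>
      obtain ⟨r, rfl⟩ := mem_tensorDegree_zero.mp hx
      rw [skewDer_algebraMap, map_zero, map_zero]
    | k + 1 =>
      rw [lTensor_eq_zero (fun y hy => ih (by omega) hy) (skewDer_mem_lTensorRange c hx), map_zero]

theorem symmetrizer_proj (n : ℕ) (x : T) :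
    symmetrizer c n (GradedAlgebra.proj (tensorDegree R M) n x) = symmetrizer c n x := by
  classical
  conv_rhs => rw [← DirectSum.sum_support_decompose (tensorDegree R M) x, map_sum]
  rw [GradedAlgebra.proj_apply, Finset.sum_eq_single n]
  · exact fun m _ hm => symmetrizer_eq_zero_of_mem_tensorDegree c hm (SetLike.coe_mem _)
  · intro hn
    rw [DFinsupp.notMem_support_iff.mp hn, ZeroMemClass.coe_zero, map_zero]

theorem symmetrizer_eq_zero {n : ℕ} (h : ∀ x ∈ tensorDegree R M n, symmetrizer c n x = 0) :
    symmetrizer c n = 0 :=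
  LinearMap.ext fun x => (symmetrizer_proj c n x).symm.trans (h _ (SetLike.coe_mem _))

theorem symmetrizer_zero_of_mem {x : T} (hx : x ∈ tensorDegree R M 0) : symmetrizer c 0 x = x := by
  obtain ⟨r, rfl⟩ := mem_tensorDegree_zero.mp hx
  rw [symmetrizer_zero_apply, AlgHom.commutes, Algebra.algebraMap_self_apply]

theorem symmetrizer_one_ι (v : M) : symmetrizer c 1 (ι R v) = ι R v := by
  have : skewDer c (ι R v) = v ⊗ₜ 1 := by simpa [skewDer_one] using skewDer_ι_mul c v 1
  rw [symmetrizer_succ_apply, this]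
  simp [symmetrizer_zero_apply]

theorem mem_nicholsIdeal {x : T} : x ∈ nicholsIdeal c ↔ ∀ n, symmetrizer c n x = 0 := by
  refine ⟨fun hx n => ?_, fun hx => ?_⟩
  · suffices nicholsIdeal c ≤ LinearMap.ker (symmetrizer c n) from this hx
    refine iSup₂_le fun m _ z hz => ?_
    obtain rfl | hmn := eq_or_ne m n
    · exact hz.2
    · exact symmetrizer_eq_zero_of_mem_tensorDegree c hmn hz.1
  · classical
    rw [← DirectSum.sum_support_decompose (tensorDegree R M) x]
    refine Submodule.sum_mem _ fun n _ => ?_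
    have hn : symmetrizer c n (DirectSum.decompose (tensorDegree R M) x n) = 0 :=
      (symmetrizer_proj c n x).trans (hx n)
    have hdeg := SetLike.coe_mem (DirectSum.decompose (tensorDegree R M) x n)
    generalize (DirectSum.decompose (tensorDegree R M) x n : T) = y at hn hdeg ⊢
    match n with
    | 0 =>
      rw [← symmetrizer_zero_of_mem c hdeg, hn]
      exact Submodule.zero_mem _
    | 1 =>
      obtain ⟨v, rfl⟩ := mem_tensorDegree_one.mp hdeg
      rw [← symmetrizer_one_ι c v, hn]
      exact Submodule.zero_mem _
    | n + 2 =>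
      exact Submodule.mem_iSup_of_mem (n + 2)
        (Submodule.mem_iSup_of_mem (Nat.le_add_left 2 n) ⟨hdeg, hn⟩)

theorem algebraMapInv_eq_zero_of_mem_nicholsIdeal {x : T} (hx : x ∈ nicholsIdeal c) :
    algebraMapInv x = 0 := by
  have := (mem_nicholsIdeal c).mp hx 0
  rwa [symmetrizer_zero_apply, TensorAlgebra.algebraMap_eq_zero_iff] at this

theorem ιInv_eq_zero_of_mem_nicholsIdeal {x : T} (hx : x ∈ nicholsIdeal c) : ιInv x = 0 := by
  suffices nicholsIdeal c ≤ LinearMap.ker (ιInv (R := R) (M := M)) from this hx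
  exact iSup₂_le fun n hn x hx => ιInv_eq_zero_of_mem_tensorDegree (by omega) hx.1

theorem le_nicholsIdeal {P : Submodule R T} (counit : ∀ x ∈ P, algebraMapInv x = 0)
    (stable : ∀ x ∈ P, skewDer c x ∈ lTensorRange M P) : P ≤ nicholsIdeal c := by
  intro x hx
  rw [mem_nicholsIdeal]
  intro n
  induction n generalizing x with
  | zero => rw [symmetrizer_zero_apply, counit x hx, map_zero]
  | succ n ih =>
    rw [symmetrizer_succ_apply, lTensor_eq_zero (fun y hy => ih hy) (stable x hx), map_zero]

variable (R M) in
/-- The tensors of degree less than `N`, a filtration of the tensor algebra. -/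
def tensorDegreeLT : ℕ →o Submodule R T where
  toFun N := ⨆ n ∈ Finset.range N, tensorDegree R M n
  monotone' _ _ h := biSup_mono fun _ hn => Finset.range_mono h hn

theorem tensorDegree_le_tensorDegreeLT {n N : ℕ} (h : n < N) :
    tensorDegree R M n ≤ tensorDegreeLT R M N :=
  le_iSup₂_of_le n (Finset.mem_range.mpr h) le_rfl

theorem iSup_tensorDegree : ⨆ n, tensorDegree R M n = ⊤ :=
  (DirectSum.Decomposition.isInternal (tensorDegree R M)).submodule_iSup_eq_top

theorem iSup_tensorDegreeLT : ⨆ N, tensorDegreeLT R M N = ⊤ :=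
  top_le_iff.mp <| iSup_tensorDegree.ge.trans <|
    iSup_mono' fun n => ⟨n + 1, tensorDegree_le_tensorDegreeLT n.lt_succ_self⟩

theorem fg_tensorDegreeLT [Module.Finite R M] (N : ℕ) : (tensorDegreeLT R M N).FG :=
  Submodule.fg_biSup _ _ fun n _ => .pow (Module.Finite.iff_fg.mp inferInstance) n

theorem symmetrizer_eq_zero_of_mem_tensorDegreeLT {n N : ℕ} (h : N ≤ n) {x : T}
    (hx : x ∈ tensorDegreeLT R M N) : symmetrizer c n x = 0 := by
  suffices tensorDegreeLT R M N ≤ LinearMap.ker (symmetrizer c n) from this hx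
  refine iSup₂_le fun m hm z hz => symmetrizer_eq_zero_of_mem_tensorDegree c ?_ hz
  exact ((Finset.mem_range.mp hm).trans_le h).ne

theorem finite_nicholsAlgebra [Module.Finite R M] {N : ℕ} (h : ∀ n ≥ N, symmetrizer c n = 0) :
    Module.Finite R (NicholsAlgebra c) := by
  suffices (tensorDegreeLT R M N).map (nicholsIdeal c).mkQ = ⊤ from
    ⟨this ▸ (fg_tensorDegreeLT N).map _⟩
  rw [Submodule.map_mkQ_eq_top, ← top_le_iff, ← iSup_tensorDegree]
  refine iSup_le fun n => ?_
  obtain hn | hn := lt_or_ge n N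
  · exact (tensorDegree_le_tensorDegreeLT hn).trans le_sup_right
  · refine le_sup_of_le_left fun x hx => (mem_nicholsIdeal c).mpr fun m => ?_
    obtain rfl | hmn := eq_or_ne n m
    · rw [h n hn, LinearMap.zero_apply]
    · exact symmetrizer_eq_zero_of_mem_tensorDegree c hmn hx

theorem exists_symmetrizer_eq_zero [Module.Finite R (NicholsAlgebra c)] :
    ∃ N, ∀ n ≥ N, symmetrizer c n = 0 := by
  let F : ℕ →o Submodule R (NicholsAlgebra c) :=
    ⟨fun N => (tensorDegreeLT R M N).map (nicholsIdeal c).mkQ,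
      fun _ _ h => Submodule.map_mono ((tensorDegreeLT R M).monotone h)⟩
  have iSup_F : iSup F = ⊤ := by
    change ⨆ N, (tensorDegreeLT R M N).map (nicholsIdeal c).mkQ = ⊤
    rw [← Submodule.map_iSup, iSup_tensorDegreeLT, Submodule.map_top, Submodule.range_mkQ]
  obtain ⟨N, hN⟩ := Module.Finite.fg_top.stabilizes_of_iSup_eq F iSup_F
  have sup_eq : nicholsIdeal c ⊔ tensorDegreeLT R M N = ⊤ :=
    (Submodule.map_mkQ_eq_top _ _).mp hN.symm
  refine ⟨N, fun n hn => LinearMap.ker_eq_top.mp (top_le_iff.mp (sup_eq.ge.trans ?_))⟩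
  exact sup_le (fun x hx => (mem_nicholsIdeal c).mp hx n)
    fun x hx => symmetrizer_eq_zero_of_mem_tensorDegreeLT c hn hx

end Grading

/-! ### The braided tensor product algebra -/

section BraidedProduct

variable {R A : Type*} [CommRing R] [AddCommGroup A] [Module R A]

/-- For a multiplication `μ` and a braiding `d` of `A`, the left multiplication by `1 ⊗ a` in the
braided tensor product `A ⊗ A`, that is `s ⊗ t ↦ ∑ s' ⊗ a' t`, where `d (a ⊗ s) = ∑ s' ⊗ a'`. -/
noncomputable def brRight (μ : A →ₗ[R] A →ₗ[R] A) (d : A ⊗[R] A →ₗ[R] A ⊗[R] A) :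
    A →ₗ[R] Module.End R (A ⊗[R] A) :=
  TensorProduct.curry ((TensorProduct.lift μ).lTensor A ∘ₗ
    (TensorProduct.assoc R A A A).toLinearMap ∘ₗ d.rTensor A ∘ₗ
    (TensorProduct.assoc R A A A).symm.toLinearMap)

/-- The multiplication of the braided tensor product `A ⊗ A`. -/
noncomputable def brProd (μ : A →ₗ[R] A →ₗ[R] A) (d : A ⊗[R] A →ₗ[R] A ⊗[R] A) :
    A ⊗[R] A →ₗ[R] Module.End R (A ⊗[R] A) :=
  LinearMap.mul' R (Module.End R (A ⊗[R] A)) ∘ₗ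
    TensorProduct.map (LinearMap.rTensorHom A ∘ₗ μ) (brRight μ d)

variable (μ : A →ₗ[R] A →ₗ[R] A) (d : A ⊗[R] A →ₗ[R] A ⊗[R] A)

theorem brRight_tmul (a s t : A) :
    brRight μ d a (s ⊗ₜ t) = (μ.flip t).lTensor A (d (a ⊗ₜ s)) := by
  have : μ.flip t = TensorProduct.lift μ ∘ₗ (TensorProduct.mk R A A).flip t := by ext; simp
  rw [this, ← lTensor_assoc_tmul]
  simp [brRight]

theorem brProd_tmul (a b : A) (z : A ⊗[R] A) :
    brProd μ d (a ⊗ₜ b) z = (μ a).rTensor A (brRight μ d b z) := by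
  simp [brProd]

end BraidedProduct

section Hexagon

open TensorAlgebra (ι lift)

variable {R M : Type*} [CommRing R] [AddCommGroup M] [Module R M]

local notation "T" => TensorAlgebra R M

theorem lift_intertwine {X Y : Type*} [AddCommGroup X] [Module R X] [AddCommGroup Y] [Module R Y]
    {f : M →ₗ[R] Module.End R X} {g : M →ₗ[R] Module.End R Y} {h : X →ₗ[R] Y}
    (H : ∀ v, h ∘ₗ f v = g v ∘ₗ h) (x : T) : h ∘ₗ lift R f x = lift R g x ∘ₗ h := by
  induction x using TensorAlgebra.induction with
  | algebraMap r => ext; simp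
  | ι v => simpa using H v
  | mul a b ha hb =>
    simp only [map_mul, Module.End.mul_eq_comp]
    rw [← LinearMap.comp_assoc, ha, LinearMap.comp_assoc, hb, LinearMap.comp_assoc]
  | add a b ha hb => simp only [map_add, LinearMap.comp_add, LinearMap.add_comp, ha, hb]

variable (c : M ⊗[R] M →ₗ[R] M ⊗[R] M)

theorem crossing_comp_mulLeft (u : M) (s : T) :
    crossing c u ∘ₗ (LinearMap.mulLeft R s).rTensor M =
      (LinearMap.mulLeft R s).rTensor M ∘ₗ crossing c u := by
  refine TensorProduct.ext' fun t v => ?_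
  rw [LinearMap.comp_apply, LinearMap.rTensor_tmul, crossing_tmul, LinearMap.comp_apply,
    crossing_tmul, ← LinearMap.rTensor_comp_apply, LinearMap.mulLeft_apply,
    LinearMap.mulLeft_mul, LinearMap.comp_assoc]

/-- The operator `s ⊗ v ↦ ∑ s t' ⊗ v'` on `T ⊗ M`, where `c_{M,T} (v ⊗ t) = ∑ t' ⊗ v'`. -/
noncomputable def tensorCrossing : T →ₗ[R] Module.End R (T ⊗[R] M) :=
  (MulOpposite.opLinearEquiv R).symm.toLinearMap ∘ₗ
    (lift R ((MulOpposite.opLinearEquiv R).toLinearMap ∘ₗ crossing c)).toLinearMap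

theorem vecBraiding_tmul (v : M) (t : T) :
    vecBraiding c (v ⊗ₜ t) = tensorCrossing c t (1 ⊗ₜ v) := by
  simp [vecBraiding, tensorCrossing]

theorem tensorCrossing_mul (s t : T) :
    tensorCrossing c (s * t) = tensorCrossing c t ∘ₗ tensorCrossing c s := by
  simp [tensorCrossing, Module.End.mul_eq_comp]

theorem vecBraiding_mul (v : M) (s t : T) :
    vecBraiding c (v ⊗ₜ (s * t)) = tensorCrossing c t (vecBraiding c (v ⊗ₜ s)) := by
  rw [vecBraiding_tmul, tensorCrossing_mul, LinearMap.comp_apply, vecBraiding_tmul]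

theorem tensorCrossing_tmul (t s : T) (v : M) :
    tensorCrossing c t (s ⊗ₜ v) = (LinearMap.mulLeft R s).rTensor M (vecBraiding c (v ⊗ₜ t)) := by
  suffices (tensorCrossing c).flip (s ⊗ₜ v) =
      (LinearMap.mulLeft R s).rTensor M ∘ₗ vecBraiding c ∘ₗ TensorProduct.mk R M T v from
    LinearMap.congr_fun this t
  refine linearMap_ext_right ?_ fun x u hx => ?_
  · simp [vecBraiding_one, tensorCrossing]
  · have ι_eq : tensorCrossing c (ι R u) = crossing c u := by simp [tensorCrossing]
    have comm := LinearMap.congr_fun (crossing_comp_mulLeft c u s) (vecBraiding c (v ⊗ₜ x))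
    simp only [LinearMap.flip_apply, LinearMap.comp_apply, TensorProduct.mk_apply] at hx comm ⊢
    rw [tensorCrossing_mul, LinearMap.comp_apply, hx, ι_eq, comm, vecBraiding_mul_ι]

theorem vecBraiding_ι (v a : M) :
    vecBraiding c (v ⊗ₜ ι R a) = (ι R).rTensor M (c (v ⊗ₜ a)) := by
  rw [← one_mul (ι R a), vecBraiding_mul_ι, vecBraiding_one, crossing_tmul, LinearMap.mulLeft_one,
    LinearMap.id_comp]

/-- The operator `u ⊗ t ⊗ v ↦ u t ⊗ v`. -/
noncomputable def vecMulFst (R M : Type*) [CommRing R] [AddCommGroup M] [Module R M] :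
    M ⊗[R] (TensorAlgebra R M ⊗[R] M) →ₗ[R] TensorAlgebra R M ⊗[R] M :=
  (vecMul R M).rTensor M ∘ₗ (TensorProduct.assoc R M (TensorAlgebra R M) M).symm.toLinearMap

theorem vecMulFst_tmul (u : M) (z : T ⊗[R] M) :
    vecMulFst R M (u ⊗ₜ z) = (LinearMap.mulLeft R (ι R u)).rTensor M z := by
  have : LinearMap.mulLeft R (ι R u) = vecMul R M ∘ₗ TensorProduct.mk R M T u := by ext; simp
  rw [this, ← rTensor_assoc_symm_tmul]
  rfl

theorem vecBraiding_ι_mul (v a : M) (x : T) :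
    vecBraiding c (v ⊗ₜ (ι R a * x)) =
      vecMulFst R M ((vecBraiding c).lTensor M (braidFirst c T (v ⊗ₜ (a ⊗ₜ x)))) := by
  have : tensorCrossing c x ∘ₗ (ι R).rTensor M =
      vecMulFst R M ∘ₗ (vecBraiding c ∘ₗ (TensorProduct.mk R M T).flip x).lTensor M :=
    TensorProduct.ext' fun u w => by simp [tensorCrossing_tmul, vecMulFst_tmul]
  rw [vecBraiding_mul, vecBraiding_ι, braidFirst_tmul, lTensor_assoc_tmul,
    ← LinearMap.comp_apply, this, LinearMap.comp_apply]

/-- The algebra map `T → End (T ⊗ T)` sending `x` to the left multiplication by `1 ⊗ x`. -/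
noncomputable def rightAct : T →ₐ[R] Module.End R (T ⊗[R] T) :=
  lift R (rightVecMul c)

theorem rightAct_ι (v : M) : rightAct c (ι R v) = rightVecMul c v := by
  simp [rightAct]

theorem tensorBraiding_tmul (s t : T) :
    tensorBraiding c (s ⊗ₜ t) = rightAct c s (t ⊗ₜ 1) := by
  simp [tensorBraiding, rightAct]

theorem mulRight_comp_rightVecMul (v : M) (t : T) :
    (LinearMap.mulRight R t).lTensor T ∘ₗ rightVecMul c v =
      rightVecMul c v ∘ₗ (LinearMap.mulRight R t).lTensor T := by
  refine TensorProduct.ext' fun s x => ?_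
  rw [LinearMap.comp_apply, rightVecMul_tmul, ← LinearMap.lTensor_comp_apply, LinearMap.comp_apply,
    LinearMap.lTensor_tmul, rightVecMul_tmul, LinearMap.mulRight_apply,
    LinearMap.mulRight_mul, LinearMap.comp_assoc]

theorem mulRight_comp_rightAct (x t : T) :
    (LinearMap.mulRight R t).lTensor T ∘ₗ rightAct c x =
      rightAct c x ∘ₗ (LinearMap.mulRight R t).lTensor T :=
  lift_intertwine (mulRight_comp_rightVecMul c · t) x

theorem brRight_tensorBraiding (x : T) :
    brRight (LinearMap.mul R T) (tensorBraiding c) x = rightAct c x := by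
  refine TensorProduct.ext' fun s t => ?_
  have := LinearMap.congr_fun (mulRight_comp_rightAct c x t) (s ⊗ₜ 1)
  have flip_mul : (LinearMap.mul R T).flip t = LinearMap.mulRight R t := rfl
  rw [brRight_tmul, tensorBraiding_tmul, flip_mul]
  simpa only [LinearMap.comp_apply, LinearMap.lTensor_tmul, LinearMap.mulRight_apply,
    one_mul] using this

/-- The left multiplications of the braided tensor product algebra `T ⊗ T`. -/
noncomputable abbrev tensorProd : T ⊗[R] T →ₗ[R] Module.End R (T ⊗[R] T) :=
  brProd (LinearMap.mul R T) (tensorBraiding c)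

theorem tensorProd_tmul (a b : T) (z : T ⊗[R] T) :
    tensorProd c (a ⊗ₜ b) z = (LinearMap.mulLeft R a).rTensor T (rightAct c b z) := by
  rw [brProd_tmul, brRight_tensorBraiding]
  rfl

theorem tensorProd_tmul_one (a : T) (z : T ⊗[R] T) :
    tensorProd c (a ⊗ₜ 1) z = (LinearMap.mulLeft R a).rTensor T z := by
  rw [tensorProd_tmul, map_one, Module.End.one_apply]

theorem tensorProd_lTensor_mulRight (z : T ⊗[R] T) (b : T) (y : T ⊗[R] T) :
    tensorProd c ((LinearMap.mulRight R b).lTensor T z) y = tensorProd c z (rightAct c b y) := by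
  suffices (tensorProd c).flip y ∘ₗ (LinearMap.mulRight R b).lTensor T =
      (tensorProd c).flip (rightAct c b y) from LinearMap.congr_fun this z
  refine TensorProduct.ext' fun s t => ?_
  simp [tensorProd_tmul]

theorem rightVecMul_rTensor_mulLeft (v : M) (s : T) (y : T ⊗[R] T) :
    rightVecMul c v ((LinearMap.mulLeft R s).rTensor T y) =
      tensorProd c (rightVecMul c v (s ⊗ₜ 1)) y := by
  suffices rightVecMul c v ∘ₗ (LinearMap.mulLeft R s).rTensor T =
      tensorProd c (rightVecMul c v (s ⊗ₜ 1)) from LinearMap.congr_fun this y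
  refine TensorProduct.ext' fun a t => ?_
  rw [LinearMap.comp_apply, LinearMap.rTensor_tmul, rightVecMul_tmul, rightVecMul_tmul,
    LinearMap.mulLeft_apply, vecBraiding_mul, LinearMap.mulRight_one, LinearMap.id_comp]
  suffices (LinearMap.mulRight R t ∘ₗ ι R).lTensor T ∘ₗ tensorCrossing c a =
      (tensorProd c).flip (a ⊗ₜ t) ∘ₗ (ι R).lTensor T from
    LinearMap.congr_fun this (vecBraiding c (v ⊗ₜ s))
  refine TensorProduct.ext' fun s' v' => ?_
  simp only [LinearMap.comp_apply, LinearMap.lTensor_tmul, LinearMap.flip_apply, tensorProd_tmul,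
    rightAct_ι, tensorCrossing_tmul, rTensor_rightVecMul_tmul]

theorem tensorProd_rightVecMul (v : M) (y : T ⊗[R] T) :
    (tensorProd c).flip y ∘ₗ rightVecMul c v = rightVecMul c v ∘ₗ (tensorProd c).flip y := by
  refine TensorProduct.ext' fun s t => ?_
  have tmul_eq : s ⊗ₜ t = (LinearMap.mulRight R t).lTensor T (s ⊗ₜ[R] 1) := by simp
  have comm := LinearMap.congr_fun (mulRight_comp_rightVecMul c v t) (s ⊗ₜ 1)
  simp only [LinearMap.comp_apply, LinearMap.flip_apply] at comm ⊢
  rw [tmul_eq, ← comm, tensorProd_lTensor_mulRight, tensorProd_lTensor_mulRight,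
    tensorProd_tmul_one, rightVecMul_rTensor_mulLeft]

theorem tensorProd_leftVecMul (v : M) (y : T ⊗[R] T) :
    (tensorProd c).flip y ∘ₗ leftVecMul R M v = leftVecMul R M v ∘ₗ (tensorProd c).flip y := by
  have leftVecMul_eq : leftVecMul R M v = (LinearMap.mulLeft R (ι R v)).rTensor T := by ext; simp
  refine TensorProduct.ext' fun s t => ?_
  simp only [LinearMap.comp_apply, LinearMap.flip_apply, leftVecMul_eq,
    LinearMap.rTensor_tmul,
    LinearMap.mulLeft_apply, tensorProd_tmul, LinearMap.mulLeft_mul, LinearMap.rTensor_comp]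

theorem rightAct_rTensor_mulLeft (x s : T) (y : T ⊗[R] T) :
    rightAct c x ((LinearMap.mulLeft R s).rTensor T y) =
      tensorProd c (rightAct c x (s ⊗ₜ 1)) y := by
  rw [← tensorProd_tmul_one c]
  exact (LinearMap.congr_fun (lift_intertwine (tensorProd_rightVecMul c · y) x) (s ⊗ₜ 1)).symm

theorem comul_mul (x y : T) : comul c (x * y) = tensorProd c (comul c x) (comul c y) := by
  have comm (v : M) : (tensorProd c).flip (comul c y) ∘ₗ (leftVecMul R M + rightVecMul c) v =
      (leftVecMul R M + rightVecMul c) v ∘ₗ (tensorProd c).flip (comul c y) := by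
    rw [LinearMap.add_apply, LinearMap.comp_add, LinearMap.add_comp, tensorProd_leftVecMul,
      tensorProd_rightVecMul]
  have := LinearMap.congr_fun (lift_intertwine comm x) (1 ⊗ₜ 1)
  simp only [LinearMap.comp_apply, LinearMap.flip_apply, tensorProd_tmul_one] at this
  simpa [comul] using this.symm

theorem comul_ι (v : M) : comul c (ι R v) = ι R v ⊗ₜ 1 + 1 ⊗ₜ ι R v := by
  rw [← mul_one (ι R v), comul_ι_mul, comul_one, leftVecMul_tmul, rightVecMul_tmul,
    vecBraiding_one]
  simp

theorem tensorBraiding_mul_right (x s t : T) :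
    tensorBraiding c (x ⊗ₜ (s * t)) = tensorProd c (tensorBraiding c (x ⊗ₜ s)) (t ⊗ₜ 1) := by
  rw [tensorBraiding_tmul, tensorBraiding_tmul, ← rightAct_rTensor_mulLeft]
  simp

theorem tensorBraiding_mul_left (x y t : T) :
    tensorBraiding c ((x * y) ⊗ₜ t) = rightAct c x (tensorBraiding c (y ⊗ₜ t)) := by
  rw [tensorBraiding_tmul, tensorBraiding_tmul, map_mul, Module.End.mul_apply]

theorem tensorBraiding_one_left (t : T) : tensorBraiding c (1 ⊗ₜ t) = t ⊗ₜ 1 := by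
  rw [tensorBraiding_tmul, map_one, Module.End.one_apply]

theorem tensorBraiding_one_right (x : T) : tensorBraiding c (x ⊗ₜ 1) = 1 ⊗ₜ x := by
  suffices tensorBraiding c ∘ₗ (TensorProduct.mk R T T).flip 1 = TensorProduct.mk R T T 1 from
    LinearMap.congr_fun this x
  refine linearMap_ext_left (tensorBraiding_one_left c 1) fun v x hx => ?_
  simp only [LinearMap.comp_apply, LinearMap.flip_apply, TensorProduct.mk_apply] at hx ⊢
  rw [tensorBraiding_mul_left, hx, rightAct_ι, rightVecMul_tmul, vecBraiding_one]
  simp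

theorem tensorBraiding_ι_left (v : M) (t : T) :
    tensorBraiding c (ι R v ⊗ₜ t) = (ι R).lTensor T (vecBraiding c (v ⊗ₜ t)) := by
  rw [tensorBraiding_tmul, rightAct_ι, rightVecMul_tmul, LinearMap.mulRight_one, LinearMap.id_comp]

/-- The algebra map `T → End (M ⊗ T)` extending `letterAct`. -/
noncomputable def tensorAct : T →ₐ[R] Module.End R (M ⊗[R] T) :=
  lift R (letterAct c)

theorem tensorAct_ι (v : M) : tensorAct c (ι R v) = letterAct c v := by
  simp [tensorAct]

/-- The braiding `c_{T,M}`, as the family of maps `T → M ⊗ T`, `x ↦ c_{T,M} (x ⊗ u)`, for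
`u : M`. -/
noncomputable def braidingVec : M →ₗ[R] T →ₗ[R] M ⊗[R] T :=
  (tensorAct c).toLinearMap.flip ∘ₗ (TensorProduct.mk R M T).flip 1

theorem braidingVec_apply (u : M) (x : T) : braidingVec c u x = tensorAct c x (u ⊗ₜ 1) := rfl

theorem ι_rTensor_comp_tensorAct (x : T) :
    (ι R).rTensor T ∘ₗ tensorAct c x = rightAct c x ∘ₗ (ι R).rTensor T := by
  refine lift_intertwine (fun v => TensorProduct.ext' fun u t => ?_) x
  rw [LinearMap.comp_apply, letterAct_tmul, LinearMap.comp_apply, LinearMap.rTensor_tmul,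
    rightVecMul_tmul, vecBraiding_ι, ← LinearMap.comp_apply, LinearMap.rTensor_comp_lTensor,
    ← LinearMap.lTensor_comp_rTensor, LinearMap.comp_apply]

theorem tensorBraiding_ι_right (x : T) (u : M) :
    tensorBraiding c (x ⊗ₜ ι R u) = (ι R).rTensor T (braidingVec c u x) := by
  rw [tensorBraiding_tmul, braidingVec_apply]
  exact (LinearMap.congr_fun (ι_rTensor_comp_tensorAct c x) (u ⊗ₜ 1)).symm

theorem mulRight_comp_letterAct (v : M) (t : T) :
    (LinearMap.mulRight R t).lTensor M ∘ₗ letterAct c v =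
      letterAct c v ∘ₗ (LinearMap.mulRight R t).lTensor M := by
  refine TensorProduct.ext' fun u s => ?_
  rw [LinearMap.comp_apply, letterAct_tmul, ← LinearMap.lTensor_comp_apply, LinearMap.comp_apply,
    LinearMap.lTensor_tmul, letterAct_tmul, LinearMap.mulRight_apply,
    LinearMap.mulRight_mul, LinearMap.comp_assoc]

theorem mulRight_comp_tensorAct (x t : T) :
    (LinearMap.mulRight R t).lTensor M ∘ₗ tensorAct c x =
      tensorAct c x ∘ₗ (LinearMap.mulRight R t).lTensor M :=
  lift_intertwine (mulRight_comp_letterAct c · t) x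

theorem skewDer_mul (x t : T) :
    skewDer c (x * t) = (LinearMap.mulRight R t).lTensor M (skewDer c x) +
      tensorAct c x (skewDer c t) := by
  suffices skewDer c ∘ₗ LinearMap.mulRight R t = (LinearMap.mulRight R t).lTensor M ∘ₗ skewDer c +
      (tensorAct c).toLinearMap.flip (skewDer c t) from LinearMap.congr_fun this x
  refine linearMap_ext_left ?_ fun v x hx => ?_
  · simp [skewDer_one]
  · have comm := LinearMap.congr_fun (mulRight_comp_letterAct c v t) (skewDer c x)
    simp only [LinearMap.comp_apply, LinearMap.add_apply, LinearMap.flip_apply,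
      LinearMap.mulRight_apply, AlgHom.toLinearMap_apply] at hx comm ⊢
    rw [mul_assoc, skewDer_ι_mul, hx, skewDer_ι_mul, map_mul, Module.End.mul_apply, map_add,
      map_add, comm, tensorAct_ι]
    simp [add_assoc]

/-- The part of total degree `m` of `T ⊗ T`. -/
def bidegree (R M : Type*) [CommRing R] [AddCommGroup M] [Module R M] (m : ℕ) :
    Submodule R (TensorAlgebra R M ⊗[R] TensorAlgebra R M) :=
  Submodule.span R {z | ∃ i j, i + j = m ∧ ∃ s ∈ tensorDegree R M i, ∃ t ∈ tensorDegree R M j,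
    s ⊗ₜ t = z}

theorem tmul_mem_bidegree {i j m : ℕ} (h : i + j = m) {s t : T} (hs : s ∈ tensorDegree R M i)
    (ht : t ∈ tensorDegree R M j) : s ⊗ₜ t ∈ bidegree R M m :=
  Submodule.subset_span ⟨i, j, h, s, hs, t, ht, rfl⟩

theorem crossing_mem_rTensorRange (u : M) {i : ℕ} {z : T ⊗[R] M}
    (hz : z ∈ rTensorRange M (tensorDegree R M i)) :
    crossing c u z ∈ rTensorRange M (tensorDegree R M (i + 1)) := by
  suffices rTensorRange M (tensorDegree R M i) ≤
    (rTensorRange M (tensorDegree R M (i + 1))).comap (crossing c u) from this hz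
  refine rTensorRange_le fun w y hy => ?_
  rw [Submodule.mem_comap, crossing_tmul]
  exact rTensor_mem_rTensorRange (fun a => mul_ι_mem_tensorDegree a hy) _

theorem vecBraiding_mem_rTensorRange (v : M) {i : ℕ} {s : T} (hs : s ∈ tensorDegree R M i) :
    vecBraiding c (v ⊗ₜ s) ∈ rTensorRange M (tensorDegree R M i) := by
  suffices tensorDegree R M i ≤ (rTensorRange M (tensorDegree R M i)).comap
    (vecBraiding c ∘ₗ TensorProduct.mk R M T v) from this hs
  clear s hs
  induction i with
  | zero =>
    intro x hx
    obtain ⟨r, rfl⟩ := mem_tensorDegree_zero.mp hx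
    simp only [Submodule.mem_comap, LinearMap.comp_apply, TensorProduct.mk_apply,
      Algebra.algebraMap_eq_smul_one, map_smul, vecBraiding_one]
    exact Submodule.smul_mem _ _ (tmul_mem_rTensorRange v one_mem_tensorDegree_zero)
  | succ i ih =>
    refine tensorDegree_succ_le_right fun u x hx => ?_
    rw [Submodule.mem_comap, LinearMap.comp_apply, TensorProduct.mk_apply, vecBraiding_mul_ι]
    exact crossing_mem_rTensorRange c u (ih hx)

theorem rightVecMul_mem_bidegree (v : M) {m : ℕ} {z : T ⊗[R] T} (hz : z ∈ bidegree R M m) :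
    rightVecMul c v z ∈ bidegree R M (m + 1) := by
  suffices bidegree R M m ≤ (bidegree R M (m + 1)).comap (rightVecMul c v) from this hz
  refine Submodule.span_le.mpr ?_
  rintro _ ⟨i, j, rfl, s, hs, t, ht, rfl⟩
  suffices rTensorRange M (tensorDegree R M i) ≤
      (bidegree R M (i + j + 1)).comap ((LinearMap.mulRight R t ∘ₗ ι R).lTensor T) by
    rw [SetLike.mem_coe, Submodule.mem_comap, rightVecMul_tmul]
    exact this (vecBraiding_mem_rTensorRange c v hs)
  refine rTensorRange_le fun w y hy => ?_
  exact tmul_mem_bidegree (add_assoc i j 1).symm hy (ι_mul_mem_tensorDegree w ht)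

theorem leftVecMul_mem_bidegree (v : M) {m : ℕ} {z : T ⊗[R] T} (hz : z ∈ bidegree R M m) :
    leftVecMul R M v z ∈ bidegree R M (m + 1) := by
  suffices bidegree R M m ≤ (bidegree R M (m + 1)).comap (leftVecMul R M v) from this hz
  refine Submodule.span_le.mpr ?_
  rintro _ ⟨i, j, rfl, s, hs, t, ht, rfl⟩
  rw [SetLike.mem_coe, Submodule.mem_comap, leftVecMul_tmul]
  exact tmul_mem_bidegree (add_right_comm i 1 j) (ι_mul_mem_tensorDegree v hs) ht

theorem comul_mem_bidegree {m : ℕ} {x : T} (hx : x ∈ tensorDegree R M m) :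
    comul c x ∈ bidegree R M m := by
  suffices tensorDegree R M m ≤ (bidegree R M m).comap (comul c) from this hx
  clear x hx
  induction m with
  | zero =>
    intro x hx
    obtain ⟨r, rfl⟩ := mem_tensorDegree_zero.mp hx
    rw [Submodule.mem_comap, Algebra.algebraMap_eq_smul_one, map_smul, comul_one]
    exact Submodule.smul_mem _ _
      (tmul_mem_bidegree (zero_add 0) one_mem_tensorDegree_zero one_mem_tensorDegree_zero)
  | succ m ih =>
    refine tensorDegree_succ_le fun v x hx => ?_
    rw [Submodule.mem_comap, comul_ι_mul]
    exact Submodule.add_mem _ (leftVecMul_mem_bidegree v (ih hx))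
      (rightVecMul_mem_bidegree c v (ih hx))

end Hexagon

/-! ### The Yang-Baxter equation -/

section YangBaxter

open TensorAlgebra (ι algebraMapInv)

variable {R M : Type*} [CommRing R] [AddCommGroup M] [Module R M] {c : M ⊗[R] M →ₗ[R] M ⊗[R] M}

local notation "T" => TensorAlgebra R M
local notation "ε" => AlgHom.toLinearMap (algebraMapInv (R := R) (M := M))

/-- The braid equation `c₁ c₂ c₁ = c₂ c₁ c₂` on `M ⊗ M ⊗ M`. -/
def IsYangBaxter (c : M ⊗[R] M →ₗ[R] M ⊗[R] M) : Prop :=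
  ∀ z, braidFirst c M (c.lTensor M (braidFirst c M z)) =
    c.lTensor M (braidFirst c M (c.lTensor M z))

theorem braidFirst_comp_mk_flip {X : Type*} [AddCommGroup X] [Module R X] (x : X) :
    braidFirst c X ∘ₗ ((TensorProduct.mk R M X).flip x).lTensor M =
      ((TensorProduct.mk R M X).flip x).lTensor M ∘ₗ c := by
  refine TensorProduct.ext' fun v u => ?_
  have := lTensor_assoc_tmul (LinearMap.id : M ⊗[R] X →ₗ[R] M ⊗[R] X) (c (v ⊗ₜ u)) x
  simpa [braidFirst_tmul] using this

theorem IsYangBaxter.braidFirst_apply (hc : IsYangBaxter c) {X : Type*} [AddCommGroup X]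
    [Module R X] (z : M ⊗[R] (M ⊗[R] (M ⊗[R] X))) :
    braidFirst c (M ⊗[R] X)
        ((braidFirst c X).lTensor M (braidFirst c (M ⊗[R] X) z)) =
      (braidFirst c X).lTensor M
        (braidFirst c (M ⊗[R] X) ((braidFirst c X).lTensor M z)) := by
  let J (x : X) : M ⊗[R] (M ⊗[R] M) →ₗ[R] M ⊗[R] (M ⊗[R] (M ⊗[R] X)) :=
    (((TensorProduct.mk R M X).flip x).lTensor M).lTensor M
  have fst_J (x z) : braidFirst c (M ⊗[R] X) (J x z) = J x (braidFirst c M z) :=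
    LinearMap.congr_fun (braidFirst_comp_lTensor c _) z
  have snd_J (x z) : (braidFirst c X).lTensor M (J x z) = J x (c.lTensor M z) := by
    rw [← LinearMap.lTensor_comp_apply, braidFirst_comp_mk_flip, LinearMap.lTensor_comp_apply]
  suffices braidFirst c (M ⊗[R] X) ∘ₗ (braidFirst c X).lTensor M ∘ₗ braidFirst c (M ⊗[R] X) =
      (braidFirst c X).lTensor M ∘ₗ braidFirst c (M ⊗[R] X) ∘ₗ (braidFirst c X).lTensor M from
    LinearMap.congr_fun this z
  ext v u w x
  have : v ⊗ₜ (u ⊗ₜ (w ⊗ₜ x)) = J x (v ⊗ₜ (u ⊗ₜ w)) := rfl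
  simp only [TensorProduct.AlgebraTensorModule.curry_apply, LinearMap.restrictScalars_self,
    TensorProduct.curry_apply, LinearMap.comp_apply, this, fst_J, snd_J, hc _]

theorem skewDer_comp_vecMul : skewDer c ∘ₗ vecMul R M =
    LinearMap.id + (vecMul R M).lTensor M ∘ₗ braidFirst c T ∘ₗ (skewDer c).lTensor M :=
  TensorProduct.ext' fun v x => by simp [skewDer_ι_mul, letterAct_apply]

theorem skewDer_letterAct (v : M) (y : M ⊗[R] T) :
    (skewDer c).lTensor M (letterAct c v y) = braidFirst c T (v ⊗ₜ y) +
      ((vecMul R M).lTensor M).lTensor M ((braidFirst c T).lTensor M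
        (braidFirst c (M ⊗[R] T) (v ⊗ₜ (skewDer c).lTensor M y))) := by
  have natural := LinearMap.congr_fun (braidFirst_comp_lTensor c (skewDer c)) (v ⊗ₜ y)
  simp only [LinearMap.comp_apply, LinearMap.lTensor_tmul] at natural
  rw [natural, letterAct_apply, ← LinearMap.lTensor_comp_apply, skewDer_comp_vecMul]
  simp only [LinearMap.lTensor_add, LinearMap.lTensor_id, LinearMap.lTensor_comp,
    LinearMap.add_apply, LinearMap.comp_apply, LinearMap.id_apply]

theorem braidingVec_comp_vecMul (u : M) : braidingVec c u ∘ₗ vecMul R M =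
    (vecMul R M).lTensor M ∘ₗ braidFirst c T ∘ₗ (braidingVec c u).lTensor M :=
  TensorProduct.ext' fun v x => by simp [braidingVec_apply, tensorAct_ι, letterAct_apply]

theorem braidFirst_braidingVec_letterAct (hc : IsYangBaxter c) (u v : M) (y : M ⊗[R] T) :
    braidFirst c T ((braidingVec c u).lTensor M (letterAct c v y)) =
      ((vecMul R M).lTensor M).lTensor M ((braidFirst c T).lTensor M
        (braidFirst c (M ⊗[R] T) (v ⊗ₜ braidFirst c T ((braidingVec c u).lTensor M y)))) := by
  have natural_u := LinearMap.congr_fun (braidFirst_comp_lTensor c (braidingVec c u)) (v ⊗ₜ y)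
  have natural_L := LinearMap.congr_fun (braidFirst_comp_lTensor c (vecMul R M))
  have braid := hc.braidFirst_apply (v ⊗ₜ (braidingVec c u).lTensor M y)
  simp only [LinearMap.comp_apply, LinearMap.lTensor_tmul] at natural_u natural_L braid
  rw [letterAct_apply, ← LinearMap.lTensor_comp_apply, braidingVec_comp_vecMul, ← braid,
    natural_u]
  simp only [LinearMap.lTensor_comp, LinearMap.comp_apply, natural_L]

theorem skewDer_comp_braidingVec (hc : IsYangBaxter c) (u : M) :
    (skewDer c).lTensor M ∘ₗ braidingVec c u =
      braidFirst c T ∘ₗ (braidingVec c u).lTensor M ∘ₗ skewDer c := by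
  refine linearMap_ext_left (by simp [braidingVec_apply, skewDer_one]) fun v x hx => ?_
  have mul_rule := LinearMap.congr_fun (braidingVec_comp_vecMul (c := c) u) (v ⊗ₜ x)
  simp only [LinearMap.comp_apply, vecMul_tmul, LinearMap.lTensor_tmul] at hx mul_rule ⊢
  rw [mul_rule, ← letterAct_apply, skewDer_letterAct, hx, skewDer_ι_mul, map_add, map_add,
    LinearMap.lTensor_tmul, braidFirst_braidingVec_letterAct hc]

theorem symmetrizer_zero_comp_vecMul : symmetrizer c 0 ∘ₗ vecMul R M = 0 :=
  TensorProduct.ext' fun v x => by simp [symmetrizer_zero_apply, algebraMapInv_ι]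

theorem symmetrizer_succ (n : ℕ) :
    symmetrizer c (n + 1) = vecMul R M ∘ₗ (symmetrizer c n).lTensor M ∘ₗ skewDer c :=
  LinearMap.ext (symmetrizer_succ_apply c n)

theorem symmetrizer_comp_braidingVec (hc : IsYangBaxter c) (n : ℕ) (u : M) :
    (symmetrizer c n).lTensor M ∘ₗ braidingVec c u = braidingVec c u ∘ₗ symmetrizer c n := by
  induction n with
  | zero =>
    refine linearMap_ext_left (by simp [braidingVec_apply, symmetrizer_zero_apply]) fun v x _ => ?_
    rw [LinearMap.comp_apply, braidingVec_apply, map_mul, Module.End.mul_apply, tensorAct_ι,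
      letterAct_apply, ← LinearMap.lTensor_comp_apply, symmetrizer_zero_comp_vecMul]
    simp [symmetrizer_zero_apply, algebraMapInv_ι]
  | succ n ih =>
    calc (symmetrizer c (n + 1)).lTensor M ∘ₗ braidingVec c u
        = (vecMul R M).lTensor M ∘ₗ ((symmetrizer c n).lTensor M).lTensor M ∘ₗ braidFirst c T ∘ₗ
            (braidingVec c u).lTensor M ∘ₗ skewDer c := by
          simp only [symmetrizer_succ, LinearMap.lTensor_comp, LinearMap.comp_assoc,
            skewDer_comp_braidingVec hc]
      _ = (vecMul R M).lTensor M ∘ₗ braidFirst c T ∘ₗ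
            ((symmetrizer c n).lTensor M ∘ₗ braidingVec c u).lTensor M ∘ₗ skewDer c := by
          rw [← LinearMap.comp_assoc _ (braidFirst c T), ← braidFirst_comp_lTensor,
            LinearMap.lTensor_comp, LinearMap.comp_assoc, LinearMap.comp_assoc]
      _ = braidingVec c u ∘ₗ symmetrizer c (n + 1) := by
          rw [ih, LinearMap.lTensor_comp, symmetrizer_succ, ← LinearMap.comp_assoc _ (vecMul R M),
            braidingVec_comp_vecMul]
          simp only [LinearMap.comp_assoc]

/-- The skew derivation acting on the first factor of `T ⊗ M`. -/
noncomputable def skewDerFst (c : M ⊗[R] M →ₗ[R] M ⊗[R] M) :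
    T ⊗[R] M →ₗ[R] M ⊗[R] (T ⊗[R] M) :=
  (TensorProduct.assoc R M T M).toLinearMap ∘ₗ (skewDer c).rTensor M

theorem skewDerFst_comp_mk_flip (w : M) : skewDerFst c ∘ₗ (TensorProduct.mk R T M).flip w =
    ((TensorProduct.mk R T M).flip w).lTensor M ∘ₗ skewDer c := by
  ext x
  have := lTensor_assoc_tmul (LinearMap.id : T ⊗[R] M →ₗ[R] T ⊗[R] M) (skewDer c x) w
  simpa [skewDerFst] using this

theorem vecMulFst_comp_mk_flip (w : M) :
    vecMulFst R M ∘ₗ ((TensorProduct.mk R T M).flip w).lTensor M =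
      (TensorProduct.mk R T M).flip w ∘ₗ vecMul R M :=
  TensorProduct.ext' fun u x => by simp [vecMulFst_tmul]

theorem skewDerFst_comp_vecMulFst : skewDerFst c ∘ₗ vecMulFst R M = LinearMap.id +
    (vecMulFst R M).lTensor M ∘ₗ braidFirst c (T ⊗[R] M) ∘ₗ (skewDerFst c).lTensor M := by
  refine TensorProduct.ext_threefold' fun v x w => ?_
  have tmul_eq : v ⊗ₜ (x ⊗ₜ w) = ((TensorProduct.mk R T M).flip w).lTensor M (v ⊗ₜ x) := rfl
  have fst_mk (z : M ⊗[R] T) : vecMulFst R M (((TensorProduct.mk R T M).flip w).lTensor M z) =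
      (TensorProduct.mk R T M).flip w (vecMul R M z) :=
    LinearMap.congr_fun (vecMulFst_comp_mk_flip w) z
  have der_mk (t : T) : skewDerFst c ((TensorProduct.mk R T M).flip w t) =
      ((TensorProduct.mk R T M).flip w).lTensor M (skewDer c t) :=
    LinearMap.congr_fun (skewDerFst_comp_mk_flip w) t
  have natural := LinearMap.congr_fun (braidFirst_comp_lTensor c ((TensorProduct.mk R T M).flip w))
  have mul_rule := LinearMap.congr_fun (skewDer_comp_vecMul (c := c)) (v ⊗ₜ x)
  simp only [LinearMap.comp_apply, LinearMap.add_apply, LinearMap.id_apply] at natural mul_rule ⊢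
  rw [tmul_eq, fst_mk, der_mk, mul_rule, map_add, ← LinearMap.lTensor_comp_apply,
    ← vecMulFst_comp_mk_flip, ← LinearMap.lTensor_comp_apply M (skewDerFst c),
    skewDerFst_comp_mk_flip, LinearMap.lTensor_comp_apply, LinearMap.lTensor_comp_apply, natural]

theorem vecBraiding_comp_vecMul : vecBraiding c ∘ₗ (vecMul R M).lTensor M =
    vecMulFst R M ∘ₗ (vecBraiding c).lTensor M ∘ₗ braidFirst c T :=
  TensorProduct.ext_threefold' fun v a x => by simp [vecBraiding_ι_mul]

theorem skewDerFst_vecBraiding_ι_mul (a v : M) (x : T)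
    (ih : (skewDerFst c ∘ₗ vecBraiding c) ∘ₗ (TensorProduct.mk R M T).flip x =
      ((vecBraiding c).lTensor M ∘ₗ braidFirst c T ∘ₗ (skewDer c).lTensor M) ∘ₗ
        (TensorProduct.mk R M T).flip x) :
    skewDerFst c (vecBraiding c (v ⊗ₜ (ι R a * x))) =
      (vecBraiding c).lTensor M (braidFirst c T (v ⊗ₜ (a ⊗ₜ x))) +
        (vecMulFst R M).lTensor M (((vecBraiding c).lTensor M).lTensor M
          (braidFirst c _ ((braidFirst c T).lTensor M
            (braidFirst c _ (v ⊗ₜ (a ⊗ₜ skewDer c x)))))) := by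
  have split := LinearMap.congr_fun (skewDerFst_comp_vecMulFst (c := c))
  have natural := LinearMap.congr_fun (braidFirst_comp_lTensor c (vecBraiding c))
  have natural_der := LinearMap.congr_fun (braidFirst_comp_lTensor c (skewDer c)) (v ⊗ₜ (a ⊗ₜ x))
  have swap : braidFirst c T (v ⊗ₜ (a ⊗ₜ x)) =
      ((TensorProduct.mk R M T).flip x).lTensor M (c (v ⊗ₜ a)) :=
    LinearMap.congr_fun (braidFirst_comp_mk_flip x) (v ⊗ₜ a)
  have ih' := congrArg (fun f => f.lTensor M (c (v ⊗ₜ a))) ih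
  simp only [LinearMap.lTensor_comp, LinearMap.comp_apply, LinearMap.add_apply,
    LinearMap.id_apply, LinearMap.lTensor_tmul, ← swap] at split natural natural_der ih'
  rw [vecBraiding_ι_mul, split, ih', natural, natural_der]

theorem skewDerFst_comp_vecBraiding (hc : IsYangBaxter c) : skewDerFst c ∘ₗ vecBraiding c =
    (vecBraiding c).lTensor M ∘ₗ braidFirst c T ∘ₗ (skewDer c).lTensor M := by
  suffices ∀ x, (skewDerFst c ∘ₗ vecBraiding c) ∘ₗ (TensorProduct.mk R M T).flip x =
      ((vecBraiding c).lTensor M ∘ₗ braidFirst c T ∘ₗ (skewDer c).lTensor M) ∘ₗ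
        (TensorProduct.mk R M T).flip x from
    TensorProduct.ext' fun v x => LinearMap.congr_fun (this x) v
  intro x
  induction x using tensorAlgebra_induction_left with
  | one => ext v; simp [vecBraiding_one, skewDer_one, skewDerFst]
  | smul r x hx => simp only [map_smul, LinearMap.comp_smul, hx]
  | add x y hx hy => simp only [map_add, LinearMap.comp_add, hx, hy]
  | ι_mul a x hx =>
    ext v
    have natural := LinearMap.congr_fun (braidFirst_comp_lTensor c (vecMul R M))
      ((braidFirst c T).lTensor M (v ⊗ₜ (a ⊗ₜ skewDer c x)))
    have move :=
      LinearMap.congr_fun (congrArg (LinearMap.lTensor M) (vecBraiding_comp_vecMul (c := c)))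
    simp only [LinearMap.comp_apply, LinearMap.lTensor_tmul, LinearMap.lTensor_comp,
      LinearMap.flip_apply, TensorProduct.mk_apply] at natural move ⊢
    rw [skewDerFst_vecBraiding_ι_mul a v x hx, skewDer_ι_mul, TensorProduct.tmul_add, map_add,
      map_add, hc.braidFirst_apply, letterAct_apply, natural, move, LinearMap.lTensor_tmul]

theorem symmetrizer_succ_rTensor (n : ℕ) : (symmetrizer c (n + 1)).rTensor M =
    vecMulFst R M ∘ₗ ((symmetrizer c n).rTensor M).lTensor M ∘ₗ skewDerFst c := by
  refine TensorProduct.ext' fun x w => ?_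
  have mk_comp : (symmetrizer c n).rTensor M ∘ₗ (TensorProduct.mk R T M).flip w =
      (TensorProduct.mk R T M).flip w ∘ₗ symmetrizer c n := by ext; simp
  have der_mk := LinearMap.congr_fun (skewDerFst_comp_mk_flip (c := c) w) x
  have mul_mk := LinearMap.congr_fun (vecMulFst_comp_mk_flip (R := R) w)
  simp only [LinearMap.comp_apply, LinearMap.flip_apply, TensorProduct.mk_apply] at der_mk mul_mk
  rw [LinearMap.comp_apply, LinearMap.comp_apply, der_mk, ← LinearMap.lTensor_comp_apply, mk_comp,
    LinearMap.lTensor_comp_apply, mul_mk, ← symmetrizer_succ_apply, LinearMap.rTensor_tmul]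

theorem symmetrizer_comp_vecBraiding (hc : IsYangBaxter c) (n : ℕ) :
    (symmetrizer c n).rTensor M ∘ₗ vecBraiding c =
      vecBraiding c ∘ₗ (symmetrizer c n).lTensor M := by
  induction n with
  | zero =>
    refine TensorProduct.ext' fun v x => ?_
    have split : (symmetrizer c 0).rTensor M = (Algebra.linearMap R T).rTensor M ∘ₗ (ε).rTensor M :=
      LinearMap.rTensor_comp M _ _
    rw [split, LinearMap.comp_apply, LinearMap.comp_apply, counit_vecBraiding]
    simp [symmetrizer_zero_apply, Algebra.algebraMap_eq_smul_one, vecBraiding_one,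
      TensorProduct.smul_tmul']
  | succ n ih =>
    calc (symmetrizer c (n + 1)).rTensor M ∘ₗ vecBraiding c
        = vecMulFst R M ∘ₗ ((symmetrizer c n).rTensor M ∘ₗ vecBraiding c).lTensor M ∘ₗ
            braidFirst c T ∘ₗ (skewDer c).lTensor M := by
          simp only [symmetrizer_succ_rTensor, LinearMap.comp_assoc, skewDerFst_comp_vecBraiding hc,
            LinearMap.lTensor_comp]
      _ = (vecMulFst R M ∘ₗ (vecBraiding c).lTensor M ∘ₗ braidFirst c T) ∘ₗ
            ((symmetrizer c n).lTensor M).lTensor M ∘ₗ (skewDer c).lTensor M := by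
          rw [ih, LinearMap.lTensor_comp]
          simp only [LinearMap.comp_assoc]
          rw [← LinearMap.comp_assoc _ _ (braidFirst c T), braidFirst_comp_lTensor,
            LinearMap.comp_assoc]
      _ = vecBraiding c ∘ₗ (symmetrizer c (n + 1)).lTensor M := by
          rw [← vecBraiding_comp_vecMul, symmetrizer_succ]
          simp only [LinearMap.lTensor_comp, LinearMap.comp_assoc]

end YangBaxter

/-! ### Stability of the relations -/

section Stable

open TensorAlgebra (ι algebraMapInv)

variable {R M : Type*} [CommRing R] [AddCommGroup M] [Module R M]
  {c : M ⊗[R] M →ₗ[R] M ⊗[R] M}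

local notation "T" => TensorAlgebra R M

theorem lTensor_mulRight_mem {z : M ⊗[R] T} (hz : z ∈ lTensorRange M (nicholsIdeal c)) (t : T) :
    (LinearMap.mulRight R t).lTensor M z ∈ lTensorRange M (nicholsIdeal c * ⊤) := by
  suffices lTensorRange M (nicholsIdeal c) ≤
      (lTensorRange M (nicholsIdeal c * ⊤)).comap ((LinearMap.mulRight R t).lTensor M) from this hz
  refine lTensorRange_le fun v y hy => ?_
  rw [Submodule.mem_comap, LinearMap.lTensor_tmul]
  exact tmul_mem_lTensorRange v (Submodule.mul_mem_mul hy trivial)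

variable [Module.Finite R M] [Module.Projective R M]

theorem mem_lTensorRange_of_dual {X : Type*} [AddCommGroup X] [Module R X] {P : Submodule R X}
    {z : M ⊗[R] X} (h : ∀ φ : Module.Dual R M, TensorProduct.lid R X (φ.rTensor X z) ∈ P) :
    z ∈ lTensorRange M P := by
  obtain ⟨q, hq⟩ := (dualTensorHom_bijective (R := R) (M := M) (N := M)).surjective LinearMap.id
  suffices ∀ q, (dualTensorHom R M M q).rTensor X z ∈ lTensorRange M P by
    simpa only [hq, LinearMap.rTensor_id_apply] using this q
  intro q
  induction q with
  | zero => simp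
  | add p q hp hq =>
    rw [map_add, LinearMap.rTensor_add]
    exact Submodule.add_mem _ hp hq
  | tmul φ v =>
    have : (dualTensorHom R M M (φ ⊗ₜ v)).rTensor X = TensorProduct.mk R M X v ∘ₗ
        (TensorProduct.lid R X).toLinearMap ∘ₗ φ.rTensor X :=
      TensorProduct.ext' fun u x => by simp [TensorProduct.smul_tmul]
    rw [this]
    exact tmul_mem_lTensorRange v (h φ)

theorem mem_lTensorRange_nicholsIdeal {z : M ⊗[R] T}
    (h : ∀ n, (symmetrizer c n).lTensor M z = 0) : z ∈ lTensorRange M (nicholsIdeal c) := by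
  refine mem_lTensorRange_of_dual fun φ => (mem_nicholsIdeal c).mpr fun n => ?_
  have natural : symmetrizer c n ∘ₗ (TensorProduct.lid R T).toLinearMap ∘ₗ φ.rTensor T =
      (TensorProduct.lid R T).toLinearMap ∘ₗ φ.rTensor T ∘ₗ (symmetrizer c n).lTensor M :=
    TensorProduct.ext' fun v t => by simp
  have := LinearMap.congr_fun natural z
  rwa [LinearMap.comp_apply, LinearMap.comp_apply, LinearMap.comp_apply, LinearMap.comp_apply, h,
    map_zero, map_zero] at this

theorem mem_rTensorRange_nicholsIdeal {z : T ⊗[R] M}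
    (h : ∀ n, (symmetrizer c n).rTensor M z = 0) : z ∈ rTensorRange M (nicholsIdeal c) := by
  have comm_mem : TensorProduct.comm R T M z ∈ lTensorRange M (nicholsIdeal c) := by
    refine mem_lTensorRange_nicholsIdeal fun n => ?_
    rw [← LinearMap.comm_comp_rTensor_comp_comm_eq, LinearMap.comp_apply, LinearMap.comp_apply]
    simp [h n]
  suffices lTensorRange M (nicholsIdeal c) ≤
      (rTensorRange M (nicholsIdeal c)).comap (TensorProduct.comm R M T).toLinearMap by
    simpa using this comm_mem
  exact lTensorRange_le fun v x hx => by simpa using tmul_mem_rTensorRange v hx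

theorem skewDer_mem_nicholsIdeal {x : T} (hx : x ∈ nicholsIdeal c) :
    skewDer c x ∈ lTensorRange M (nicholsIdeal c) := by
  refine mem_lTensorRange_nicholsIdeal fun n => vecMul_injective ?_
  rw [← symmetrizer_succ_apply, (mem_nicholsIdeal c).mp hx, map_zero]

theorem braidingVec_mem_nicholsIdeal (hc : IsYangBaxter c) {x : T} (hx : x ∈ nicholsIdeal c)
    (u : M) : braidingVec c u x ∈ lTensorRange M (nicholsIdeal c) := by
  refine mem_lTensorRange_nicholsIdeal fun n => ?_
  have := LinearMap.congr_fun (symmetrizer_comp_braidingVec hc n u) x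
  simpa [(mem_nicholsIdeal c).mp hx n] using this

theorem vecBraiding_mem_nicholsIdeal (hc : IsYangBaxter c) {x : T} (hx : x ∈ nicholsIdeal c)
    (v : M) : vecBraiding c (v ⊗ₜ x) ∈ rTensorRange M (nicholsIdeal c) := by
  refine mem_rTensorRange_nicholsIdeal fun n => ?_
  have := LinearMap.congr_fun (symmetrizer_comp_vecBraiding hc n) (v ⊗ₜ x)
  simpa [(mem_nicholsIdeal c).mp hx n] using this

theorem ι_mul_mem_nicholsIdeal {x : T} (hx : x ∈ nicholsIdeal c) (v : M) :
    ι R v * x ∈ nicholsIdeal c := by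
  let P : Submodule R T := nicholsIdeal c ⊔ (lTensorRange M (nicholsIdeal c)).map (vecMul R M)
  have ι_mul_mem (v : M) {x : T} (hx : x ∈ nicholsIdeal c) : ι R v * x ∈ P :=
    Submodule.mem_sup_right ⟨_, tmul_mem_lTensorRange v hx, by simp⟩
  suffices P ≤ nicholsIdeal c from this (ι_mul_mem v hx)
  refine le_nicholsIdeal c ?_ ?_
  · suffices P ≤ LinearMap.ker (algebraMapInv (R := R) (M := M)).toLinearMap from
      fun x hx => this hx
    refine sup_le (fun x hx => algebraMapInv_eq_zero_of_mem_nicholsIdeal c hx) ?_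
    rw [Submodule.map_le_iff_le_comap]
    exact lTensorRange_le fun v x _ => by simp [algebraMapInv_ι]
  · suffices P ≤ (lTensorRange M P).comap (skewDer c) from fun x hx => this hx
    refine sup_le (fun x hx => lTensorRange_mono le_sup_left (skewDer_mem_nicholsIdeal hx)) ?_
    rw [Submodule.map_le_iff_le_comap]
    refine lTensorRange_le fun v x hx => ?_
    rw [Submodule.mem_comap, vecMul_tmul, Submodule.mem_comap, skewDer_ι_mul]
    exact Submodule.add_mem _ (tmul_mem_lTensorRange v (Submodule.mem_sup_left hx))
      (letterAct_mem_lTensorRange c v (fun u y hy => ι_mul_mem u hy) (skewDer_mem_nicholsIdeal hx))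

theorem mul_mem_nicholsIdeal_left (t : T) {x : T} (hx : x ∈ nicholsIdeal c) :
    t * x ∈ nicholsIdeal c := by
  induction t using tensorAlgebra_induction_left with
  | one => rwa [one_mul]
  | smul r t ht => rw [smul_mul_assoc]; exact Submodule.smul_mem _ _ ht
  | add s t hs ht => rw [add_mul]; exact Submodule.add_mem _ hs ht
  | ι_mul v t ht => rw [mul_assoc]; exact ι_mul_mem_nicholsIdeal ht v

theorem tensorAct_mem_nicholsIdeal (hc : IsYangBaxter c) {x : T} (hx : x ∈ nicholsIdeal c)
    (z : M ⊗[R] T) : tensorAct c x z ∈ lTensorRange M (nicholsIdeal c * ⊤) := by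
  induction z with
  | zero => rw [map_zero]; exact Submodule.zero_mem _
  | add a b ha hb => rw [map_add]; exact Submodule.add_mem _ ha hb
  | tmul u s =>
    have := LinearMap.congr_fun (mulRight_comp_tensorAct c x s) (u ⊗ₜ 1)
    simp only [LinearMap.comp_apply, LinearMap.lTensor_tmul, LinearMap.mulRight_apply, one_mul,
      ← braidingVec_apply] at this
    rw [← this]
    exact lTensor_mulRight_mem (braidingVec_mem_nicholsIdeal hc hx u) s

theorem mul_mem_nicholsIdeal_right (hc : IsYangBaxter c) {x : T} (hx : x ∈ nicholsIdeal c)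
    (t : T) : x * t ∈ nicholsIdeal c := by
  suffices nicholsIdeal c * ⊤ ≤ nicholsIdeal c from this (Submodule.mul_mem_mul hx trivial)
  refine le_nicholsIdeal c ?_ ?_
  · suffices nicholsIdeal c * ⊤ ≤ LinearMap.ker (algebraMapInv (R := R) (M := M)).toLinearMap
      from fun x hx => this hx
    refine Submodule.mul_le.mpr fun x hx t _ => ?_
    simp [algebraMapInv_eq_zero_of_mem_nicholsIdeal c hx]
  · suffices nicholsIdeal c * ⊤ ≤ (lTensorRange M (nicholsIdeal c * ⊤)).comap (skewDer c) from
      fun x hx => this hx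
    refine Submodule.mul_le.mpr fun x hx t _ => ?_
    rw [Submodule.mem_comap, skewDer_mul]
    exact Submodule.add_mem _ (lTensor_mulRight_mem (skewDer_mem_nicholsIdeal hx) t)
      (tensorAct_mem_nicholsIdeal hc hx _)

theorem tensorBraiding_nicholsIdeal_left (hc : IsYangBaxter c) {x : T} (hx : x ∈ nicholsIdeal c)
    (t : T) : tensorBraiding c (x ⊗ₜ t) ∈ lTensorRange T (nicholsIdeal c) := by
  induction t using tensorAlgebra_induction_left generalizing x with
  | one => rw [tensorBraiding_one_right]; exact tmul_mem_lTensorRange 1 hx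
  | smul r t ht => rw [TensorProduct.tmul_smul, map_smul]; exact Submodule.smul_mem _ _ (ht hx)
  | add s t hs ht =>
    rw [TensorProduct.tmul_add, map_add]; exact Submodule.add_mem _ (hs hx) (ht hx)
  | ι_mul v t ht =>
    rw [tensorBraiding_mul_right, tensorBraiding_ι_right]
    suffices lTensorRange M (nicholsIdeal c) ≤ (lTensorRange T (nicholsIdeal c)).comap
        ((tensorProd c).flip (t ⊗ₜ 1) ∘ₗ (ι R).rTensor T) from
      this (braidingVec_mem_nicholsIdeal hc hx v)
    refine lTensorRange_le fun a y hy => ?_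
    rw [Submodule.mem_comap, LinearMap.comp_apply, LinearMap.rTensor_tmul, LinearMap.flip_apply,
      tensorProd_tmul, ← tensorBraiding_tmul]
    suffices lTensorRange T (nicholsIdeal c) ≤ (lTensorRange T (nicholsIdeal c)).comap
        ((LinearMap.mulLeft R (ι R a)).rTensor T) from this (ht hy)
    exact lTensorRange_le fun s z hz => tmul_mem_lTensorRange (ι R a * s) hz

theorem rightVecMul_nicholsIdeal (hc : IsYangBaxter c) (v : M) {z : T ⊗[R] T}
    (hz : z ∈ rTensorRange T (nicholsIdeal c)) :
    rightVecMul c v z ∈ rTensorRange T (nicholsIdeal c) := by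
  suffices rTensorRange T (nicholsIdeal c) ≤
      (rTensorRange T (nicholsIdeal c)).comap (rightVecMul c v) from this hz
  refine rTensorRange_le fun s x hx => ?_
  rw [Submodule.mem_comap, rightVecMul_tmul]
  suffices rTensorRange M (nicholsIdeal c) ≤ (rTensorRange T (nicholsIdeal c)).comap
      ((LinearMap.mulRight R s ∘ₗ ι R).lTensor T) from this (vecBraiding_mem_nicholsIdeal hc hx v)
  exact rTensorRange_le fun a y hy => tmul_mem_rTensorRange (ι R a * s) hy

theorem tensorBraiding_nicholsIdeal_right (hc : IsYangBaxter c) (t : T) {x : T}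
    (hx : x ∈ nicholsIdeal c) :
    tensorBraiding c (t ⊗ₜ x) ∈ rTensorRange T (nicholsIdeal c) := by
  induction t using tensorAlgebra_induction_left with
  | one => rw [tensorBraiding_one_left]; exact tmul_mem_rTensorRange 1 hx
  | smul r t ht => rw [← TensorProduct.smul_tmul', map_smul]; exact Submodule.smul_mem _ _ ht
  | add s t hs ht => rw [TensorProduct.add_tmul, map_add]; exact Submodule.add_mem _ hs ht
  | ι_mul v t ht =>
    rw [tensorBraiding_mul_left, rightAct_ι]
    exact rightVecMul_nicholsIdeal hc v ht

end Stable

/-! ### Algebras with a subspace of primitive elements -/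

section TensorSq

variable {R K M N : Type*} [CommRing R] [CommRing K] [Algebra R K] [AddCommGroup M] [Module R M]
  [AddCommGroup N] [Module R N] [Module K N] [IsScalarTower R K N]

@[simp]
theorem tensorSq_tmul (f : M →ₗ[R] N) (x y : M) : tensorSq K f (x ⊗ₜ y) = f x ⊗ₜ f y := by
  simp [tensorSq]

theorem tensorSq_eq_map {N : Type*} [AddCommGroup N] [Module R N] (f : M →ₗ[R] N) :
    tensorSq R f = TensorProduct.map f f :=
  TensorProduct.ext' fun x y => by simp

end TensorSq

section Primitive

open TensorAlgebra (ι ιInv lift)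

variable {K U B : Type*} [CommRing K] [AddCommGroup U] [Module K U] [AddCommGroup B] [Module K B]

local notation "T" => TensorAlgebra K U

/-- The multiplication `μ` with unit `e` makes `B` an associative algebra, and the braiding `d` is
compatible with it in the second argument: `d (a ⊗ e) = e ⊗ a` and
`d (a ⊗ b b') = (1 ⊗ a) (b ⊗ 1) (b' ⊗ 1)` in the braided tensor product `B ⊗ B`. -/
structure IsBraidedAlgebra (μ : B →ₗ[K] B →ₗ[K] B) (e : B) (d : B ⊗[K] B →ₗ[K] B ⊗[K] B) :
    Prop where
  assoc : ∀ a b b', μ (μ a b) b' = μ a (μ b b')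
  one_mul : ∀ a, μ e a = a
  mul_one : ∀ a, μ a e = a
  braid_one : ∀ a, d (a ⊗ₜ e) = e ⊗ₜ a
  braid_mul : ∀ a b b', d (a ⊗ₜ μ b b') = brProd μ d (d (a ⊗ₜ b)) (b' ⊗ₜ e)

/-- The map `u₁ ⋯ uₙ ↦ f u₁ ⋯ f uₙ` from the tensor algebra, for a multiplication `μ` of `B` with
unit `e`. -/
noncomputable def tensorEval (μ : B →ₗ[K] B →ₗ[K] B) (e : B) (f : U →ₗ[K] B) : T →ₗ[K] B :=
  LinearMap.applyₗ e ∘ₗ (lift K (A := Module.End K B) (μ ∘ₗ f)).toLinearMap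

variable {μ : B →ₗ[K] B →ₗ[K] B} {e : B} {f : U →ₗ[K] B}

theorem tensorEval_one : tensorEval μ e f 1 = e := by simp [tensorEval]

theorem tensorEval_ι_mul (u : U) (x : T) :
    tensorEval μ e f (ι K u * x) = μ (f u) (tensorEval μ e f x) := by
  simp [tensorEval]

theorem tensorEval_ι (mul_one : ∀ a, μ a e = a) (u : U) : tensorEval μ e f (ι K u) = f u := by
  rw [← _root_.mul_one (ι K u), tensorEval_ι_mul, tensorEval_one, mul_one]

variable {c : U ⊗[K] U →ₗ[K] U ⊗[K] U} {d : B ⊗[K] B →ₗ[K] B ⊗[K] B}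

namespace IsBraidedAlgebra

theorem tensorEval_mul_ι (hB : IsBraidedAlgebra μ e d) (x : T) (u : U) :
    tensorEval μ e f (x * ι K u) = μ (tensorEval μ e f x) (f u) := by
  suffices tensorEval μ e f ∘ₗ LinearMap.mulRight K (ι K u) = μ.flip (f u) ∘ₗ tensorEval μ e f from
    LinearMap.congr_fun this x
  refine linearMap_ext_left ?_ fun v x hx => ?_
  · simp [tensorEval_ι hB.mul_one, tensorEval_one, hB.one_mul]
  · simp only [LinearMap.comp_apply, LinearMap.mulRight_apply, LinearMap.flip_apply] at hx ⊢
    rw [mul_assoc, tensorEval_ι_mul, hx, tensorEval_ι_mul, hB.assoc]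

theorem brProd_comp_map_tensorEval (hB : IsBraidedAlgebra μ e d) (hf : IsBraidedMap f c d) (w : U) :
    (brProd μ d).flip (f w ⊗ₜ e) ∘ₗ TensorProduct.map (tensorEval μ e f) f =
      TensorProduct.map (tensorEval μ e f) f ∘ₗ crossing c w := by
  refine TensorProduct.ext' fun s v => ?_
  have flip_e : μ.flip e = LinearMap.id := LinearMap.ext hB.mul_one
  have braid_f : d (f v ⊗ₜ f w) = TensorProduct.map f f (c (v ⊗ₜ w)) := by
    simpa [tensorSq_eq_map] using hf (v ⊗ₜ w)
  have eval_mulLeft : tensorEval μ e f ∘ₗ LinearMap.mulLeft K s ∘ₗ ι K =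
      μ (tensorEval μ e f s) ∘ₗ f := LinearMap.ext fun u => hB.tensorEval_mul_ι s u
  simp only [LinearMap.comp_apply, LinearMap.flip_apply, TensorProduct.map_tmul, brProd_tmul,
    brRight_tmul, flip_e, LinearMap.lTensor_id, LinearMap.id_apply, braid_f, crossing_tmul]
  rw [← LinearMap.comp_apply, LinearMap.rTensor_comp_map, ← eval_mulLeft,
    ← LinearMap.map_comp_rTensor, LinearMap.comp_apply]

theorem comp_map_tensorEval (hB : IsBraidedAlgebra μ e d) (hf : IsBraidedMap f c d) :
    d ∘ₗ TensorProduct.map f (tensorEval μ e f) =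
      TensorProduct.map (tensorEval μ e f) f ∘ₗ vecBraiding c := by
  refine TensorProduct.ext (LinearMap.ext fun u => linearMap_ext_right ?_ fun x w hx => ?_)
  · simp [tensorEval_one, hB.braid_one, vecBraiding_one]
  · have := LinearMap.congr_fun (hB.brProd_comp_map_tensorEval hf w) (vecBraiding c (u ⊗ₜ x))
    simp only [LinearMap.compr₂ₛₗ_apply, TensorProduct.mk_apply, LinearMap.comp_apply,
      TensorProduct.map_tmul, LinearMap.flip_apply] at hx this ⊢
    rw [hB.tensorEval_mul_ι, hB.braid_mul, hx, this, vecBraiding_mul_ι]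

theorem brRight_comp_map_tensorEval (hB : IsBraidedAlgebra μ e d) (hf : IsBraidedMap f c d)
    (u : U) : brRight μ d (f u) ∘ₗ TensorProduct.map (tensorEval μ e f) (tensorEval μ e f) =
      TensorProduct.map (tensorEval μ e f) (tensorEval μ e f) ∘ₗ rightVecMul c u := by
  refine TensorProduct.ext' fun s t => ?_
  have braid := LinearMap.congr_fun (hB.comp_map_tensorEval hf) (u ⊗ₜ s)
  have eval_mulRight : tensorEval μ e f ∘ₗ LinearMap.mulRight K t ∘ₗ ι K =
      μ.flip (tensorEval μ e f t) ∘ₗ f := LinearMap.ext fun v => tensorEval_ι_mul v t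
  simp only [LinearMap.comp_apply, TensorProduct.map_tmul] at braid ⊢
  rw [brRight_tmul, braid, rightVecMul_tmul, ← LinearMap.comp_apply, LinearMap.lTensor_comp_map,
    ← eval_mulRight, ← LinearMap.map_comp_lTensor, LinearMap.comp_apply]

theorem comul_tensorEval (hB : IsBraidedAlgebra μ e d) (hf : IsBraidedMap f c d)
    {D : B →ₗ[K] B ⊗[K] B} (D_one : D e = e ⊗ₜ e)
    (D_mul : ∀ u b, D (μ (f u) b) = (μ (f u)).rTensor B (D b) + brRight μ d (f u) (D b)) :
    D ∘ₗ tensorEval μ e f =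
      TensorProduct.map (tensorEval μ e f) (tensorEval μ e f) ∘ₗ comul c := by
  refine linearMap_ext_left ?_ fun u x hx => ?_
  · simp [tensorEval_one, D_one, comul_one]
  · have left : (μ (f u)).rTensor B ∘ₗ TensorProduct.map (tensorEval μ e f) (tensorEval μ e f) =
        TensorProduct.map (tensorEval μ e f) (tensorEval μ e f) ∘ₗ leftVecMul K U u :=
      TensorProduct.ext' fun s t => by simp [tensorEval_ι_mul]
    have right := hB.brRight_comp_map_tensorEval hf u
    replace left := LinearMap.congr_fun left (comul c x)
    replace right := LinearMap.congr_fun right (comul c x)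
    simp only [LinearMap.comp_apply] at hx left right ⊢
    rw [tensorEval_ι_mul, D_mul, hx, left, right, comul_ι_mul, map_add]

end IsBraidedAlgebra

/-- The analogue of the quantum symmetrizer for a comultiplication `D` of `B` with counit `ε` and a
projection `p` to the degree one part `U`. -/
noncomputable def projSymmetrizer (ε : B →ₗ[K] K) (p : B →ₗ[K] U) (D : B →ₗ[K] B ⊗[K] B) :
    ℕ → (B →ₗ[K] T)
  | 0 => Algebra.linearMap K T ∘ₗ ε
  | n + 1 => vecMul K U ∘ₗ TensorProduct.map p (projSymmetrizer ε p D n) ∘ₗ D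

section Projection

variable {ε : B →ₗ[K] K} {p : B →ₗ[K] U} {D : B →ₗ[K] B ⊗[K] B}

/- Only degrees `m ≤ n` are allowed: `p` need not vanish on products of at least two elements of
`f U`, and such a left tensor factor leaves a right one of degree less than `n`, on which
`symmetrizer c n` vanishes. -/
theorem projSymmetrizer_tensorEval (mul_one : ∀ a, μ a e = a) (counit_one : ε e = 1)
    (proj_one : p e = 0) (proj_f : ∀ u, p (f u) = u)
    (comul_eval : D ∘ₗ tensorEval μ e f =
      TensorProduct.map (tensorEval μ e f) (tensorEval μ e f) ∘ₗ comul c)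
    {n m : ℕ} (hmn : m ≤ n) {x : T} (hx : x ∈ tensorDegree K U m) :
    projSymmetrizer ε p D n (tensorEval μ e f x) = symmetrizer c n x := by
  induction n generalizing m x with
  | zero =>
    obtain rfl : m = 0 := by omega
    obtain ⟨r, rfl⟩ := mem_tensorDegree_zero.mp hx
    simp [projSymmetrizer, symmetrizer_zero_apply, Algebra.algebraMap_eq_smul_one, tensorEval_one,
      counit_one]
  | succ n ih =>
    suffices bidegree K U m ≤ LinearMap.eqLocus
        (TensorProduct.map p (projSymmetrizer ε p D n) ∘ₗ
          TensorProduct.map (tensorEval μ e f) (tensorEval μ e f))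
        (TensorProduct.map ιInv (symmetrizer c n)) by
      have comul_x : D (tensorEval μ e f x) =
          TensorProduct.map (tensorEval μ e f) (tensorEval μ e f) (comul c x) :=
        LinearMap.congr_fun comul_eval x
      simp only [projSymmetrizer, symmetrizer, LinearMap.comp_apply, comul_x]
      exact congrArg (vecMul K U) (this (comul_mem_bidegree c hx))
    refine Submodule.span_le.mpr ?_
    rintro _ ⟨i, j, rfl, s, hs, t, ht, rfl⟩
    rw [SetLike.mem_coe, LinearMap.mem_eqLocus, LinearMap.comp_apply, TensorProduct.map_tmul,
      TensorProduct.map_tmul, TensorProduct.map_tmul]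
    match i with
    | 0 =>
      obtain ⟨r, rfl⟩ := mem_tensorDegree_zero.mp hs
      simp [Algebra.algebraMap_eq_smul_one, tensorEval_one, proj_one, ιInv_one]
    | 1 =>
      obtain ⟨u, rfl⟩ := mem_tensorDegree_one.mp hs
      rw [ih (by omega) ht, ιInv_ι, tensorEval_ι mul_one, proj_f]
    | i + 2 =>
      rw [ih (by omega) ht, symmetrizer_eq_zero_of_mem_tensorDegree c (by omega) ht,
        TensorProduct.tmul_zero, TensorProduct.tmul_zero]

theorem IsBraidedAlgebra.finite_nicholsAlgebra [IsNoetherian K B] [Module.Finite K U]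
    (hB : IsBraidedAlgebra μ e d) (hf : IsBraidedMap f c d) (D_one : D e = e ⊗ₜ e)
    (D_mul : ∀ u b, D (μ (f u) b) = (μ (f u)).rTensor B (D b) + brRight μ d (f u) (D b))
    (counit_one : ε e = 1) (proj_one : p e = 0) (proj_f : ∀ u, p (f u) = u) :
    Module.Finite K (NicholsAlgebra c) := by
  have symm_eval {n m : ℕ} (hmn : m ≤ n) {x : T} (hx : x ∈ tensorDegree K U m) :
      projSymmetrizer ε p D n (tensorEval μ e f x) = symmetrizer c n x :=
    projSymmetrizer_tensorEval hB.mul_one counit_one proj_one proj_f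
      (hB.comul_tensorEval hf D_one D_mul) hmn hx
  let F : ℕ →o Submodule K B :=
    ⟨fun n => (tensorDegreeLT K U n).map (tensorEval μ e f),
      fun _ _ h => Submodule.map_mono ((tensorDegreeLT K U).monotone h)⟩
  obtain ⟨N, hN⟩ := monotone_stabilizes_iff_noetherian.mpr ‹IsNoetherian K B› F
  refine Nichols.finite_nicholsAlgebra c (N := N) fun n hn =>
    symmetrizer_eq_zero c fun x hx => ?_
  have eval_mem : tensorEval μ e f x ∈ F (n + 1) :=
    ⟨x, tensorDegree_le_tensorDegreeLT n.lt_succ_self hx, rfl⟩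
  rw [← hN (n + 1) (by omega)] at eval_mem
  obtain ⟨y, hy, eval_y⟩ := eval_mem
  have symm_eval_y : projSymmetrizer ε p D n (tensorEval μ e f y) = symmetrizer c n y := by
    suffices tensorDegreeLT K U N ≤ LinearMap.eqLocus
        (projSymmetrizer ε p D n ∘ₗ tensorEval μ e f) (symmetrizer c n) from this hy
    exact iSup₂_le fun m hm z hz => symm_eval (((Finset.mem_range.mp hm).trans_le hn).le) hz
  rw [← symm_eval le_rfl hx, ← eval_y, symm_eval_y,
    symmetrizer_eq_zero_of_mem_tensorDegreeLT c hn hy]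

end Projection

end Primitive

/-! ### Base change of braided modules -/

section Naturality

open TensorAlgebra (ι algebraMapInv)

variable {R K M N X Y : Type*} [CommRing R] [CommRing K] [Algebra R K] [AddCommGroup M] [Module R M]
  [AddCommGroup N] [Module R N] [Module K N] [IsScalarTower R K N] [AddCommGroup X] [Module R X]
  [AddCommGroup Y] [Module R Y] [Module K Y] [IsScalarTower R K Y]

variable (K) in
/-- The map `M ⊗_R X → N ⊗_K Y`, `x ⊗ y ↦ f x ⊗ g y`, for `R`-linear maps `f` and `g` into modules
over the `R`-algebra `K`. -/
noncomputable def semiMap (f : M →ₗ[R] N) (g : X →ₗ[R] Y) : M ⊗[R] X →ₗ[R] N ⊗[K] Y :=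
  TensorProduct.lift ((((TensorProduct.mk K N Y).restrictScalars₁₂ R R).compl₂ g) ∘ₗ f)

@[simp]
theorem semiMap_tmul (f : M →ₗ[R] N) (g : X →ₗ[R] Y) (x : M) (y : X) :
    semiMap K f g (x ⊗ₜ y) = f x ⊗ₜ g y := by
  simp [semiMap]

theorem semiMap_lTensor {Z : Type*} [AddCommGroup Z] [Module R Z] (f : M →ₗ[R] N) (g : X →ₗ[R] Y)
    (h : Z →ₗ[R] X) (z : M ⊗[R] Z) : semiMap K f g (h.lTensor M z) = semiMap K f (g ∘ₗ h) z := by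
  have : semiMap K f g ∘ₗ h.lTensor M = semiMap K f (g ∘ₗ h) :=
    TensorProduct.ext' fun x y => by simp
  exact LinearMap.congr_fun this z

theorem lTensor_semiMap {Z : Type*} [AddCommGroup Z] [Module R Z] [Module K Z]
    [IsScalarTower R K Z] (f : M →ₗ[R] N) (g : X →ₗ[R] Y) (h : Y →ₗ[K] Z) (z : M ⊗[R] X) :
    h.lTensor N (semiMap K f g z) = semiMap K f (h.restrictScalars R ∘ₗ g) z := by
  have : (h.lTensor N).restrictScalars R ∘ₗ semiMap K f g =
      semiMap K f (h.restrictScalars R ∘ₗ g) := TensorProduct.ext' fun x y => by simp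
  exact LinearMap.congr_fun this z

theorem semiMap_injective [Module.Flat R M] {f : M →ₗ[R] N}
    (hf : Function.Bijective (f.liftBaseChange K)) {g : X →ₗ[R] Y} (hg : Function.Injective g) :
    Function.Injective (semiMap K f g) := by
  let e : M ⊗[R] Y ≃ₗ[R] N ⊗[K] Y := TensorProduct.comm R M Y ≪≫ₗ
    ((TensorProduct.AlgebraTensorModule.cancelBaseChange R K K Y M).symm ≪≫ₗ
      (LinearEquiv.ofBijective _ hf).lTensor Y ≪≫ₗ TensorProduct.comm K Y N).restrictScalars R
  have : semiMap K f g = e.toLinearMap ∘ₗ g.lTensor M :=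
    TensorProduct.ext' fun x y => by simp [e]
  rw [this]
  exact e.injective.comp (Module.Flat.lTensor_preserves_injective_linearMap g hg)

variable (K) in
/-- The map of tensor algebras induced by an `R`-linear map into a module over the `R`-algebra
`K`. -/
noncomputable def tensorMap (f : M →ₗ[R] N) : TensorAlgebra R M →ₐ[R] TensorAlgebra K N :=
  TensorAlgebra.lift R ((ι K).restrictScalars R ∘ₗ f)

@[simp]
theorem tensorMap_ι (f : M →ₗ[R] N) (v : M) : tensorMap K f (ι R v) = ι K (f v) := by
  simp [tensorMap]

theorem vecMul_comp_semiMap (f : M →ₗ[R] N) :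
    (vecMul K N).restrictScalars R ∘ₗ semiMap K f (tensorMap K f).toLinearMap =
      (tensorMap K f).toLinearMap ∘ₗ vecMul R M :=
  TensorProduct.ext' fun v x => by simp

variable {f : M →ₗ[R] N} {c : M ⊗[R] M →ₗ[R] M ⊗[R] M} {d : N ⊗[K] N →ₗ[K] N ⊗[K] N}

namespace IsBraidedMap

theorem braidFirst_semiMap (hf : IsBraidedMap f c d) (g : X →ₗ[R] Y) (z : M ⊗[R] (M ⊗[R] X)) :
    braidFirst d Y (semiMap K f (semiMap K f g) z) =
      semiMap K f (semiMap K f g) (braidFirst c X z) := by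
  suffices (braidFirst d Y).restrictScalars R ∘ₗ semiMap K f (semiMap K f g) =
      semiMap K f (semiMap K f g) ∘ₗ braidFirst c X from LinearMap.congr_fun this z
  refine TensorProduct.ext_threefold' fun v u x => ?_
  have assoc_semiMap : semiMap K f (semiMap K f g) ∘ₗ (TensorProduct.assoc R M M X).toLinearMap ∘ₗ
      (TensorProduct.mk R (M ⊗[R] M) X).flip x =
      ((TensorProduct.assoc K N N Y).toLinearMap ∘ₗ
        (TensorProduct.mk K (N ⊗[K] N) Y).flip (g x)).restrictScalars R ∘ₗ tensorSq K f :=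
    TensorProduct.ext' fun a b => by simp
  have := LinearMap.congr_fun assoc_semiMap (c (v ⊗ₜ u))
  have braid_f := hf (v ⊗ₜ u)
  rw [tensorSq_tmul] at braid_f
  simp only [LinearMap.comp_apply, LinearMap.restrictScalars_apply, semiMap_tmul, braidFirst_tmul,
    LinearEquiv.coe_coe, LinearMap.flip_apply, TensorProduct.mk_apply] at this ⊢
  rw [this, braid_f]

theorem letterAct_semiMap (hf : IsBraidedMap f c d) (v : M) (z : M ⊗[R] TensorAlgebra R M) :
    letterAct d (f v) (semiMap K f (tensorMap K f).toLinearMap z) =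
      semiMap K f (tensorMap K f).toLinearMap (letterAct c v z) := by
  rw [letterAct_apply, ← semiMap_tmul, hf.braidFirst_semiMap, lTensor_semiMap, vecMul_comp_semiMap,
    ← semiMap_lTensor, letterAct_apply]

theorem skewDer_tensorMap (hf : IsBraidedMap f c d) (x : TensorAlgebra R M) :
    skewDer d (tensorMap K f x) = semiMap K f (tensorMap K f).toLinearMap (skewDer c x) := by
  suffices (skewDer d).restrictScalars R ∘ₗ (tensorMap K f).toLinearMap =
      semiMap K f (tensorMap K f).toLinearMap ∘ₗ skewDer c from LinearMap.congr_fun this x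
  refine linearMap_ext_left (by simp [skewDer_one]) fun v x hx => ?_
  simp only [LinearMap.comp_apply, LinearMap.restrictScalars_apply,
    AlgHom.toLinearMap_apply] at hx ⊢
  rw [map_mul, tensorMap_ι, skewDer_ι_mul, hx, hf.letterAct_semiMap, skewDer_ι_mul, map_add,
    semiMap_tmul, AlgHom.toLinearMap_apply]

theorem symmetrizer_comp_tensorMap (hf : IsBraidedMap f c d) (n : ℕ) :
    (symmetrizer d n).restrictScalars R ∘ₗ (tensorMap K f).toLinearMap =
      (tensorMap K f).toLinearMap ∘ₗ symmetrizer c n := by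
  induction n with
  | zero =>
    refine linearMap_ext_left (by simp [symmetrizer_zero_apply]) fun v x _ => ?_
    simp [symmetrizer_zero_apply, algebraMapInv_ι]
  | succ n ih =>
    ext1 x
    have := LinearMap.congr_fun (vecMul_comp_semiMap (K := K) f)
      ((symmetrizer c n).lTensor M (skewDer c x))
    simp only [LinearMap.comp_apply, LinearMap.restrictScalars_apply,
      AlgHom.toLinearMap_apply] at this ⊢
    rw [symmetrizer_succ_apply, hf.skewDer_tensorMap, lTensor_semiMap, ih, ← semiMap_lTensor, this,
      symmetrizer_succ_apply]

theorem symmetrizer_tensorMap (hf : IsBraidedMap f c d) (n : ℕ) (x : TensorAlgebra R M) :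
    symmetrizer d n (tensorMap K f x) = tensorMap K f (symmetrizer c n x) :=
  LinearMap.congr_fun (hf.symmetrizer_comp_tensorMap n) x

end IsBraidedMap

theorem counit_vecMul (z : M ⊗[R] TensorAlgebra R M) : algebraMapInv (vecMul R M z) = 0 := by
  have : (algebraMapInv (R := R) (M := M)).toLinearMap ∘ₗ vecMul R M = 0 :=
    TensorProduct.ext' fun v x => by simp [algebraMapInv_ι]
  exact LinearMap.congr_fun this z

theorem tensorDegreeLT_succ_le (n : ℕ) : tensorDegreeLT R M (n + 1) ≤
    1 ⊔ (lTensorRange M (tensorDegreeLT R M n)).map (vecMul R M) := by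
  refine iSup₂_le fun j hj => ?_
  match j with
  | 0 => exact le_sup_left
  | j + 1 =>
    refine le_sup_of_le_right (tensorDegree_succ_le fun v x hx => ?_)
    have hx' := tensorDegree_le_tensorDegreeLT (by simpa using hj) hx
    exact ⟨_, tmul_mem_lTensorRange v hx', vecMul_tmul v x⟩

theorem eq_zero_of_tensorMap_eq_zero [Module.Flat R M]
    (hf : Function.Bijective (f.liftBaseChange K)) (hK : Function.Injective (algebraMap R K))
    {n : ℕ} {x : TensorAlgebra R M} (hx : x ∈ tensorDegreeLT R M n) (h : tensorMap K f x = 0) :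
    x = 0 := by
  induction n generalizing x with
  | zero => simpa [tensorDegreeLT] using hx
  | succ n ih =>
    obtain ⟨_, ⟨r, rfl⟩, _, ⟨_, ⟨z, rfl⟩, rfl⟩, rfl⟩ :=
      Submodule.mem_sup.mp (tensorDegreeLT_succ_le n hx)
    have vecMul_semiMap := LinearMap.congr_fun (vecMul_comp_semiMap (K := K) f)
      ((tensorDegreeLT R M n).subtype.lTensor M z)
    simp only [LinearMap.comp_apply, LinearMap.restrictScalars_apply, semiMap_lTensor,
      AlgHom.toLinearMap_apply] at vecMul_semiMap
    rw [map_add, ← vecMul_semiMap] at h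
    obtain rfl : r = 0 := hK <| by
      simpa [counit_vecMul, ← Algebra.algebraMap_eq_smul_one,
        IsScalarTower.algebraMap_apply R K (TensorAlgebra K _)] using congrArg algebraMapInv h
    have semi_eq_zero : semiMap K f ((tensorMap K f).toLinearMap ∘ₗ
        (tensorDegreeLT R M n).subtype) z = 0 := vecMul_injective (by simpa using h)
    have injective_on : Function.Injective ((tensorMap K f).toLinearMap ∘ₗ
        (tensorDegreeLT R M n).subtype) :=
      LinearMap.ker_eq_bot.mp (LinearMap.ker_eq_bot'.mpr fun y hy => Subtype.ext (ih y.2 hy))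
    obtain rfl : z = 0 := semiMap_injective hf injective_on (by rw [semi_eq_zero, map_zero])
    simp

theorem tensorMap_injective [Module.Flat R M]
    (hf : Function.Bijective (f.liftBaseChange K)) (hK : Function.Injective (algebraMap R K)) :
    Function.Injective (tensorMap K f) := by
  refine (injective_iff_map_eq_zero _).mpr fun x hx => ?_
  have x_mem : x ∈ ⨆ n, tensorDegreeLT R M n := iSup_tensorDegreeLT.ge trivial
  obtain ⟨n, hn⟩ := (Submodule.mem_iSup_of_directed _
    (tensorDegreeLT R M).monotone.directed_le).mp x_mem
  exact eq_zero_of_tensorMap_eq_zero hf hK hn hx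

theorem IsYangBaxter.of_isBraidedMap [Module.Flat R M]
    (hf : Function.Bijective (f.liftBaseChange K)) (hinj : Function.Injective f)
    (hcd : IsBraidedMap f c d) (hd : IsYangBaxter d) : IsYangBaxter c := by
  intro z
  apply semiMap_injective hf (semiMap_injective hf hinj)
  have lTensor_braiding (z : M ⊗[R] (M ⊗[R] M)) :
      semiMap K f (semiMap K f f) (c.lTensor M z) =
        d.lTensor N (semiMap K f (semiMap K f f) z) := by
    rw [semiMap_lTensor, lTensor_semiMap]
    exact congrArg (semiMap K f · z) (LinearMap.ext fun p => (hcd p).symm)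
  rw [← hcd.braidFirst_semiMap, lTensor_braiding, ← hcd.braidFirst_semiMap, hd, lTensor_braiding,
    ← hcd.braidFirst_semiMap, lTensor_braiding]

end Naturality

/-! ### Orders -/

section Restriction

variable {R K M N : Type*} [CommRing R] [CommRing K] [Algebra R K] [AddCommGroup M] [Module R M]
  [AddCommGroup N] [Module R N] [Module K N] [IsScalarTower R K N] {f : M →ₗ[R] N}

theorem isBraidedMap_restrictBraiding {d : N ⊗[K] N →ₗ[K] N ⊗[K] N}
    (hinj : Function.Injective (tensorSq K f))
    (hd : (LinearMap.range (tensorSq K f)).map (d.restrictScalars R) ≤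
      LinearMap.range (tensorSq K f)) :
    IsBraidedMap f (restrictBraiding f d) d := by
  have exists_restriction : ∃ c, IsBraidedMap f c d := by
    let e := LinearEquiv.ofInjective (tensorSq K f) hinj
    let g := (d.restrictScalars R ∘ₗ tensorSq K f).codRestrict (LinearMap.range (tensorSq K f))
      fun z => hd ⟨_, ⟨z, rfl⟩, rfl⟩
    exact ⟨e.symm.toLinearMap ∘ₗ g, fun z => congrArg Subtype.val (e.apply_symm_apply (g z)).symm⟩
  rw [restrictBraiding, dif_pos exists_restriction]
  exact exists_restriction.choose_spec

end Restriction

namespace IsOrder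

variable {k V : Type*} [Field k] [AddCommGroup V] [Module k V] {c : V ⊗[k] V →ₗ[k] V ⊗[k] V}
  {R : Subring k} {VR : Submodule R V}

theorem flat (h : IsOrder c R VR) : Module.Flat R VR :=
  have := h.projective
  inferInstance

theorem isBraidedMap (h : IsOrder c R VR) : IsBraidedMap VR.subtype (orderBraiding c R VR) c :=
  have := h.flat
  isBraidedMap_restrictBraiding (semiMap_injective h.bijective VR.injective_subtype) h.map_le

theorem isYangBaxter (h : IsOrder c R VR) (hc : IsYangBaxter c) :
    IsYangBaxter (orderBraiding c R VR) :=
  have := h.flat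
  IsYangBaxter.of_isBraidedMap h.bijective VR.injective_subtype h.isBraidedMap hc

theorem tensorMap_injective (h : IsOrder c R VR) :
    Function.Injective (tensorMap k VR.subtype) :=
  have := h.flat
  Nichols.tensorMap_injective h.bijective Subtype.val_injective

theorem orderIdeal_eq (h : IsOrder c R VR) :
    orderIdeal c R VR = nicholsIdeal (orderBraiding c R VR) := by
  ext x
  have mem_orderIdeal : x ∈ orderIdeal c R VR ↔ tensorMap k VR.subtype x ∈ nicholsIdeal c := .rfl
  simp only [mem_orderIdeal, mem_nicholsIdeal, h.isBraidedMap.symmetrizer_tensorMap,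
    map_eq_zero_iff _ h.tensorMap_injective]

theorem exists_symmetrizer_eq_zero (h : IsOrder c R VR)
    [FiniteDimensional k (NicholsAlgebra c)] :
    ∃ N, ∀ n ≥ N, symmetrizer (orderBraiding c R VR) n = 0 := by
  obtain ⟨N, hN⟩ := Nichols.exists_symmetrizer_eq_zero c
  refine ⟨N, fun n hn => LinearMap.ext fun x => h.tensorMap_injective ?_⟩
  rw [← h.isBraidedMap.symmetrizer_tensorMap, hN n hn, LinearMap.zero_apply, LinearMap.zero_apply,
    map_zero]

theorem finite_orderNichols (h : IsOrder c R VR) [FiniteDimensional k (NicholsAlgebra c)] :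
    Module.Finite R (OrderNichols c R VR) := by
  obtain ⟨N, hN⟩ := h.exists_symmetrizer_eq_zero
  have := h.finite
  have := finite_nicholsAlgebra _ hN
  exact .equiv (Submodule.quotEquivOfEq _ _ h.orderIdeal_eq.symm)

end IsOrder

section YetterDrinfeld

variable {k H V : Type*} [Field k] [Ring H] [Bialgebra k H] [AddCommGroup V] [Module k V]
  [Module H V] [IsScalarTower k H V]

variable (k H) in
/-- The orbit map `h ↦ h w` of a vector `w` of an `H`-module. -/
noncomputable def smulVec (w : V) : H →ₗ[k] V :=
  (Algebra.lsmul k k V : H →ₐ[k] Module.End k V).toLinearMap.flip w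

@[simp]
theorem smulVec_apply (w : V) (h : H) : smulVec k H w h = h • w :=
  rfl

variable [YetterDrinfeld k H V]

local notation "δ" => YetterDrinfeld.coact (k := k) (H := H) (V := V)

theorem ydBraiding_tmul (v w : V) :
    ydBraiding k H V (v ⊗ₜ w) = (smulVec k H w).rTensor V (δ v) := by
  have : (TensorProduct.lift (Algebra.lsmul k k V : H →ₐ[k] Module.End k V).toLinearMap).rTensor V
      ∘ₗ (TensorProduct.rightComm k H V V).toLinearMap ∘ₗ (TensorProduct.mk k _ V).flip w =
      (smulVec k H w).rTensor V := TensorProduct.ext' fun h u => by simp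
  exact LinearMap.congr_fun this (δ v)

theorem lTensor_ydBraiding_comp (w x : V) :
    (ydBraiding k H V).lTensor V ∘ₗ (TensorProduct.assoc k V V V).toLinearMap ∘ₗ
        (TensorProduct.mk k (V ⊗[k] V) V).flip x ∘ₗ (smulVec k H w).rTensor V =
      TensorProduct.map (smulVec k H w) ((smulVec k H x).rTensor V) ∘ₗ LinearMap.lTensor H δ :=
  TensorProduct.ext' fun h v => by simp [ydBraiding_tmul]

theorem lTensor_ydBraiding_braidFirst (v w x : V) :
    (ydBraiding k H V).lTensor V (braidFirst (ydBraiding k H V) V (v ⊗ₜ (w ⊗ₜ x))) =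
      TensorProduct.map (smulVec k H w) ((smulVec k H x).rTensor V)
        (TensorProduct.assoc k H H V ((Coalgebra.comul (R := k) (A := H)).rTensor V (δ v))) := by
  have coassoc := LinearMap.congr_fun (YetterDrinfeld.coassoc (k := k) (H := H) (V := V)) v
  have := LinearMap.congr_fun (lTensor_ydBraiding_comp (k := k) (H := H) w x) (δ v)
  simp only [LinearMap.comp_apply, LinearEquiv.coe_coe, LinearMap.flip_apply,
    TensorProduct.mk_apply] at coassoc this
  rw [braidFirst_tmul, ydBraiding_tmul, this, coassoc]

variable (H) in
/-- The left hand side `(h₁ w)₍₋₁₎ h₂ ⊗ (h₁ w)₍₀₎` of the Yetter-Drinfeld compatibility, as a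
function of `h₁ ⊗ h₂`. -/
noncomputable def ydCompatLeft (w : V) : H ⊗[k] H →ₗ[k] H ⊗[k] V :=
  (LinearMap.mul' k H).rTensor V ∘ₗ (TensorProduct.rightComm k H V H).toLinearMap ∘ₗ
    (YetterDrinfeld.coact ∘ₗ smulVec k H w).rTensor H

variable (H) in
/-- The right hand side `h₁ g ⊗ h₂ v` of the Yetter-Drinfeld compatibility, as a function of
`h₁ ⊗ h₂` and `g ⊗ v`. -/
noncomputable def ydCompatRight (z : H ⊗[k] V) : H ⊗[k] H →ₗ[k] H ⊗[k] V :=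
  TensorProduct.map (LinearMap.mul' k H)
    (TensorProduct.lift (Algebra.lsmul k k V : H →ₐ[k] Module.End k V).toLinearMap) ∘ₗ
      (TensorProduct.tensorTensorTensorComm k H H H V).toLinearMap ∘ₗ
        (TensorProduct.mk k (H ⊗[k] H) (H ⊗[k] V)).flip z

theorem ydCompat (w : V) : ydCompatLeft H w ∘ₗ Coalgebra.comul (R := k) (A := H) =
    ydCompatRight H (δ w) ∘ₗ Coalgebra.comul :=
  LinearMap.ext fun h => YetterDrinfeld.compat h w

theorem braidFirst_ydBraiding_left (w x : V) :
    braidFirst (ydBraiding k H V) V ∘ₗ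
        TensorProduct.map (smulVec k H w) ((smulVec k H x).rTensor V) ∘ₗ
          (TensorProduct.assoc k H H V).toLinearMap =
      (TensorProduct.assoc k V V V).toLinearMap ∘ₗ
        ((smulVec k H x).rTensor V ∘ₗ ydCompatLeft H w).rTensor V := by
  refine TensorProduct.ext_threefold fun h g v => ?_
  have smulVec_smul : (smulVec k H x).rTensor V ∘ₗ (LinearMap.mul' k H).rTensor V ∘ₗ
      (TensorProduct.rightComm k H V H).toLinearMap ∘ₗ (TensorProduct.mk k _ H).flip g =
      (smulVec k H (g • x)).rTensor V := TensorProduct.ext' fun a u => by simp [mul_smul]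
  have := LinearMap.congr_fun smulVec_smul (δ (h • w))
  simp only [LinearMap.comp_apply, LinearEquiv.coe_coe, LinearMap.flip_apply,
    TensorProduct.mk_apply] at this
  simp [ydCompatLeft, braidFirst_tmul, ydBraiding_tmul, this]

theorem lTensor_ydBraiding_braidFirst_tmul (x v : V) (z : H ⊗[k] V) :
    (ydBraiding k H V).lTensor V
        (braidFirst (ydBraiding k H V) V (v ⊗ₜ (smulVec k H x).rTensor V z)) =
      TensorProduct.assoc k V V V (((smulVec k H x).rTensor V ∘ₗ ydCompatRight H z ∘ₗ
        Coalgebra.comul).rTensor V (δ v)) := by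
  induction z with
  | zero => simp [ydCompatRight]
  | add a b ha hb =>
    have compat_add : ydCompatRight H (a + b) = ydCompatRight H a + ydCompatRight H b := by
      simp [ydCompatRight, LinearMap.comp_add]
    simp only [map_add, TensorProduct.tmul_add, ha, hb, LinearMap.comp_add, LinearMap.add_comp,
      LinearMap.rTensor_add, LinearMap.add_apply, compat_add]
  | tmul g w =>
    have : TensorProduct.map (smulVec k H (g • x)) ((smulVec k H w).rTensor V) ∘ₗ
        (TensorProduct.assoc k H H V).toLinearMap =
        (TensorProduct.assoc k V V V).toLinearMap ∘ₗ
          ((smulVec k H x).rTensor V ∘ₗ ydCompatRight H (g ⊗ₜ w)).rTensor V :=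
      TensorProduct.ext_threefold fun a b u => by simp [ydCompatRight, mul_smul]
    rw [LinearMap.rTensor_tmul, smulVec_apply, lTensor_ydBraiding_braidFirst,
      ← LinearMap.comp_assoc, LinearMap.rTensor_comp_apply]
    exact LinearMap.congr_fun this _

theorem isYangBaxter_ydBraiding : IsYangBaxter (ydBraiding k H V) := by
  intro z
  let c := ydBraiding k H V
  suffices braidFirst c V ∘ₗ c.lTensor V ∘ₗ braidFirst c V =
      c.lTensor V ∘ₗ braidFirst c V ∘ₗ c.lTensor V from LinearMap.congr_fun this z
  refine TensorProduct.ext_threefold' fun v w x => ?_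
  have := LinearMap.congr_fun (braidFirst_ydBraiding_left (k := k) (H := H) w x)
    ((Coalgebra.comul (R := k) (A := H)).rTensor V (δ v))
  simp only [LinearMap.comp_apply, LinearEquiv.coe_coe] at this
  simp only [c, LinearMap.comp_apply, LinearMap.lTensor_tmul]
  rw [ydBraiding_tmul w x, lTensor_ydBraiding_braidFirst_tmul, lTensor_ydBraiding_braidFirst, this,
    ← LinearMap.rTensor_comp_apply, LinearMap.comp_assoc, ydCompat]

end YetterDrinfeld

/-! ### Quotients of the tensor algebra -/

section TensorSq

variable {R K M N U : Type*} [CommRing R] [CommRing K] [Algebra R K] [AddCommGroup M] [Module R M]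
  [AddCommGroup N] [Module R N] [Module K N] [IsScalarTower R K N] [AddCommGroup U] [Module R U]
  {c : M ⊗[R] M →ₗ[R] M ⊗[R] M} {d : N ⊗[K] N →ₗ[K] N ⊗[K] N}

theorem tensorSq_comp (g : U →ₗ[R] N) (f : M →ₗ[R] U) (z : M ⊗[R] M) :
    tensorSq K (g ∘ₗ f) z = tensorSq K g (tensorSq R f z) := by
  have : tensorSq K (g ∘ₗ f) = tensorSq K g ∘ₗ tensorSq R f :=
    TensorProduct.ext' fun x y => by simp
  exact LinearMap.congr_fun this z

theorem tensorSq_restrictScalars_comp [Module K U] [IsScalarTower R K U] (g : U →ₗ[K] N)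
    (f : M →ₗ[R] U) (z : M ⊗[R] M) :
    tensorSq K (g.restrictScalars R ∘ₗ f) z = tensorSq K g (tensorSq K f z) := by
  have : tensorSq K (g.restrictScalars R ∘ₗ f) =
      (tensorSq K g).restrictScalars R ∘ₗ tensorSq K f := TensorProduct.ext' fun x y => by simp
  exact LinearMap.congr_fun this z

theorem IsBraidedMap.comp {e : U ⊗[R] U →ₗ[R] U ⊗[R] U} {g : U →ₗ[R] N} {f : M →ₗ[R] U}
    (hg : IsBraidedMap g e d) (hf : IsBraidedMap f c e) : IsBraidedMap (g ∘ₗ f) c d := by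
  intro z
  rw [tensorSq_comp, hg, hf, tensorSq_comp]

theorem IsBraidedMap.of_comp [Module K U] [IsScalarTower R K U]
    {e : U ⊗[K] U →ₗ[K] U ⊗[K] U} {g : U →ₗ[K] N} {f : M →ₗ[R] U} (hg : IsBraidedMap g e d)
    (hinj : Function.Injective (tensorSq K g))
    (hgf : IsBraidedMap (g.restrictScalars R ∘ₗ f) c d) : IsBraidedMap f c e := by
  intro z
  apply hinj
  rw [← hg, ← tensorSq_restrictScalars_comp, hgf, tensorSq_restrictScalars_comp]

theorem isBraidedMap_ι : IsBraidedMap (TensorAlgebra.ι R) c (tensorBraiding c) := by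
  intro z
  suffices tensorBraiding c ∘ₗ tensorSq R (TensorAlgebra.ι R) =
      tensorSq R (TensorAlgebra.ι R) ∘ₗ c from LinearMap.congr_fun this z
  refine TensorProduct.ext' fun v u => ?_
  rw [LinearMap.comp_apply, tensorSq_tmul, tensorBraiding_ι_left, vecBraiding_ι,
    LinearMap.comp_apply, tensorSq_eq_map, ← LinearMap.comp_apply, LinearMap.lTensor_comp_rTensor]

theorem tensorSq_injective_of_leftInverse {f : U →ₗ[R] M} {p : M →ₗ[R] U}
    (hpf : p ∘ₗ f = LinearMap.id) : Function.Injective (tensorSq R f) := by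
  refine Function.LeftInverse.injective (g := tensorSq R p) fun z => ?_
  rw [← tensorSq_comp, hpf, tensorSq_eq_map, TensorProduct.map_id, LinearMap.id_apply]

theorem isBraidedMap_restrictBraiding_of_leftInverse {f : U →ₗ[R] M} {p : M →ₗ[R] U}
    (hpf : p ∘ₗ f = LinearMap.id)
    (hl : (LinearMap.range (f.rTensor M)).map c ≤ LinearMap.range (f.lTensor M))
    (hr : (LinearMap.range (f.lTensor M)).map c ≤ LinearMap.range (f.rTensor M)) :
    IsBraidedMap f (restrictBraiding f c) c := by
  refine isBraidedMap_restrictBraiding (tensorSq_injective_of_leftInverse hpf) ?_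
  rintro _ ⟨_, ⟨z, rfl⟩, rfl⟩
  rw [LinearMap.restrictScalars_apply, tensorSq_eq_map]
  obtain ⟨y, hy⟩ := hl ⟨_, ⟨f.lTensor U z, rfl⟩, rfl⟩
  obtain ⟨y', hy'⟩ := hr ⟨_, ⟨f.rTensor U z, rfl⟩, rfl⟩
  rw [show f.rTensor M (f.lTensor U z) = TensorProduct.map f f z from
    LinearMap.congr_fun (LinearMap.rTensor_comp_lTensor ..) z] at hy
  rw [show f.lTensor M (f.rTensor U z) = TensorProduct.map f f z from
    LinearMap.congr_fun (LinearMap.lTensor_comp_rTensor ..) z] at hy'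
  have proj_left : (f ∘ₗ p).lTensor M (c (TensorProduct.map f f z)) =
      c (TensorProduct.map f f z) := by
    rw [← hy, ← LinearMap.lTensor_comp_apply, LinearMap.comp_assoc, hpf, LinearMap.comp_id]
  have proj_right : (f ∘ₗ p).rTensor M (c (TensorProduct.map f f z)) =
      c (TensorProduct.map f f z) := by
    rw [← hy', ← LinearMap.rTensor_comp_apply, LinearMap.comp_assoc, hpf, LinearMap.comp_id]
  refine ⟨TensorProduct.map p p (c (TensorProduct.map f f z)), ?_⟩
  rw [← LinearMap.comp_apply, ← TensorProduct.map_comp, ← LinearMap.rTensor_comp_lTensor,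
    LinearMap.comp_apply, proj_left, proj_right]

end TensorSq

section Span

variable {R K M N Y : Type*} [CommRing R] [CommRing K] [Algebra R K] [AddCommGroup M]
  [Module R M] [AddCommGroup N] [Module R N] [Module K N] [IsScalarTower R K N] [AddCommGroup Y]
  [Module K Y]

theorem span_tmul_eq_top {ι₁ ι₂ : Type*} {f : ι₁ → N} {g : ι₂ → Y}
    (hf : Submodule.span K (Set.range f) = ⊤) (hg : Submodule.span K (Set.range g) = ⊤) :
    Submodule.span K (Set.range fun i : ι₁ × ι₂ => f i.1 ⊗ₜ[K] g i.2) = ⊤ := by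
  rw [← TensorProduct.map₂_mk_top_top_eq_top, ← hf, ← hg, Submodule.map₂_span_span,
    Set.image2_range]
  rfl

theorem span_range_tensorMap {g : M →ₗ[R] N} (hg : Submodule.span K (Set.range g) = ⊤) :
    Submodule.span K (Set.range (tensorMap K g)) = ⊤ := by
  refine Submodule.eq_top_iff'.mpr fun x => ?_
  induction x using tensorAlgebra_induction_left with
  | one => exact Submodule.subset_span ⟨1, map_one _⟩
  | smul a x hx => exact Submodule.smul_mem _ a hx
  | add x y hx hy => exact Submodule.add_mem _ hx hy
  | ι_mul u x hx =>
    have mem_span : TensorAlgebra.ι K u ∈ Submodule.span K (TensorAlgebra.ι K '' Set.range g) := by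
      rw [← Submodule.map_span, hg]
      exact ⟨u, trivial, rfl⟩
    have mul_mem := Submodule.mul_mem_mul mem_span hx
    rw [Submodule.span_mul_span] at mul_mem
    refine Submodule.span_mono ?_ mul_mem
    rintro _ ⟨_, ⟨_, ⟨v, rfl⟩, rfl⟩, _, ⟨y, rfl⟩, rfl⟩
    exact ⟨TensorAlgebra.ι R v * y, by simp⟩

theorem IsBraidedMap.finite_nicholsAlgebra_of_span [Module.Finite K N] {f : M →ₗ[R] N}
    {c : M ⊗[R] M →ₗ[R] M ⊗[R] M} {d : N ⊗[K] N →ₗ[K] N ⊗[K] N} (hf : IsBraidedMap f c d)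
    (hspan : Submodule.span K (Set.range f) = ⊤) {n₀ : ℕ} (h : ∀ n ≥ n₀, symmetrizer c n = 0) :
    Module.Finite K (NicholsAlgebra d) :=
  finite_nicholsAlgebra d fun n hn =>
    LinearMap.ext_on_range (span_range_tensorMap hspan) fun x => by
      rw [hf.symmetrizer_tensorMap, h n hn, LinearMap.zero_apply, map_zero, LinearMap.zero_apply]

end Span

section Coprod

variable {K E P Q : Type*} [CommSemiring K] [AddCommMonoid E] [Module K E] [AddCommMonoid P]
  [Module K P] [AddCommMonoid Q] [Module K Q]

theorem range_rTensor_coprod (f : P →ₗ[K] E) (g : Q →ₗ[K] E) :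
    LinearMap.range ((f.coprod g).rTensor E) =
      LinearMap.range (f.rTensor E) ⊔ LinearMap.range (g.rTensor E) := by
  have : (f.coprod g).rTensor E = (f.rTensor E).coprod (g.rTensor E) ∘ₗ
      (TensorProduct.prodLeft K K P Q E).toLinearMap :=
    TensorProduct.ext' fun ⟨x, y⟩ e => by simp [TensorProduct.add_tmul]
  rw [this, LinearEquiv.range_comp, LinearMap.range_coprod]

theorem range_lTensor_coprod (f : P →ₗ[K] E) (g : Q →ₗ[K] E) :
    LinearMap.range ((f.coprod g).lTensor E) =
      LinearMap.range (f.lTensor E) ⊔ LinearMap.range (g.lTensor E) := by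
  have : (f.coprod g).lTensor E = (f.lTensor E).coprod (g.lTensor E) ∘ₗ
      (TensorProduct.prodRight K K E P Q).toLinearMap :=
    TensorProduct.ext' fun e x => by simp [TensorProduct.tmul_add]
  rw [this, LinearEquiv.range_comp, LinearMap.range_coprod]

end Coprod

section Quotient

variable {R K M B : Type*} [CommRing R] [CommRing K] [Algebra R K] [AddCommGroup M] [Module R M]
  [AddCommGroup B] [Module R B] [Module K B] [IsScalarTower R K B]
  {c : M ⊗[R] M →ₗ[R] M ⊗[R] M} {d : B ⊗[K] B →ₗ[K] B ⊗[K] B} {q : TensorAlgebra R M →ₗ[R] B}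
  {μ : B →ₗ[K] B →ₗ[K] B}

local notation "T" => TensorAlgebra R M

theorem tensorSq_rightAct (hμ : ∀ x y, μ (q x) (q y) = q (x * y))
    (hd : IsBraidedMap q (tensorBraiding c) d) (b : T) (y : T ⊗[R] T) :
    tensorSq K q (rightAct c b y) = brRight μ d (q b) (tensorSq K q y) := by
  suffices tensorSq K q ∘ₗ rightAct c b =
      (brRight μ d (q b)).restrictScalars R ∘ₗ tensorSq K q from LinearMap.congr_fun this y
  refine TensorProduct.ext' fun s t => ?_
  have tensorSq_mulRight : tensorSq K q ∘ₗ (LinearMap.mulRight R t).lTensor T =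
      ((μ.flip (q t)).lTensor B).restrictScalars R ∘ₗ tensorSq K q :=
    TensorProduct.ext' fun x y => by simp [hμ]
  have braid := hd (b ⊗ₜ s)
  have := LinearMap.congr_fun tensorSq_mulRight (tensorBraiding c (b ⊗ₜ s))
  simp only [LinearMap.comp_apply, LinearMap.restrictScalars_apply, tensorSq_tmul] at braid this ⊢
  rw [brRight_tmul, braid, ← this, ← brRight_tensorBraiding, brRight_tmul]
  rfl

theorem tensorSq_tensorProd (hμ : ∀ x y, μ (q x) (q y) = q (x * y))
    (hd : IsBraidedMap q (tensorBraiding c) d) (z y : T ⊗[R] T) :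
    tensorSq K q (tensorProd c z y) = brProd μ d (tensorSq K q z) (tensorSq K q y) := by
  suffices tensorSq K q ∘ₗ (tensorProd c).flip y =
      ((brProd μ d).flip (tensorSq K q y)).restrictScalars R ∘ₗ tensorSq K q from
    LinearMap.congr_fun this z
  refine TensorProduct.ext' fun a b => ?_
  have tensorSq_mulLeft : tensorSq K q ∘ₗ (LinearMap.mulLeft R a).rTensor T =
      ((μ (q a)).rTensor B).restrictScalars R ∘ₗ tensorSq K q :=
    TensorProduct.ext' fun x y => by simp [hμ]
  have := LinearMap.congr_fun tensorSq_mulLeft (rightAct c b y)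
  simp only [LinearMap.comp_apply, LinearMap.restrictScalars_apply, LinearMap.flip_apply,
    tensorSq_tmul] at this ⊢
  rw [tensorProd_tmul, this, tensorSq_rightAct hμ hd, brProd_tmul]

theorem isBraidedAlgebra_of_span (hq : Submodule.span K (Set.range q) = ⊤)
    (hμ : ∀ x y, μ (q x) (q y) = q (x * y)) (hd : IsBraidedMap q (tensorBraiding c) d) :
    IsBraidedAlgebra μ (q 1) d where
  assoc a b b' := by
    have : μ.compr₂ μ = (LinearMap.llcomp K B B B).compl₁₂ μ μ :=
      LinearMap.ext_on_range hq fun x => LinearMap.ext_on_range hq fun y =>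
        LinearMap.ext_on_range hq fun z => by simp [hμ, mul_assoc]
    exact LinearMap.congr_fun (LinearMap.congr_fun₂ this a b) b'
  one_mul a := by
    have : μ (q 1) = LinearMap.id := LinearMap.ext_on_range hq fun x => by simp [hμ]
    exact LinearMap.congr_fun this a
  mul_one a := by
    have : μ.flip (q 1) = LinearMap.id := LinearMap.ext_on_range hq fun x => by simp [hμ]
    exact LinearMap.congr_fun this a
  braid_one a := by
    have : d ∘ₗ (TensorProduct.mk K B B).flip (q 1) = TensorProduct.mk K B B (q 1) :=
      LinearMap.ext_on_range hq fun x => by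
        simpa [tensorBraiding_one_right] using hd (x ⊗ₜ 1)
    exact LinearMap.congr_fun this a
  braid_mul a b b' := by
    have : (LinearMap.llcomp K B B (B ⊗[K] B)).compl₁₂ (TensorProduct.curry d) μ =
        (TensorProduct.curry d).compr₂
          ((brProd μ d).compl₂ ((TensorProduct.mk K B B).flip (q 1))) :=
      LinearMap.ext_on_range hq fun x => LinearMap.ext_on_range hq fun y =>
        LinearMap.ext_on_range hq fun z => by
          have braid := hd (x ⊗ₜ (y * z))
          rw [tensorBraiding_mul_right, tensorSq_tensorProd hμ hd, ← hd] at braid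
          simpa [hμ] using braid
    exact LinearMap.congr_fun (LinearMap.congr_fun₂ this a b) b'

theorem comul_mul_of_span (hq : Submodule.span K (Set.range q) = ⊤)
    (hμ : ∀ x y, μ (q x) (q y) = q (x * y)) (hd : IsBraidedMap q (tensorBraiding c) d)
    {D : B →ₗ[K] B ⊗[K] B} (hD : ∀ x, D (q x) = tensorSq K q (comul c x)) (a b : B) :
    D (μ a b) = brProd μ d (D a) (D b) := by
  have : μ.compr₂ D = (brProd μ d).compl₁₂ D D :=
    LinearMap.ext_on_range hq fun x => LinearMap.ext_on_range hq fun y => by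
      simp [hμ, hD, comul_mul, tensorSq_tensorProd hμ hd]
  exact LinearMap.congr_fun₂ this a b

theorem comul_mul_of_primitive (hq : Submodule.span K (Set.range q) = ⊤)
    (hμ : ∀ x y, μ (q x) (q y) = q (x * y)) (hd : IsBraidedMap q (tensorBraiding c) d)
    {D : B →ₗ[K] B ⊗[K] B} (hD : ∀ x, D (q x) = tensorSq K q (comul c x)) {a : B}
    (ha : D a = a ⊗ₜ q 1 + q 1 ⊗ₜ a) (b : B) :
    D (μ a b) = (μ a).rTensor B (D b) + brRight μ d a (D b) := by
  have one_mul : μ (q 1) = LinearMap.id :=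
    LinearMap.ext (isBraidedAlgebra_of_span hq hμ hd).one_mul
  have brRight_one (z : B ⊗[K] B) : brRight μ d (q 1) z = z := by
    suffices brRight μ d (q 1) = LinearMap.id from LinearMap.congr_fun this z
    have braid_one : d ∘ₗ TensorProduct.mk K B B (q 1) = (TensorProduct.mk K B B).flip (q 1) :=
      LinearMap.ext_on_range hq fun x => by
        simpa [tensorBraiding_one_left] using hd (1 ⊗ₜ x)
    refine TensorProduct.ext' fun s t => ?_
    have := LinearMap.congr_fun braid_one s
    simp only [LinearMap.comp_apply, TensorProduct.mk_apply, LinearMap.flip_apply] at this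
    rw [brRight_tmul, this, LinearMap.lTensor_tmul, LinearMap.flip_apply, one_mul]
    rfl
  rw [comul_mul_of_span hq hμ hd hD, ha, map_add, LinearMap.add_apply, brProd_tmul, brProd_tmul,
    brRight_one, one_mul, LinearMap.rTensor_id, LinearMap.id_apply]

end Quotient

/-! ### Specializations -/

section Specialized

variable {k V : Type*} [Field k] [AddCommGroup V] [Module k V] {c : V ⊗[k] V →ₗ[k] V ⊗[k] V}
  {R : Subring k} {VR : Submodule R V} {K : Type*} [CommRing K] [Algebra R K]

local notation "T" => TensorAlgebra R VR
local notation "B" => Specialized c R VR K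
local notation "q" => specMk c R VR K
local notation "cR" => orderBraiding c R VR

variable (c R VR K) in
theorem span_range_specMk : Submodule.span K (Set.range q) = ⊤ := by
  rw [eq_top_iff, ← Submodule.baseChange_top, Submodule.baseChange_eq_span, Submodule.span_le]
  rintro _ ⟨y, -, rfl⟩
  obtain ⟨x, rfl⟩ := (orderIdeal c R VR).mkQ_surjective y
  exact Submodule.subset_span ⟨x, rfl⟩

variable (K) in
theorem specMk_eq_zero {x : T} (hx : x ∈ orderIdeal c R VR) : q x = 0 := by
  have : (orderIdeal c R VR).mkQ x = 0 := (Submodule.Quotient.mk_eq_zero _).mpr hx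
  rw [specMk, LinearMap.comp_apply, this, map_zero]

section Descent

variable {X : Type*} [AddCommGroup X] [Module R X] [Module K X] [IsScalarTower R K X]

/-- The `K`-linear map on `K ⊗_R B(V_R)` induced by an `R`-linear map on `T(V_R)` which vanishes
on the relations of `B(V_R)`. -/
noncomputable def specLift (F : T →ₗ[R] X) (hF : orderIdeal c R VR ≤ LinearMap.ker F) :
    B →ₗ[K] X :=
  ((orderIdeal c R VR).liftQ F hF).liftBaseChange K

theorem specLift_specMk (F : T →ₗ[R] X) (hF : orderIdeal c R VR ≤ LinearMap.ker F) (x : T) :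
    specLift (K := K) F hF (q x) = F x := by
  simp [specLift, specMk]

theorem exists_specLift₂ {F : T →ₗ[R] T →ₗ[R] X} (h₁ : ∀ x ∈ orderIdeal c R VR, ∀ y, F x y = 0)
    (h₂ : ∀ x, ∀ y ∈ orderIdeal c R VR, F x y = 0) :
    ∃ G : B →ₗ[K] B →ₗ[K] X, ∀ x y, G (q x) (q y) = F x y := by
  let G₁ : B →ₗ[K] T →ₗ[R] X := specLift F fun x hx => LinearMap.ext (h₁ x hx)
  have G₁_specMk (x : T) : G₁ (q x) = F x := specLift_specMk _ _ x
  have le_ker : orderIdeal c R VR ≤ LinearMap.ker G₁.flip := fun y hy =>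
    LinearMap.ext_on_range (span_range_specMk c R VR K) fun x => by
      rw [LinearMap.flip_apply, G₁_specMk, h₂ x y hy, LinearMap.zero_apply]
  refine ⟨(specLift G₁.flip le_ker).flip, fun x y => ?_⟩
  rw [LinearMap.flip_apply, specLift_specMk, LinearMap.flip_apply, G₁_specMk]

end Descent

theorem IsOrder.exists_specMul (h : IsOrder c R VR) (hc : IsYangBaxter c) :
    ∃ μ : B →ₗ[K] B →ₗ[K] B, ∀ x y, μ (q x) (q y) = q (x * y) := by
  have := h.finite
  have := h.projective
  refine exists_specLift₂ (F := (LinearMap.mul R T).compr₂ q)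
    (fun x hx y => specMk_eq_zero K ?_) fun x y hy => specMk_eq_zero K ?_
  · rw [h.orderIdeal_eq] at hx ⊢
    exact mul_mem_nicholsIdeal_right (h.isYangBaxter hc) hx y
  · rw [h.orderIdeal_eq] at hy ⊢
    exact mul_mem_nicholsIdeal_left x hy

theorem isBraidedMap_inducedBraiding {R K M N : Type*} [CommRing R] [CommRing K] [Algebra R K]
    [AddCommGroup M] [Module R M] [AddCommGroup N] [Module R N] [Module K N] [IsScalarTower R K N]
    {f : M →ₗ[R] N} {c : M ⊗[R] M →ₗ[R] M ⊗[R] M}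
    (h : ∃ d : N ⊗[K] N →ₗ[K] N ⊗[K] N, IsBraidedMap f c d) :
    IsBraidedMap f c (inducedBraiding K f c) := by
  rw [inducedBraiding, dif_pos h]
  exact h.choose_spec

theorem IsOrder.isBraidedMap_specBraiding (h : IsOrder c R VR) (hc : IsYangBaxter c) :
    IsBraidedMap q (tensorBraiding cR) (specBraiding c R VR K) := by
  have := h.finite
  have := h.projective
  have lTensorRange_le_ker : lTensorRange T (nicholsIdeal cR) ≤ LinearMap.ker (tensorSq K q) :=
    lTensorRange_le fun x y hy => by
      rw [← h.orderIdeal_eq] at hy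
      rw [LinearMap.mem_ker, tensorSq_tmul, specMk_eq_zero K hy, TensorProduct.tmul_zero]
  have rTensorRange_le_ker : rTensorRange T (nicholsIdeal cR) ≤ LinearMap.ker (tensorSq K q) :=
    rTensorRange_le fun x y hy => by
      rw [← h.orderIdeal_eq] at hy
      rw [LinearMap.mem_ker, tensorSq_tmul, specMk_eq_zero K hy, TensorProduct.zero_tmul]
  let F : T →ₗ[R] T →ₗ[R] B ⊗[K] B := TensorProduct.curry (tensorSq K q ∘ₗ tensorBraiding cR)
  have braid_left : ∀ x ∈ orderIdeal c R VR, ∀ y, F x y = 0 := fun x hx y =>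
    lTensorRange_le_ker <|
      tensorBraiding_nicholsIdeal_left (h.isYangBaxter hc) (h.orderIdeal_eq ▸ hx) y
  have braid_right : ∀ x, ∀ y ∈ orderIdeal c R VR, F x y = 0 := fun x y hy =>
    rTensorRange_le_ker <|
      tensorBraiding_nicholsIdeal_right (h.isYangBaxter hc) x (h.orderIdeal_eq ▸ hy)
  obtain ⟨G, hG⟩ := exists_specLift₂ (K := K) (X := B ⊗[K] B) braid_left braid_right
  refine isBraidedMap_inducedBraiding ⟨TensorProduct.lift G, fun z => ?_⟩
  suffices (TensorProduct.lift G).restrictScalars R ∘ₗ tensorSq K q =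
      tensorSq K q ∘ₗ tensorBraiding cR from LinearMap.congr_fun this z
  exact TensorProduct.ext' fun x y => by simp [hG, F]

theorem IsOrder.exists_specCounit (h : IsOrder c R VR) :
    ∃ ε : B →ₗ[K] K, ∀ x, ε (q x) = algebraMap R K (TensorAlgebra.algebraMapInv x) := by
  refine ⟨specLift (Algebra.linearMap R K ∘ₗ TensorAlgebra.algebraMapInv.toLinearMap)
    fun x hx => ?_, fun x => specLift_specMk _ _ x⟩
  rw [h.orderIdeal_eq] at hx
  simp [algebraMapInv_eq_zero_of_mem_nicholsIdeal _ hx]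

theorem IsOrder.exists_specProj (h : IsOrder c R VR) :
    ∃ π : B →ₗ[K] K ⊗[R] VR, ∀ x, π (q x) = 1 ⊗ₜ TensorAlgebra.ιInv x := by
  refine ⟨specLift (TensorProduct.mk R K VR 1 ∘ₗ TensorAlgebra.ιInv) fun x hx => ?_,
    fun x => specLift_specMk _ _ x⟩
  rw [h.orderIdeal_eq] at hx
  simp [ιInv_eq_zero_of_mem_nicholsIdeal _ hx]

theorem specVec_tmul (a : K) (v : VR) :
    specVec c R VR K (a ⊗ₜ v) = a • q (TensorAlgebra.ι R v) := by
  simp [specVec, specMk, TensorProduct.smul_tmul']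

theorem specDegreeGE_le_ker {X : Type*} [AddCommGroup X] [Module K X] {F : B →ₗ[K] X} {n : ℕ}
    (hF : ∀ m ≥ n, ∀ x ∈ tensorDegree R VR m, F (q x) = 0) :
    specDegreeGE c R VR K n ≤ LinearMap.ker F := by
  refine iSup₂_le fun m hm => ?_
  rw [Submodule.baseChange_eq_span, Submodule.span_le]
  rintro _ ⟨_, ⟨x, hx, rfl⟩, rfl⟩
  exact hF m hm x hx

theorem specDegreeGE_le_ker_specCounit {ε : B →ₗ[K] K}
    (hε : ∀ x, ε (q x) = algebraMap R K (TensorAlgebra.algebraMapInv x)) {n : ℕ} (hn : n ≠ 0) :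
    specDegreeGE c R VR K n ≤ LinearMap.ker ε :=
  specDegreeGE_le_ker fun m hm x hx => by
    obtain ⟨m, rfl⟩ := Nat.exists_eq_succ_of_ne_zero (by omega : m ≠ 0)
    rw [hε, algebraMapInv_eq_zero_of_mem_tensorDegree hx, map_zero]

/-- The inclusion `(u, w) ↦ u + w` of `V_{R,K} ⊕ W` into `K ⊗_R B(V_R)`. -/
noncomputable def sumIncl (W : Submodule K B) : SumSpace c R VR K W →ₗ[K] B :=
  (specVec c R VR K).coprod W.subtype

theorem sumIncl_apply {W : Submodule K B} (u : SumSpace c R VR K W) :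
    sumIncl W u = specVec c R VR K u.1 + u.2 :=
  rfl

theorem IsOrder.exists_specCounit_sumProj {W : Submodule K B} (h : IsOrder c R VR)
    (hW : IsComplemented W) (hdeg : W ≤ specDegreeGE c R VR K 2) :
    ∃ (ε : B →ₗ[K] K) (p : B →ₗ[K] SumSpace c R VR K W), ε (q 1) = 1 ∧ p (q 1) = 0 ∧
      p ∘ₗ sumIncl W = LinearMap.id := by
  obtain ⟨ε, hε⟩ := h.exists_specCounit (K := K)
  obtain ⟨π, hπ⟩ := h.exists_specProj (K := K)
  obtain ⟨W', hW'⟩ := hW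
  have counit_one : ε (q 1) = 1 := by rw [hε, map_one, map_one]
  have proj_one : π (q 1) = 0 := by rw [hπ, ιInv_one, TensorProduct.tmul_zero]
  have counit_W : W ≤ LinearMap.ker ε :=
    hdeg.trans (specDegreeGE_le_ker_specCounit hε two_ne_zero)
  have proj_W : W ≤ LinearMap.ker π := hdeg.trans <| specDegreeGE_le_ker fun m hm x hx => by
    rw [hπ, ιInv_eq_zero_of_mem_tensorDegree (by omega) hx, TensorProduct.tmul_zero]
  have counit_vec : ε ∘ₗ specVec c R VR K = 0 := by ext v; simp [specVec_tmul, hε, algebraMapInv_ι]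
  have proj_vec : π ∘ₗ specVec c R VR K = LinearMap.id := by ext v; simp [specVec_tmul, hπ, ιInv_ι]
  let proj := W.projectionOnto W' hW' ∘ₗ
    (LinearMap.id - specVec c R VR K ∘ₗ π - ε.smulRight (q 1))
  refine ⟨ε, π.prod proj, counit_one, by simp [proj, counit_one, proj_one],
    LinearMap.ext fun u => ?_⟩
  have counit_u : ε (sumIncl W u) = 0 := by
    rw [sumIncl_apply, map_add, show ε u.2 = 0 from counit_W u.2.2, add_zero]
    exact LinearMap.congr_fun counit_vec u.1
  have proj_u : π (sumIncl W u) = u.1 := by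
    rw [sumIncl_apply, map_add, show π u.2 = 0 from proj_W u.2.2, add_zero]
    exact LinearMap.congr_fun proj_vec u.1
  have sub_vec : sumIncl W u - specVec c R VR K u.1 = u.2 := by
    rw [sumIncl_apply, add_sub_cancel_left]
  exact Prod.ext proj_u (by simp [proj, counit_u, proj_u, sub_vec])

theorem specVec_one_tmul (v : VR) : specVec c R VR K (1 ⊗ₜ v) = q (TensorAlgebra.ι R v) := by
  rw [specVec_tmul, one_smul]

variable (R VR K) in
theorem span_range_one_tmul :
    Submodule.span K (Set.range fun v : VR => (1 : K) ⊗ₜ[R] v) = ⊤ := by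
  rw [eq_top_iff, ← Submodule.baseChange_top, Submodule.baseChange_eq_span]
  exact Submodule.span_mono (by rintro _ ⟨v, -, rfl⟩; exact ⟨v, rfl⟩)

theorem specVec_primitive {D : B →ₗ[K] B ⊗[K] B} (hD : IsSpecComul c R VR K D) (v : K ⊗[R] VR) :
    D (specVec c R VR K v) = specVec c R VR K v ⊗ₜ q 1 + q 1 ⊗ₜ specVec c R VR K v := by
  suffices D ∘ₗ specVec c R VR K = (TensorProduct.mk K B B).flip (q 1) ∘ₗ specVec c R VR K +
      TensorProduct.mk K B B (q 1) ∘ₗ specVec c R VR K from LinearMap.congr_fun this v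
  ext v
  simp [specVec_one_tmul, hD _, comul_ι]

namespace IsOrder

theorem map_range_rTensor_specVec_le (h : IsOrder c R VR) (hc : IsYangBaxter c) :
    (LinearMap.range ((specVec c R VR K).rTensor B)).map (specBraiding c R VR K) ≤
      LinearMap.range ((specVec c R VR K).lTensor B) := by
  rw [LinearMap.range_eq_map, ← span_tmul_eq_top (span_range_one_tmul R VR K)
    (span_range_specMk c R VR K), Submodule.map_span, Submodule.map_span, Submodule.span_le]
  rintro _ ⟨_, ⟨_, ⟨⟨v, t⟩, rfl⟩, rfl⟩, rfl⟩
  have braid := h.isBraidedMap_specBraiding (K := K) hc (TensorAlgebra.ι R v ⊗ₜ t)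
  have tensorSq_ι : tensorSq K q ∘ₗ (TensorAlgebra.ι R).lTensor T =
      ((specVec c R VR K).lTensor B).restrictScalars R ∘ₗ
        semiMap K q (TensorProduct.mk R K VR 1) :=
    TensorProduct.ext' fun x u => by simp [specVec_one_tmul]
  rw [tensorSq_tmul, tensorBraiding_ι_left] at braid
  rw [LinearMap.rTensor_tmul, specVec_one_tmul, braid]
  exact ⟨_, (LinearMap.congr_fun tensorSq_ι _).symm⟩

theorem map_range_lTensor_specVec_le (h : IsOrder c R VR) (hc : IsYangBaxter c) :
    (LinearMap.range ((specVec c R VR K).lTensor B)).map (specBraiding c R VR K) ≤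
      LinearMap.range ((specVec c R VR K).rTensor B) := by
  rw [LinearMap.range_eq_map, ← span_tmul_eq_top (span_range_specMk c R VR K)
    (span_range_one_tmul R VR K), Submodule.map_span, Submodule.map_span, Submodule.span_le]
  rintro _ ⟨_, ⟨_, ⟨⟨t, v⟩, rfl⟩, rfl⟩, rfl⟩
  have braid := h.isBraidedMap_specBraiding (K := K) hc (t ⊗ₜ TensorAlgebra.ι R v)
  have tensorSq_ι : tensorSq K q ∘ₗ (TensorAlgebra.ι R).rTensor T =
      ((specVec c R VR K).rTensor B).restrictScalars R ∘ₗ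
        semiMap K (TensorProduct.mk R K VR 1) q :=
    TensorProduct.ext' fun u x => by simp [specVec_one_tmul]
  rw [tensorSq_tmul, tensorBraiding_ι_right] at braid
  rw [LinearMap.lTensor_tmul, specVec_one_tmul, braid]
  exact ⟨_, (LinearMap.congr_fun tensorSq_ι _).symm⟩

theorem isBraidedMap_sumBraiding {W : Submodule K B} (h : IsOrder c R VR) (hc : IsYangBaxter c)
    (hcat : IsCategorical (specBraiding c R VR K) W) {p : B →ₗ[K] SumSpace c R VR K W}
    (hp : p ∘ₗ sumIncl W = LinearMap.id) :
    IsBraidedMap (R := K) (K := K) (M := SumSpace c R VR K W) (N := B) (sumIncl W)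
      (sumBraiding c R VR K W) (specBraiding c R VR K) := by
  have left : (LinearMap.range ((sumIncl W).rTensor B)).map (specBraiding c R VR K) ≤
      LinearMap.range ((sumIncl W).lTensor B) := by
    rw [sumIncl, range_rTensor_coprod, range_lTensor_coprod, Submodule.map_sup, hcat.1]
    exact sup_le_sup_right (h.map_range_rTensor_specVec_le hc) _
  have right : (LinearMap.range ((sumIncl W).lTensor B)).map (specBraiding c R VR K) ≤
      LinearMap.range ((sumIncl W).rTensor B) := by
    rw [sumIncl, range_rTensor_coprod, range_lTensor_coprod, Submodule.map_sup, hcat.2]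
    exact sup_le_sup_right (h.map_range_lTensor_specVec_le hc) _
  exact isBraidedMap_restrictBraiding_of_leftInverse (U := SumSpace c R VR K W) hp left right

variable {W : Submodule K (Specialized c R VR K)}

theorem finite_sumNichols_of_isSpecComul [IsNoetherian K B] (h : IsOrder c R VR)
    (hc : IsYangBaxter c) (hW : IsComplemented W) (hdeg : W ≤ specDegreeGE c R VR K 2)
    (hcat : IsCategorical (specBraiding c R VR K) W) {D : B →ₗ[K] B ⊗[K] B}
    (hD : IsSpecComul c R VR K D) (hprim : ∀ w ∈ W, D w = w ⊗ₜ q 1 + q 1 ⊗ₜ w) :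
    Module.Finite K (SumNichols c R VR K W) := by
  have := h.finite
  obtain ⟨ε, p, counit_one, proj_one, proj_comp⟩ := h.exists_specCounit_sumProj hW hdeg
  obtain ⟨μ, hμ⟩ := h.exists_specMul (K := K) hc
  have hd := h.isBraidedMap_specBraiding (K := K) hc
  have D_sumIncl (u : SumSpace c R VR K W) :
      D (sumIncl W u) = sumIncl W u ⊗ₜ q 1 + q 1 ⊗ₜ sumIncl W u := by
    rw [sumIncl_apply, map_add, specVec_primitive hD, hprim _ u.2.2, TensorProduct.add_tmul,
      TensorProduct.tmul_add, add_add_add_comm]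
  exact (isBraidedAlgebra_of_span (span_range_specMk c R VR K) hμ hd).finite_nicholsAlgebra
    (U := SumSpace c R VR K W) (h.isBraidedMap_sumBraiding hc hcat proj_comp)
    (by rw [hD, comul_one, tensorSq_tmul])
    (fun u => comul_mul_of_primitive (span_range_specMk c R VR K) hμ hd hD (D_sumIncl u))
    counit_one proj_one (LinearMap.congr_fun proj_comp)

theorem finite_sumNichols_of_eq_bot [FiniteDimensional k (NicholsAlgebra c)] (h : IsOrder c R VR)
    (hc : IsYangBaxter c) (hcat : IsCategorical (specBraiding c R VR K) W) (hW : W = ⊥) :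
    Module.Finite K (SumNichols c R VR K W) := by
  have := h.finite
  have : Module.Finite K W := by subst hW; infer_instance
  obtain ⟨N, hN⟩ := h.exists_symmetrizer_eq_zero
  obtain ⟨-, p, -, -, proj_comp⟩ := h.exists_specCounit_sumProj (W := W) (hW ▸ isComplemented_bot)
    (hW.le.trans bot_le)
  let f : VR →ₗ[R] SumSpace c R VR K W :=
    (LinearMap.inl K (K ⊗[R] VR) W).restrictScalars R ∘ₗ TensorProduct.mk R K VR 1
  have span_f : Submodule.span K (Set.range f) = ⊤ := by
    have range_inl : LinearMap.range (LinearMap.inl K (K ⊗[R] VR) W) = ⊤ := by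
      rw [LinearMap.range_inl, Submodule.eq_top_iff']
      exact fun u => Subtype.ext (by simpa [hW] using u.2.2)
    rw [← range_inl, LinearMap.range_eq_map, ← span_range_one_tmul, Submodule.map_span,
      ← Set.range_comp]
    rfl
  have sumIncl_comp : (sumIncl W).restrictScalars R ∘ₗ f = q ∘ₗ TensorAlgebra.ι R :=
    LinearMap.ext fun v => by simp [f, sumIncl_apply, specVec_one_tmul]
  have hf : IsBraidedMap (K := K) (N := SumSpace c R VR K W) f (orderBraiding c R VR)
      (sumBraiding c R VR K W) :=
    IsBraidedMap.of_comp (N := B) (U := SumSpace c R VR K W)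
      (h.isBraidedMap_sumBraiding hc hcat proj_comp)
      (tensorSq_injective_of_leftInverse (U := SumSpace c R VR K W) proj_comp)
      (sumIncl_comp ▸ (h.isBraidedMap_specBraiding hc).comp isBraidedMap_ι)
  exact hf.finite_nicholsAlgebra_of_span (N := SumSpace c R VR K W) span_f hN

theorem eq_bot_of_not_exists_isSpecComul (h : IsOrder c R VR)
    (hdeg : W ≤ specDegreeGE c R VR K 2) (hprim : ∀ w ∈ W, IsPrimitive c R VR K w)
    (hD : ¬ ∃ D, IsSpecComul c R VR K D) : W = ⊥ := by
  obtain ⟨ε, hε⟩ := h.exists_specCounit (K := K)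
  refine (Submodule.eq_bot_iff W).mpr fun w hw => ?_
  have counit_w : ε w = 0 := specDegreeGE_le_ker_specCounit hε two_ne_zero (hdeg hw)
  have counit_one : ε (q 1) = 1 := by rw [hε, map_one, map_one]
  have prim_w : w ⊗ₜ q 1 + q 1 ⊗ₜ w = (0 : B ⊗[K] B) := by
    rw [← hprim w hw, specComul, dif_neg hD, LinearMap.zero_apply]
  simpa [counit_w, counit_one] using
    congrArg ((TensorProduct.rid K B).toLinearMap ∘ₗ ε.lTensor B) prim_w

theorem finite_sumNichols [IsNoetherianRing K] [FiniteDimensional k (NicholsAlgebra c)]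
    (h : IsOrder c R VR) (hc : IsYangBaxter c) (hW : IsComplemented W)
    (hdeg : W ≤ specDegreeGE c R VR K 2) (hcat : IsCategorical (specBraiding c R VR K) W)
    (hprim : ∀ w ∈ W, IsPrimitive c R VR K w) : Module.Finite K (SumNichols c R VR K W) := by
  by_cases hD : ∃ D, IsSpecComul c R VR K D
  · have := h.finite_orderNichols
    have : IsNoetherian K B := isNoetherian_of_isNoetherianRing_of_finite K B
    refine h.finite_sumNichols_of_isSpecComul hc hW hdeg hcat (D := specComul c R VR K) ?_ hprim
    rw [specComul, dif_pos hD]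
    exact hD.choose_spec
  · exact h.finite_sumNichols_of_eq_bot hc hcat (h.eq_bot_of_not_exists_isSpecComul hdeg hprim hD)

end IsOrder

end Specialized

end Nichols

theorem lemma3p5_general {k V : Type*} [Field k] [AddCommGroup V] [Module k V]
    {c : V ⊗[k] V →ₗ[k] V ⊗[k] V} (hc : Nichols.IsYangBaxter c) {R : Subring k}
    {VR : Submodule R V} (hVR : Nichols.IsOrder c R VR) {K : Type*} [CommRing K]
    [IsNoetherianRing K] [Algebra R K] {W : Submodule K (Nichols.Specialized c R VR K)}
    (hW : IsComplemented W) (hW_deg : W ≤ Nichols.specDegreeGE c R VR K 2)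
    (hW_cat : Nichols.IsCategorical (Nichols.specBraiding c R VR K) W)
    (hW_prim : ∀ w ∈ W, Nichols.IsPrimitive c R VR K w)
    (hW_inf : ¬ Module.Finite K (Nichols.SumNichols c R VR K W)) :
    ¬ FiniteDimensional k (Nichols.NicholsAlgebra c) :=
  fun _ => hW_inf (hVR.finite_sumNichols hc hW hW_deg hW_cat hW_prim)

theorem lemma3p5 {k H V : Type*} [Field k] [CharZero k] [Ring H] [HopfAlgebra k H]
    (hS : Function.Bijective (HopfAlgebra.antipode k : H →ₗ[k] H))
    [AddCommGroup V] [Module k V] [Module H V] [IsScalarTower k H V]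
    [Nichols.YetterDrinfeld k H V] [FiniteDimensional k V]
    (R : Subring k) (VR : Submodule R V)
    (hVR : Nichols.IsOrder (Nichols.ydBraiding k H V) R VR)
    (m : Ideal R) [m.IsMaximal]
    (W : Submodule (R ⧸ m) (Nichols.Specialized (Nichols.ydBraiding k H V) R VR (R ⧸ m)))
    (hW_deg : W ≤ Nichols.specDegreeGE (Nichols.ydBraiding k H V) R VR (R ⧸ m) 2)
    (hW_cat : Nichols.IsCategorical
      (Nichols.specBraiding (Nichols.ydBraiding k H V) R VR (R ⧸ m)) W)
    (hW_prim : ∀ w ∈ W, Nichols.IsPrimitive (Nichols.ydBraiding k H V) R VR (R ⧸ m) w)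
    (hW_inf : ¬ Module.Finite (R ⧸ m)
      (Nichols.SumNichols (Nichols.ydBraiding k H V) R VR (R ⧸ m) W)) :
    ¬ FiniteDimensional k (Nichols.NicholsAlgebra (Nichols.ydBraiding k H V)) :=
  letI := Ideal.Quotient.field m
  lemma3p5_general Nichols.isYangBaxter_ydBraiding hVR W.exists_isCompl hW_deg hW_cat hW_prim hW_inf
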